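/- Let $\mathbb{R}^{2,1}$ be $\mathbb{R}^3$ with the inner product $\langle u,v\rangle=u_1v_1+u_2v_2-u_3v_3$, let $a>b>0$ and $c>0$, and let $\mathbb{E}_0=\{(x,y,z): x^2/a^2+y^2/b^2+z^2/c^2=1\}$. For a local parametrization $X(u,v)$ of a surface let $E=\langle X_u,X_u\rangle$, $F=\langle X_u,X_v\rangle$, $G=\langle X_v,X_v\rangle$. Let $u\times v$ be the vector with $\langle u\times v,w\rangle=\det(u,v,w)$ for all $w$, and let $\tilde e,\tilde f,\tilde g$ be the products $\langle X_{uu},n\rangle$, $\langle X_{uv},n\rangle$, $\langle X_{vv},n\rangle$ with $n=X_u\times X_v$. Where $EG-F^2\neq0$, the second fundamental form $II=e\,du^2+2f\,du\,dv+g\,dv^2$ is obtained by replacing $n$ with $N=\pm n/\sqrt{|\langle n,n\rangle|}$. The equation of principal lines is $L_1dv^2+M_1du\,dv+N_1du^2=0$ with $L_1=F\tilde g-G\tilde f$, $M_1=E\tilde g-G\tilde e$, $N_1=E\tilde f-F\tilde e$. The umbilic points are those where $L_1=M_1=N_1=0$; an umbilic point is spacelike if $EG-F^2>0$ there (and then $II=kI$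 for a constant $k$). The tropic $LD$ is the set where $EG-F^2=0$. The set $LPL$ consists of the non-umbilic points where $M_1^2-4L_1N_1=0$. A principal line is a smooth regular curve (parametrized by an open interval) that contains no umbilic point and satisfies the equation of principal lines; a leaf is a principal line not contained in a larger one. Put $m=dv/du$, $\mathcal F(u,v,m)=L_1m^2+M_1m+N_1$. The Lie–Cartan vector field is $(\mathcal F_m,\,m\mathcal F_m,\,-(\mathcal F_u+m\mathcal F_v))$ on $\{\mathcal F=0\}$, and similarly with $r=du/dv$ in the other chart of the projective line of directions. An umbilic point is Darbouxian of type $D_1$ if the surface of principal directions so defined is regular along the projective line over the point and the Lie–Cartan line field has exactly one singular point on this projective line, which is a hyperbolic saddle. A separatrix of an umbilic point $p$ is a leaf one end of which tends to $p$, with tangent direction converging to a direction that is a hyperbolic saddle of the Lie–Cartan field over $p$. Then: (a) The curves $\mathbb{E}_0\cap\{x=0\}$ and $\mathbb{E}_0\cap\{z=0\}$ are principal lines. (b) $\mathbb{E}_0$ has exactly four spacelike umbilic points, $$\left(\pm a\sqrt{\frac{a^2-b^2}{a^2+c^2}},\,0,\,\pm c\sqrt{\frac{b^2+c^2}{a^2+c^2}}\right),$$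 and no other umbilic points. (c) These umbilic points are Darbouxian of type $D_1$. (d) The curve $c_y=\mathbb{E}_0\cap\{y=0\}$ is the union of the umbilic points and of four principal lines, namely the four connected components of $c_y$ minus the umbilic points; these components are exactly the separatrices of the umbilic points of $\mathbb{E}_0$. (e) The tropic is the union of two disjoint (simple) regular closed curves, and these curves are principal lines. (f) The principal lines are globally defined: $LPL=\emptyset$, and at every non-umbilic point of $\mathbb{E}_0$ there are exactly two principal directions. -/

import Mathlib

open scoped ContDiff Topology

noncomputable section

namespace Mink

/-- The underlying vector space `ℝ³` of Minkowski space `ℝ^{2,1}`. -/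
abbrev E3 : Type := Fin 3 → ℝ

/-- The Minkowski inner product `⟨u, v⟩ = u₁v₁ + u₂v₂ - u₃v₃`. -/
def ip (u v : E3) : ℝ := u 0 * v 0 + u 1 * v 1 - u 2 * v 2

/-- The Minkowski norm `‖v‖ = √|⟨v, v⟩|`. -/
def mnorm (v : E3) : ℝ := Real.sqrt |ip v v|

/-- The Minkowski vector product: the formal determinant with rows `(i, j, -k)`, `u`, `v`. -/
def cross (u v : E3) : E3 :=
  ![u 1 * v 2 - u 2 * v 1, -(u 0 * v 2 - u 2 * v 0), -(u 0 * v 1 - u 1 * v 0)]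

/-! ### Local parametrizations and the fundamental forms -/

/-- The partial derivative `X_u`. -/
def dU (X : ℝ × ℝ → E3) (q : ℝ × ℝ) : E3 := fderiv ℝ X q (1, 0)

/-- The partial derivative `X_v`. -/
def dV (X : ℝ × ℝ → E3) (q : ℝ × ℝ) : E3 := fderiv ℝ X q (0, 1)

/-- `X : U → M` is a (smooth, regular) local parametrization of the surface `M ⊆ ℝ³`: `U` is open
in the plane, `X` is smooth and immersive on `U`, and it maps `U` homeomorphically onto a
relatively open subset of `M`. -/
structure IsChart (M : Set E3) (U : Set (ℝ × ℝ)) (X : ℝ × ℝ → E3) : Prop where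
  isOpen : IsOpen U
  smooth : ContDiffOn ℝ ∞ X U
  mapsTo : Set.MapsTo X U M
  injOn : Set.InjOn X U
  immersion : ∀ q ∈ U, LinearIndependent ℝ ![dU X q, dV X q]
  openMap : ∀ V ⊆ U, IsOpen V → ∃ W : Set E3, IsOpen W ∧ X '' V = W ∩ M

/-- `X : U → M` is a local parametrization of `M` with `X q = p`, `q ∈ U`. -/
def IsChartAt (M : Set E3) (p : E3) (U : Set (ℝ × ℝ)) (X : ℝ × ℝ → E3) (q : ℝ × ℝ) : Prop :=
  IsChart M U X ∧ q ∈ U ∧ X q = p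

/-- Coefficients `E`, `F`, `G` of the first fundamental form. -/
def cE (X : ℝ × ℝ → E3) (q : ℝ × ℝ) : ℝ := ip (dU X q) (dU X q)
/-- See `cE`. -/
def cF (X : ℝ × ℝ → E3) (q : ℝ × ℝ) : ℝ := ip (dU X q) (dV X q)
/-- See `cE`. -/
def cG (X : ℝ × ℝ → E3) (q : ℝ × ℝ) : ℝ := ip (dV X q) (dV X q)

/-- `det I = E G - F²`: positive on the Riemannian (spacelike) part, negative on the Lorentzian
(timelike) part, zero on the tropic. -/
def detI (X : ℝ × ℝ → E3) (q : ℝ × ℝ) : ℝ := cE X q * cG X q - cF X q ^ 2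

/-- The sign `ε` in the Gauss map: `1` on the spacelike part, `-1` on the timelike part. -/
def eps (X : ℝ × ℝ → E3) (q : ℝ × ℝ) : ℝ := if 0 < detI X q then 1 else -1

/-- The unnormalised normal `X_u × X_v`, defined also on the tropic. -/
def nrm (X : ℝ × ℝ → E3) (q : ℝ × ℝ) : E3 := cross (dU X q) (dV X q)

/-- The Gauss map `N = ε (X_u × X_v) / ‖X_u × X_v‖` (meaningful off the tropic only). -/
def gauss (X : ℝ × ℝ → E3) (q : ℝ × ℝ) : E3 := (eps X q / mnorm (nrm X q)) • nrm X q

/-- Coefficients `e`, `f`, `g` of the second fundamental form (meaningful off the tropic only). -/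
def ce (X : ℝ × ℝ → E3) (q : ℝ × ℝ) : ℝ := ip (dU (dU X) q) (gauss X q)
/-- See `ce`. -/
def cf (X : ℝ × ℝ → E3) (q : ℝ × ℝ) : ℝ := ip (dV (dU X) q) (gauss X q)
/-- See `ce`. -/
def cg (X : ℝ × ℝ → E3) (q : ℝ × ℝ) : ℝ := ip (dV (dV X) q) (gauss X q)

/-! ### The extended equation of principal lines -/

/-- Second fundamental form with the normal `X_u × X_v` in place of `N`, that is `e`, `f`, `g`
multiplied by `ε ‖X_u × X_v‖`. It makes sense on the tropic too. -/
def te (X : ℝ × ℝ → E3) (q : ℝ × ℝ) : ℝ := ip (dU (dU X) q) (nrm X q)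
/-- See `te`. -/
def tf (X : ℝ × ℝ → E3) (q : ℝ × ℝ) : ℝ := ip (dV (dU X) q) (nrm X q)
/-- See `te`. -/
def tg (X : ℝ × ℝ → E3) (q : ℝ × ℝ) : ℝ := ip (dV (dV X) q) (nrm X q)

/-- The coefficients `L₁`, `M₁`, `N₁` of the equation of principal lines
`L₁ dv² + M₁ du dv + N₁ du² = 0`, extended to the tropic. Off the tropic they are
`‖X_u × X_v‖ (F g - G f)`, `‖X_u × X_v‖ (E g - G e)`, `‖X_u × X_v‖ (E f - F e)` up to the common
sign `ε`, see `coefL_eq`, `coefM_eq`, `coefN_eq`. -/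
def coefL (X : ℝ × ℝ → E3) (q : ℝ × ℝ) : ℝ := cF X q * tg X q - cG X q * tf X q
/-- See `coefL`. -/
def coefM (X : ℝ × ℝ → E3) (q : ℝ × ℝ) : ℝ := cE X q * tg X q - cG X q * te X q
/-- See `coefL`. -/
def coefN (X : ℝ × ℝ → E3) (q : ℝ × ℝ) : ℝ := cE X q * tf X q - cF X q * te X q

theorem ip_smul_right (r : ℝ) (u v : E3) : ip u (r • v) = r * ip u v := by
  simp only [ip, Pi.smul_apply, smul_eq_mul]; ring

/-- Lagrange's identity: `⟨X_u × X_v, X_u × X_v⟩ = -(E G - F²)`. -/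
theorem ip_nrm (X : ℝ × ℝ → E3) (q : ℝ × ℝ) : ip (nrm X q) (nrm X q) = -detI X q := by
  simp [nrm, cross, ip, detI, cE, cF, cG]; ring

theorem mnorm_nrm_ne (X : ℝ × ℝ → E3) (q : ℝ × ℝ) (h : detI X q ≠ 0) : mnorm (nrm X q) ≠ 0 := by
  unfold mnorm
  rw [ip_nrm, abs_neg]
  exact (Real.sqrt_pos.mpr (abs_pos.mpr h)).ne'

theorem coefL_eq (X : ℝ × ℝ → E3) (q : ℝ × ℝ) (h : detI X q ≠ 0) :
    mnorm (nrm X q) * (cF X q * cg X q - cG X q * cf X q) = eps X q * coefL X q := by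
  have := mnorm_nrm_ne X q h
  simp only [cg, cf, gauss, ip_smul_right, coefL, tg, tf]; field_simp

theorem coefM_eq (X : ℝ × ℝ → E3) (q : ℝ × ℝ) (h : detI X q ≠ 0) :
    mnorm (nrm X q) * (cE X q * cg X q - cG X q * ce X q) = eps X q * coefM X q := by
  have := mnorm_nrm_ne X q h
  simp only [cg, ce, gauss, ip_smul_right, coefM, tg, te]; field_simp

theorem coefN_eq (X : ℝ × ℝ → E3) (q : ℝ × ℝ) (h : detI X q ≠ 0) :
    mnorm (nrm X q) * (cE X q * cf X q - cF X q * ce X q) = eps X q * coefN X q := by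
  have := mnorm_nrm_ne X q h
  simp only [cf, ce, gauss, ip_smul_right, coefN, tf, te]; field_simp

/-! ### The principal configuration -/

/-- The tropic `LD`: the points of `M` where the induced metric is degenerate. -/
def tropic (M : Set E3) : Set E3 := {p | ∃ U X q, IsChartAt M p U X q ∧ detI X q = 0}

/-- The umbilic set of `M`: the points where `L₁ = M₁ = N₁ = 0`. -/
def umbilics (M : Set E3) : Set E3 :=
  {p | ∃ U X q, IsChartAt M p U X q ∧ coefL X q = 0 ∧ coefM X q = 0 ∧ coefN X q = 0}

/-- The spacelike umbilic points of `M`: the points of the Riemannian part where `II = k I` for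
some constant `k`. -/
def spacelikeUmbilics (M : Set E3) : Set E3 :=
  {p | ∃ U X q, IsChartAt M p U X q ∧ 0 < detI X q ∧
    ∃ k : ℝ, ce X q = k * cE X q ∧ cf X q = k * cF X q ∧ cg X q = k * cG X q}

/-- The lightlike principal locus: the non-umbilic points where the discriminant of the equation of
principal lines vanishes, so that it determines a unique direction. -/
def LPL (M : Set E3) : Set E3 :=
  {p | p ∉ umbilics M ∧ ∃ U X q, IsChartAt M p U X q ∧
    coefM X q ^ 2 - 4 * coefL X q * coefN X q = 0}

/-- `w` is tangent to `M` at `p` and solves the equation of principal lines; the nonzero such `w`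
span the principal directions. -/
def IsPrincipalVector (M : Set E3) (p w : E3) : Prop :=
  ∃ U X q, IsChartAt M p U X q ∧ ∃ ξ η : ℝ, w = ξ • dU X q + η • dV X q ∧
    coefL X q * η ^ 2 + coefM X q * (ξ * η) + coefN X q * ξ ^ 2 = 0

/-- `γ` is a smooth regular curve on `M` without umbilic points that solves the equation of
principal lines. (Every open interval is diffeomorphic to `ℝ`, so that it is enough to take `ℝ`
as domain of the parameter; closed curves are run through periodically.) -/
structure IsPrincipalCurve (M : Set E3) (γ : ℝ → E3) : Prop where
  smooth : ContDiff ℝ ∞ γ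
  regular : ∀ t, deriv γ t ≠ 0
  mem : ∀ t, γ t ∈ M
  not_umbilic : ∀ t, γ t ∉ umbilics M
  principal : ∀ t, IsPrincipalVector M (γ t) (deriv γ t)

/-- The point set `C` is a principal line of `M`. -/
def IsPrincipalLine (M C : Set E3) : Prop := ∃ γ, IsPrincipalCurve M γ ∧ Set.range γ = C

/-- `C` is a leaf of one of the principal foliations: a principal line that is not contained in a
larger one. -/
def IsLeaf (M C : Set E3) : Prop :=
  IsPrincipalLine M C ∧ ∀ C', IsPrincipalLine M C' → C ⊆ C' → C' = C

/-- `C` is a simple regular (smooth) closed curve. -/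
def IsRegularClosedCurve (C : Set E3) : Prop :=
  ∃ (γ : ℝ → E3) (T : ℝ), 0 < T ∧ ContDiff ℝ ∞ γ ∧ Function.Periodic γ T ∧
    (∀ t, deriv γ t ≠ 0) ∧ Set.InjOn γ (Set.Ico 0 T) ∧ Set.range γ = C

/-! ### Lie-Cartan resolution of an umbilic point -/

/-- `𝓕(u, v, m) = L₁ m² + M₁ m + N₁`: the equation of principal lines with `m = dv/du`. -/
def implF (X : ℝ × ℝ → E3) (z : (ℝ × ℝ) × ℝ) : ℝ :=
  coefL X z.1 * z.2 ^ 2 + coefM X z.1 * z.2 + coefN X z.1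

/-- `𝓖(u, v, r) = L₁ + M₁ r + N₁ r²`: the equation of principal lines with `r = du/dv`. -/
def implG (X : ℝ × ℝ → E3) (z : (ℝ × ℝ) × ℝ) : ℝ :=
  coefL X z.1 + coefM X z.1 * z.2 + coefN X z.1 * z.2 ^ 2

/-- Partial derivative in `u` of a function of `((u, v), m)`. -/
def pu (H : (ℝ × ℝ) × ℝ → ℝ) (z : (ℝ × ℝ) × ℝ) : ℝ := fderiv ℝ H z ((1, 0), 0)
/-- Partial derivative in `v` of a function of `((u, v), m)`. -/
def pv (H : (ℝ × ℝ) × ℝ → ℝ) (z : (ℝ × ℝ) × ℝ) : ℝ := fderiv ℝ H z ((0, 1), 0)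
/-- Partial derivative in `m` of a function of `((u, v), m)`. -/
def pm (H : (ℝ × ℝ) × ℝ → ℝ) (z : (ℝ × ℝ) × ℝ) : ℝ := fderiv ℝ H z ((0, 0), 1)

/-- The Lie-Cartan vector field `(𝓕_m, m 𝓕_m, -(𝓕_u + m 𝓕_v))`. It is tangent to the surface
`𝓕 = 0`, and its integral curves there project to the principal lines. -/
def lieCartan (X : ℝ × ℝ → E3) (z : (ℝ × ℝ) × ℝ) : (ℝ × ℝ) × ℝ :=
  ((pm (implF X) z, z.2 * pm (implF X) z), -(pu (implF X) z + z.2 * pv (implF X) z))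

/-- The Lie-Cartan vector field `(r 𝓖_r, 𝓖_r, -(r 𝓖_u + 𝓖_v))` in the other affine chart of the
projective line of directions. -/
def lieCartan' (X : ℝ × ℝ → E3) (z : (ℝ × ℝ) × ℝ) : (ℝ × ℝ) × ℝ :=
  ((z.2 * pm (implG X) z, pm (implG X) z), -(z.2 * pu (implG X) z + pv (implG X) z))

/-- `z` is a regular point of the surface `𝓕 = 0` and a hyperbolic saddle of the Lie-Cartan vector
field on this surface: the linear part of the field on the tangent plane `ker d𝓕(z)` has a negative
and a positive eigenvalue. -/
def IsLieCartanSaddle (X : ℝ × ℝ → E3) (z : (ℝ × ℝ) × ℝ) : Prop :=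
  implF X z = 0 ∧ fderiv ℝ (implF X) z ≠ 0 ∧ lieCartan X z = 0 ∧
  ∃ (l₁ l₂ : ℝ) (w₁ w₂ : (ℝ × ℝ) × ℝ), l₁ < 0 ∧ 0 < l₂ ∧ w₁ ≠ 0 ∧ w₂ ≠ 0 ∧
    fderiv ℝ (implF X) z w₁ = 0 ∧ fderiv ℝ (implF X) z w₂ = 0 ∧
    fderiv ℝ (lieCartan X) z w₁ = l₁ • w₁ ∧ fderiv ℝ (lieCartan X) z w₂ = l₂ • w₂

/-- `p` is a Darbouxian umbilic point of type `D₁`: in suitable coordinates, the surface of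
directions that solve the equation of principal lines is regular along the projective line over `p`
(both affine charts), and on this projective line the Lie-Cartan line field has exactly one
singular point, which is a hyperbolic saddle. (The coordinates can always be rotated so that the
singular point is not the direction `du = 0`.) -/
def IsDarbouxianD1 (M : Set E3) (p : E3) : Prop :=
  ∃ U X q, IsChartAt M p U X q ∧ coefL X q = 0 ∧ coefM X q = 0 ∧ coefN X q = 0 ∧
    (∀ m : ℝ, fderiv ℝ (implF X) (q, m) ≠ 0) ∧ (∀ r : ℝ, fderiv ℝ (implG X) (q, r) ≠ 0) ∧
    (∃ m₀ : ℝ, IsLieCartanSaddle X (q, m₀) ∧ ∀ m : ℝ, lieCartan X (q, m) = 0 → m = m₀) ∧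
    lieCartan' X (q, 0) ≠ 0

/-- The nonzero tangent vector `w` of `M` at `p` spans a direction that is a hyperbolic saddle of
the Lie-Cartan line field. -/
def IsSaddleVector (M : Set E3) (p w : E3) : Prop :=
  ∃ U X q, IsChartAt M p U X q ∧ ∃ m₀ s : ℝ, s ≠ 0 ∧ IsLieCartanSaddle X (q, m₀) ∧
    w = s • (dU X q + m₀ • dV X q)

/-- `C` is a separatrix of the umbilic point `p`: a leaf of a principal foliation that tends to `p`
at one of its ends in such a way that its lift to the surface of principal directions tends to a
hyperbolic saddle of the Lie-Cartan line field over `p`; that is, the oriented direction of its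
tangent converges to a saddle direction. -/
def IsSeparatrix (M : Set E3) (p : E3) (C : Set E3) : Prop :=
  p ∈ umbilics M ∧ IsLeaf M C ∧
  ∃ γ, IsPrincipalCurve M γ ∧ Set.range γ = C ∧ Filter.Tendsto γ Filter.atTop (𝓝 p) ∧
    ∃ (ρ : ℝ → ℝ) (w : E3), (∀ t, 0 < ρ t) ∧ IsSaddleVector M p w ∧
      Filter.Tendsto (fun t => ρ t • deriv γ t) Filter.atTop (𝓝 w)

/-- The set of all separatrices of umbilic points of `M`. -/
def separatrices (M : Set E3) : Set (Set E3) := {C | ∃ p, IsSeparatrix M p C}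

/-- The ellipsoid `x²/a² + y²/b² + z²/c² = 1`. -/
def ellipsoid (a b c : ℝ) : Set E3 :=
  {p | p 0 ^ 2 / a ^ 2 + p 1 ^ 2 / b ^ 2 + p 2 ^ 2 / c ^ 2 = 1}

/-- The section of the ellipsoid by the coordinate plane on which the `i`-th coordinate is `0`. -/
def planeSection (a b c : ℝ) (i : Fin 3) : Set E3 := {p | p ∈ ellipsoid a b c ∧ p i = 0}

/-- The four points `(± a √((a² - b²)/(a² + c²)), 0, ± c √((b² + c²)/(a² + c²)))`. -/
def fourPoints (a b c : ℝ) : Set E3 :=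
  {p | ∃ s t : ℝ, (s = 1 ∨ s = -1) ∧ (t = 1 ∨ t = -1) ∧
    p = ![s * (a * Real.sqrt ((a ^ 2 - b ^ 2) / (a ^ 2 + c ^ 2))), 0,
      t * (c * Real.sqrt ((b ^ 2 + c ^ 2) / (a ^ 2 + c ^ 2)))]}

end Mink

end

open scoped ContDiff Topology

noncomputable section

namespace Mink

/-! Let n = (x/a², y/b², z/c²) be the conormal, S = diag (1/a², 1/b², 1/c²) and J = diag (1, 1, -1).
In every chart X_u × X_v = λJn with λ ≠ 0, and differentiating S(X, X_u) = S(X, X_v) = 0 shows that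
`te`, `tf`, `tg` are -λ times S on the tangent plane. So the equation of principal lines compares
the forms J and S on that plane; free of charts, it reads Q(w) = det(n, Jw, Sw) = 0 with n·w = 0
(`prinForm`, `IsChart.coef_eq`, `isPrincipalVector_iff`).

Put A = n₀²(1/b² + 1/c²), B = n₁²(1/a² + 1/c²), C = n₂²(1/b² - 1/a²), which are nonnegative because
a > b. The discriminant of the equation is λ⁶ times (A - C)² + B² + 2B(A + C). It is nonnegative and
vanishes only for y = 0, A = C; there Q vanishes on the whole tangent plane, and these are the four
points. This settles the umbilic points, `LPL` and the number of principal directions. The sign of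
EG - F² is that of n₂² - n₀² - n₁², which is positive at the umbilic points. On each coordinate
section every monomial of Q has a vanishing factor, so the section solves the equation; on the
tropic n, Jw, Sw are all orthogonal to Jn when w is tangent to it, so Q(w) = 0 again.

In the coordinates (x, y) the differentials of L₁, M₁, N₁ at an umbilic point are -kr dy, -2k dx, k
dy with k ≠ 0 and r > 0 (`graphChart_coefs`). On the projective line the Lie-Cartan field is km(1 +
rm²), whose only zero is m = 0, and the eigenvalues there are k and -2k: type D₁.

The saddle directions lie in the plane y = 0 (`IsSaddleVector.tangent`). A principal curve that
approaches an umbilic point along such a direction satisfies y = 0 near its end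
(`eventually_eq_zero_of_saddle`) and then everywhere, by uniqueness for a linear equation in y
(`IsPrincipalCurve.forall_eq_zero`). Hence separatrices lie in the section y = 0. Conversely each of
its four arcs between umbilic points is a leaf: a principal line containing it meets y = 0 at
uncountably many parameters, so it is tangent to the section somewhere and stays in it. -/

/-! ### The shape form of the ellipsoid and the form of principal directions -/

/-- The Euclidean bilinear form with matrix `diag (1/a², 1/b², 1/c²)`. -/
def shapeForm (a b c : ℝ) (u v : E3) : ℝ :=
  u 0 * v 0 / a ^ 2 + u 1 * v 1 / b ^ 2 + u 2 * v 2 / c ^ 2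

/-- The quadratic form in `w` whose zeros on the tangent plane of the ellipsoid at `p` are the
principal vectors. -/
def prinForm (a b c : ℝ) (p w : E3) : ℝ :=
  p 0 / a ^ 2 * (1 / b ^ 2 + 1 / c ^ 2) * (w 1 * w 2)
    - p 1 / b ^ 2 * (1 / a ^ 2 + 1 / c ^ 2) * (w 0 * w 2)
    + p 2 / c ^ 2 * (1 / b ^ 2 - 1 / a ^ 2) * (w 0 * w 1)

/-- The discriminant of `prinForm` on the tangent plane at `p`, as a function of the conormal. -/
def prinDisc (a b c : ℝ) (p : E3) : ℝ :=
  ((p 0 / a ^ 2) ^ 2 * (1 / b ^ 2 + 1 / c ^ 2) - (p 2 / c ^ 2) ^ 2 * (1 / b ^ 2 - 1 / a ^ 2)) ^ 2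
    + ((p 1 / b ^ 2) ^ 2 * (1 / a ^ 2 + 1 / c ^ 2)) ^ 2
    + 2 * ((p 1 / b ^ 2) ^ 2 * (1 / a ^ 2 + 1 / c ^ 2)) *
      ((p 0 / a ^ 2) ^ 2 * (1 / b ^ 2 + 1 / c ^ 2) + (p 2 / c ^ 2) ^ 2 * (1 / b ^ 2 - 1 / a ^ 2))

theorem mem_ellipsoid_iff {a b c : ℝ} {p : E3} :
    p ∈ ellipsoid a b c ↔ shapeForm a b c p p = 1 := by
  simp [ellipsoid, shapeForm, sq]

theorem shapeForm_comm (a b c : ℝ) (u v : E3) : shapeForm a b c u v = shapeForm a b c v u := by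
  simp only [shapeForm]; ring

theorem fderiv_shapeForm (a b c : ℝ) {F G : ℝ × ℝ → E3} {q : ℝ × ℝ}
    (hF : DifferentiableAt ℝ F q) (hG : DifferentiableAt ℝ G q) (v : ℝ × ℝ) :
    fderiv ℝ (fun x => shapeForm a b c (F x) (G x)) q v =
      shapeForm a b c (fderiv ℝ F q v) (G q) + shapeForm a b c (F q) (fderiv ℝ G q v) := by
  have hF' := hasFDerivAt_pi'.1 hF.hasFDerivAt
  have hG' := hasFDerivAt_pi'.1 hG.hasFDerivAt
  have h := ((((hF' 0).mul (hG' 0)).mul_const (a ^ 2)⁻¹).add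
    (((hF' 1).mul (hG' 1)).mul_const (b ^ 2)⁻¹)).add (((hF' 2).mul (hG' 2)).mul_const (c ^ 2)⁻¹)
  have h2 : HasFDerivAt (fun x => shapeForm a b c (F x) (G x)) _ q := h
  rw [h2.fderiv]
  simp [shapeForm]
  ring

theorem IsChart.contDiffAt {M : Set E3} {U : Set (ℝ × ℝ)} {X : ℝ × ℝ → E3} (h : IsChart M U X)
    {q : ℝ × ℝ} (hq : q ∈ U) : ContDiffAt ℝ ∞ X q :=
  h.smooth.contDiffAt (h.isOpen.mem_nhds hq)

/-! ### Smoothness of the coefficients of the equation of principal lines -/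

theorem contDiffAt_dU {X : ℝ × ℝ → E3} {q : ℝ × ℝ} (h : ContDiffAt ℝ ∞ X q) :
    ContDiffAt ℝ ∞ (dU X) q :=
  (h.fderiv_right (m := ∞) (by simp)).clm_apply contDiffAt_const

theorem contDiffAt_dV {X : ℝ × ℝ → E3} {q : ℝ × ℝ} (h : ContDiffAt ℝ ∞ X q) :
    ContDiffAt ℝ ∞ (dV X) q :=
  (h.fderiv_right (m := ∞) (by simp)).clm_apply contDiffAt_const

theorem contDiffAt_ip {F G : ℝ × ℝ → E3} {q : ℝ × ℝ} (hF : ContDiffAt ℝ ∞ F q)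
    (hG : ContDiffAt ℝ ∞ G q) : ContDiffAt ℝ ∞ (fun x => ip (F x) (G x)) q := by
  have hF' := contDiffAt_pi.1 hF
  have hG' := contDiffAt_pi.1 hG
  exact (((hF' 0).mul (hG' 0)).add ((hF' 1).mul (hG' 1))).sub ((hF' 2).mul (hG' 2))

theorem contDiffAt_nrm {X : ℝ × ℝ → E3} {q : ℝ × ℝ} (h : ContDiffAt ℝ ∞ X q) :
    ContDiffAt ℝ ∞ (nrm X) q := by
  have hF' := contDiffAt_pi.1 (contDiffAt_dU h)
  have hG' := contDiffAt_pi.1 (contDiffAt_dV h)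
  refine contDiffAt_pi.2 fun i => ?_
  fin_cases i
  · exact ((hF' 1).mul (hG' 2)).sub ((hF' 2).mul (hG' 1))
  · exact (((hF' 0).mul (hG' 2)).sub ((hF' 2).mul (hG' 0))).neg
  · exact (((hF' 0).mul (hG' 1)).sub ((hF' 1).mul (hG' 0))).neg

theorem contDiffAt_coefL {X : ℝ × ℝ → E3} {q : ℝ × ℝ} (h : ContDiffAt ℝ ∞ X q) :
    ContDiffAt ℝ ∞ (coefL X) q :=
  ((contDiffAt_ip (contDiffAt_dU h) (contDiffAt_dV h)).mul
    (contDiffAt_ip (contDiffAt_dV (contDiffAt_dV h)) (contDiffAt_nrm h))).sub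
  ((contDiffAt_ip (contDiffAt_dV h) (contDiffAt_dV h)).mul
    (contDiffAt_ip (contDiffAt_dV (contDiffAt_dU h)) (contDiffAt_nrm h)))

theorem contDiffAt_coefM {X : ℝ × ℝ → E3} {q : ℝ × ℝ} (h : ContDiffAt ℝ ∞ X q) :
    ContDiffAt ℝ ∞ (coefM X) q :=
  ((contDiffAt_ip (contDiffAt_dU h) (contDiffAt_dU h)).mul
    (contDiffAt_ip (contDiffAt_dV (contDiffAt_dV h)) (contDiffAt_nrm h))).sub
  ((contDiffAt_ip (contDiffAt_dV h) (contDiffAt_dV h)).mul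
    (contDiffAt_ip (contDiffAt_dU (contDiffAt_dU h)) (contDiffAt_nrm h)))

theorem contDiffAt_coefN {X : ℝ × ℝ → E3} {q : ℝ × ℝ} (h : ContDiffAt ℝ ∞ X q) :
    ContDiffAt ℝ ∞ (coefN X) q :=
  ((contDiffAt_ip (contDiffAt_dU h) (contDiffAt_dU h)).mul
    (contDiffAt_ip (contDiffAt_dV (contDiffAt_dU h)) (contDiffAt_nrm h))).sub
  ((contDiffAt_ip (contDiffAt_dU h) (contDiffAt_dV h)).mul
    (contDiffAt_ip (contDiffAt_dU (contDiffAt_dU h)) (contDiffAt_nrm h)))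

/-- The factor `λ` with `X_u × X_v = λ ∇φ / 2` (Euclidean vector product), where `φ = 1` is the
equation of the ellipsoid. -/
def conormalFactor (a b c : ℝ) (X : ℝ × ℝ → E3) (q : ℝ × ℝ) : ℝ :=
  (nrm X q 0 * (X q 0 / a ^ 2) + nrm X q 1 * (X q 1 / b ^ 2) - nrm X q 2 * (X q 2 / c ^ 2)) /
    ((X q 0 / a ^ 2) ^ 2 + (X q 1 / b ^ 2) ^ 2 + (X q 2 / c ^ 2) ^ 2)

/-! ### Normal, second fundamental form and discriminant of the ellipsoid in a chart -/

section
variable {a b c : ℝ} {U : Set (ℝ × ℝ)} {X : ℝ × ℝ → E3} {q : ℝ × ℝ}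

theorem IsChart.shapeForm_eq_one (h : IsChart (ellipsoid a b c) U X) (hq : q ∈ U) :
    shapeForm a b c (X q) (X q) = 1 := mem_ellipsoid_iff.1 (h.mapsTo hq)

theorem fderiv_eq_zero_of_eqOn {U : Set (ℝ × ℝ)} (hU : IsOpen U) {f : ℝ × ℝ → ℝ} {k : ℝ}
    (hf : ∀ x ∈ U, f x = k) {q : ℝ × ℝ} (hq : q ∈ U) : fderiv ℝ f q = 0 := by
  have : f =ᶠ[𝓝 q] fun _ => k := Filter.eventually_of_mem (hU.mem_nhds hq) hf
  rw [this.fderiv_eq]; simp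

theorem IsChart.shapeForm_fderiv (h : IsChart (ellipsoid a b c) U X) (hq : q ∈ U) (v : ℝ × ℝ) :
    shapeForm a b c (X q) (fderiv ℝ X q v) = 0 := by
  have hX := (h.contDiffAt hq).differentiableAt (by simp)
  have h1 := fderiv_shapeForm a b c hX hX v
  rw [fderiv_eq_zero_of_eqOn h.isOpen (fun x hx => h.shapeForm_eq_one hx) hq,
    shapeForm_comm a b c (fderiv ℝ X q v)] at h1
  simp at h1
  linarith

theorem IsChart.shapeForm_dU (h : IsChart (ellipsoid a b c) U X) (hq : q ∈ U) :
    shapeForm a b c (X q) (dU X q) = 0 := h.shapeForm_fderiv hq _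

theorem IsChart.shapeForm_dV (h : IsChart (ellipsoid a b c) U X) (hq : q ∈ U) :
    shapeForm a b c (X q) (dV X q) = 0 := h.shapeForm_fderiv hq _

/-- Product rule for S(X, Y) = 0. With Y = X_u or X_v it trades the second derivatives of X in `te`,
`tf`, `tg` for values of S on first derivatives. -/
theorem IsChart.shapeForm_second (h : IsChart (ellipsoid a b c) U X) (hq : q ∈ U)
    {Y : ℝ × ℝ → E3} (hY : DifferentiableAt ℝ Y q)
    (hXY : ∀ x ∈ U, shapeForm a b c (X x) (Y x) = 0) (v : ℝ × ℝ) :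
    shapeForm a b c (X q) (fderiv ℝ Y q v) = -shapeForm a b c (fderiv ℝ X q v) (Y q) := by
  have hX := (h.contDiffAt hq).differentiableAt (by simp)
  have h1 := fderiv_shapeForm a b c hX hY v
  rw [fderiv_eq_zero_of_eqOn h.isOpen hXY hq] at h1
  simp at h1
  linarith

theorem conormal_sq_pos {p : E3} (hp : shapeForm a b c p p = 1) :
    0 < (p 0 / a ^ 2) ^ 2 + (p 1 / b ^ 2) ^ 2 + (p 2 / c ^ 2) ^ 2 := by
  by_contra hn
  have h0 : p 0 / a ^ 2 = 0 := by
    nlinarith [sq_nonneg (p 0 / a ^ 2), sq_nonneg (p 1 / b ^ 2), sq_nonneg (p 2 / c ^ 2)]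
  have h1 : p 1 / b ^ 2 = 0 := by
    nlinarith [sq_nonneg (p 0 / a ^ 2), sq_nonneg (p 1 / b ^ 2), sq_nonneg (p 2 / c ^ 2)]
  have h2 : p 2 / c ^ 2 = 0 := by
    nlinarith [sq_nonneg (p 0 / a ^ 2), sq_nonneg (p 1 / b ^ 2), sq_nonneg (p 2 / c ^ 2)]
  have : shapeForm a b c p p = p 0 * (p 0 / a ^ 2) + p 1 * (p 1 / b ^ 2) + p 2 * (p 2 / c ^ 2) := by
    simp only [shapeForm]; ring
  rw [this, h0, h1, h2] at hp
  simp at hp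

/-- X_u and X_v are Euclidean orthogonal to the conormal, so their Euclidean vector product is a
multiple of it; the Minkowski product differs by the sign of the last entry. -/
theorem IsChart.nrm_eq (h : IsChart (ellipsoid a b c) U X) (hq : q ∈ U) :
    nrm X q = ![conormalFactor a b c X q * (X q 0 / a ^ 2),
      conormalFactor a b c X q * (X q 1 / b ^ 2),
      -(conormalFactor a b c X q * (X q 2 / c ^ 2))] := by
  have hP := h.shapeForm_dU hq
  have hR := h.shapeForm_dV hq
  have hpos := conormal_sq_pos (h.shapeForm_eq_one hq)
  simp only [conormalFactor, nrm, cross]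
  simp only [shapeForm] at hP hR
  generalize dU X q = P at *
  generalize dV X q = R at *
  have hP' : X q 0 / a ^ 2 * P 0 + X q 1 / b ^ 2 * P 1 + X q 2 / c ^ 2 * P 2 = 0 := by
    rw [← hP]; ring
  have hR' : X q 0 / a ^ 2 * R 0 + X q 1 / b ^ 2 * R 1 + X q 2 / c ^ 2 * R 2 = 0 := by
    rw [← hR]; ring
  clear hP hR
  generalize X q 0 / a ^ 2 = n0 at *
  generalize X q 1 / b ^ 2 = n1 at *
  generalize X q 2 / c ^ 2 = n2 at *
  ext i
  fin_cases i
  · simp; field_simp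
    linear_combination (n1 * R 2 - n2 * R 1) * hP' + (-n1 * P 2 + n2 * P 1) * hR'
  · simp; field_simp
    linear_combination (-n0 * R 2 + n2 * R 0) * hP' + (n0 * P 2 - n2 * P 0) * hR'
  · simp; field_simp
    linear_combination (-n0 * R 1 + n1 * R 0) * hP' + (n0 * P 1 - n1 * P 0) * hR'

theorem cross_ne_zero {P R : E3} (h : LinearIndependent ℝ ![P, R]) : cross P R ≠ 0 := by
  intro h0
  rw [LinearIndependent.pair_iff] at h
  have e0 := congrFun h0 0
  have e1 := congrFun h0 1
  have e2 := congrFun h0 2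
  simp [cross] at e0 e1 e2
  have key : ∀ i, R i = 0 ∧ P i = 0 := by
    intro i
    have := h (R i) (-P i) (by
      ext j
      fin_cases i <;> fin_cases j <;> simp <;> linarith)
    simpa using this
  have := h 1 0 (by ext j; simp [(key j).2])
  simp at this

theorem IsChart.conormalFactor_ne (h : IsChart (ellipsoid a b c) U X) (hq : q ∈ U) :
    conormalFactor a b c X q ≠ 0 := by
  intro h0
  have h1 := h.nrm_eq hq
  rw [h0] at h1
  apply cross_ne_zero (h.immersion q hq)
  change nrm X q = 0
  rw [h1]
  ext i; fin_cases i <;> simp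

theorem IsChart.ip_nrm_eq (h : IsChart (ellipsoid a b c) U X) (hq : q ∈ U) (w : E3) :
    ip w (nrm X q) = conormalFactor a b c X q * shapeForm a b c (X q) w := by
  rw [h.nrm_eq hq]
  simp [ip, shapeForm]
  ring

theorem IsChart.te_eq (h : IsChart (ellipsoid a b c) U X) (hq : q ∈ U) :
    te X q = -conormalFactor a b c X q * shapeForm a b c (dU X q) (dU X q) := by
  rw [te, h.ip_nrm_eq hq, show dU (dU X) q = fderiv ℝ (dU X) q (1, 0) from rfl,
    h.shapeForm_second hq ((contDiffAt_dU (h.contDiffAt hq)).differentiableAt (by simp))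
      (fun x hx => h.shapeForm_dU hx)]
  simp [dU]

theorem IsChart.tf_eq (h : IsChart (ellipsoid a b c) U X) (hq : q ∈ U) :
    tf X q = -conormalFactor a b c X q * shapeForm a b c (dU X q) (dV X q) := by
  rw [tf, h.ip_nrm_eq hq, show dV (dU X) q = fderiv ℝ (dU X) q (0, 1) from rfl,
    h.shapeForm_second hq ((contDiffAt_dU (h.contDiffAt hq)).differentiableAt (by simp))
      (fun x hx => h.shapeForm_dU hx), shapeForm_comm]
  simp [dU, dV]

theorem IsChart.tg_eq (h : IsChart (ellipsoid a b c) U X) (hq : q ∈ U) :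
    tg X q = -conormalFactor a b c X q * shapeForm a b c (dV X q) (dV X q) := by
  rw [tg, h.ip_nrm_eq hq, show dV (dV X) q = fderiv ℝ (dV X) q (0, 1) from rfl,
    h.shapeForm_second hq ((contDiffAt_dV (h.contDiffAt hq)).differentiableAt (by simp))
      (fun x hx => h.shapeForm_dV hx)]
  simp [dV]

/-- The equation of principal lines in intrinsic form. -/
theorem IsChart.coef_eq (h : IsChart (ellipsoid a b c) U X) (hq : q ∈ U) (ξ η : ℝ) :
    coefL X q * η ^ 2 + coefM X q * (ξ * η) + coefN X q * ξ ^ 2 =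
      -conormalFactor a b c X q ^ 2 * prinForm a b c (X q) (ξ • dU X q + η • dV X q) := by
  have h1 := h.nrm_eq hq
  simp only [coefL, coefM, coefN, h.te_eq hq, h.tf_eq hq, h.tg_eq hq, cE, cF, cG]
  generalize conormalFactor a b c X q = l at *
  have e0 := congrFun h1 0
  have e1 := congrFun h1 1
  have e2 := congrFun h1 2
  simp [nrm, cross] at e0 e1 e2
  rw [← neg_inj, neg_neg] at e2
  -- One factor λ is absorbed into the conormal, so that λn can be replaced by the entries of X_u ×
  -- X_v; what remains is a polynomial identity in X_u and X_v.
  have : -l ^ 2 * prinForm a b c (X q) (ξ • dU X q + η • dV X q) =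
    -l * ((l * (X q 0 / a ^ 2)) * (1 / b ^ 2 + 1 / c ^ 2) *
      ((ξ • dU X q + η • dV X q) 1 * (ξ • dU X q + η • dV X q) 2)
    - (l * (X q 1 / b ^ 2)) * (1 / a ^ 2 + 1 / c ^ 2) *
      ((ξ • dU X q + η • dV X q) 0 * (ξ • dU X q + η • dV X q) 2)
    + (l * (X q 2 / c ^ 2)) * (1 / b ^ 2 - 1 / a ^ 2) *
      ((ξ • dU X q + η • dV X q) 0 * (ξ • dU X q + η • dV X q) 1)) := by
    simp only [prinForm]; ring
  rw [this, ← e0, ← e1, ← e2]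
  simp [ip, shapeForm]
  ring

theorem IsChart.coefN_eq (h : IsChart (ellipsoid a b c) U X) (hq : q ∈ U) :
    coefN X q = -conormalFactor a b c X q ^ 2 * prinForm a b c (X q) (dU X q) := by
  simpa using h.coef_eq hq 1 0

theorem IsChart.coefL_eq (h : IsChart (ellipsoid a b c) U X) (hq : q ∈ U) :
    coefL X q = -conormalFactor a b c X q ^ 2 * prinForm a b c (X q) (dV X q) := by
  simpa using h.coef_eq hq 0 1

/-- The chart enters the discriminant only through an even power of λ, so its sign and its vanishing
are properties of the point. -/
theorem IsChart.coef_disc (h : IsChart (ellipsoid a b c) U X) (hq : q ∈ U) :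
    coefM X q ^ 2 - 4 * coefL X q * coefN X q =
      conormalFactor a b c X q ^ 6 * prinDisc a b c (X q) := by
  have hM := h.coef_eq hq 1 1
  have hL := h.coefL_eq hq
  have hN := h.coefN_eq hq
  have h1 := h.nrm_eq hq
  generalize conormalFactor a b c X q = l at *
  have e0 := congrFun h1 0
  have e1 := congrFun h1 1
  have e2 := congrFun h1 2
  simp [nrm, cross] at e0 e1 e2
  rw [← neg_inj, neg_neg] at e2
  have hM' : coefM X q = -l ^ 2 * (prinForm a b c (X q) (dU X q + dV X q)
      - prinForm a b c (X q) (dU X q) - prinForm a b c (X q) (dV X q)) := by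
    simp at hM; linarith
  rw [hM', hL, hN]
  -- `prinDisc` is quartic in the conormal. Two of the six factors λ turn one conormal in each
  -- product into an entry of X_u × X_v; the other four match λ⁴ on the left.
  have hD : l ^ 6 * prinDisc a b c (X q) =
      l ^ 4 * (((X q 0 / a ^ 2) * (l * (X q 0 / a ^ 2)) * (1 / b ^ 2 + 1 / c ^ 2)
        - (X q 2 / c ^ 2) * (l * (X q 2 / c ^ 2)) * (1 / b ^ 2 - 1 / a ^ 2)) ^ 2
      + ((X q 1 / b ^ 2) * (l * (X q 1 / b ^ 2)) * (1 / a ^ 2 + 1 / c ^ 2)) ^ 2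
      + 2 * ((X q 1 / b ^ 2) * (l * (X q 1 / b ^ 2)) * (1 / a ^ 2 + 1 / c ^ 2)) *
      ((X q 0 / a ^ 2) * (l * (X q 0 / a ^ 2)) * (1 / b ^ 2 + 1 / c ^ 2)
        + (X q 2 / c ^ 2) * (l * (X q 2 / c ^ 2)) * (1 / b ^ 2 - 1 / a ^ 2))) := by
    simp only [prinDisc]; ring
  rw [hD, ← e0, ← e1, ← e2]
  simp [prinForm]
  ring

end

/-! ### Graph charts -/

/-- The part of the ellipsoid with `τ z > 0` as a graph over the `xy`-plane. -/
def graphChart (a b c τ : ℝ) (q : ℝ × ℝ) : E3 :=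
  ![q.1, q.2, τ * (c * Real.sqrt (1 - q.1 ^ 2 / a ^ 2 - q.2 ^ 2 / b ^ 2))]

/-- The domain of `graphChart`. -/
def graphDomain (a b : ℝ) : Set (ℝ × ℝ) := {q | 0 < 1 - q.1 ^ 2 / a ^ 2 - q.2 ^ 2 / b ^ 2}

theorem isOpen_graphDomain (a b : ℝ) : IsOpen (graphDomain a b) :=
  isOpen_lt continuous_const (by fun_prop)

theorem contDiffOn_graphChart (a b c τ : ℝ) :
    ContDiffOn ℝ ∞ (graphChart a b c τ) (graphDomain a b) := by
  refine contDiffOn_pi.2 fun i => ?_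
  fin_cases i
  · exact contDiff_fst.contDiffOn
  · exact contDiff_snd.contDiffOn
  · refine contDiffOn_const.mul (contDiffOn_const.mul (ContDiffOn.sqrt ?_ fun q hq => ?_))
    · fun_prop
    · exact (show 0 < 1 - q.1 ^ 2 / a ^ 2 - q.2 ^ 2 / b ^ 2 from hq).ne'

theorem fderiv_graphChart (a b c τ : ℝ) {q : ℝ × ℝ} (hq : q ∈ graphDomain a b) (v : ℝ × ℝ) :
    fderiv ℝ (graphChart a b c τ) q v 0 = v.1 ∧ fderiv ℝ (graphChart a b c τ) q v 1 = v.2 := by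
  have hd : DifferentiableAt ℝ (graphChart a b c τ) q :=
    ((contDiffOn_graphChart a b c τ).contDiffAt
      ((isOpen_graphDomain a b).mem_nhds hq)).differentiableAt (by simp)
  have h := hasFDerivAt_pi'.1 hd.hasFDerivAt
  have h0 : HasFDerivAt (fun x : ℝ × ℝ => x.1) _ q := h 0
  have h1 : HasFDerivAt (fun x : ℝ × ℝ => x.2) _ q := h 1
  have e0 := h0.unique hasFDerivAt_fst
  have e1 := h1.unique hasFDerivAt_snd
  constructor
  · simpa using DFunLike.congr_fun e0 v
  · simpa using DFunLike.congr_fun e1 v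

theorem linearIndependent_graph {P R : E3} (h0 : P 0 = 1) (h1 : P 1 = 0) (h2 : R 0 = 0)
    (h3 : R 1 = 1) : LinearIndependent ℝ ![P, R] := by
  rw [LinearIndependent.pair_iff]
  intro s t hst
  have e0 := congrFun hst 0
  have e1 := congrFun hst 1
  simp [h0, h1, h2, h3] at e0 e1
  exact ⟨e0, e1⟩

theorem graphChart_apply {a b c τ : ℝ} {p : E3} (hc : 0 < c) (hτ : τ ^ 2 = 1)
    (hp : p ∈ ellipsoid a b c) (hz : 0 < τ * p 2) :
    (p 0, p 1) ∈ graphDomain a b ∧ graphChart a b c τ (p 0, p 1) = p := by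
  have h2 : 1 - p 0 ^ 2 / a ^ 2 - p 1 ^ 2 / b ^ 2 = (τ * p 2 / c) ^ 2 := by
    have hp' : p 0 ^ 2 / a ^ 2 + p 1 ^ 2 / b ^ 2 + p 2 ^ 2 / c ^ 2 = 1 := hp
    rw [div_pow, mul_pow, hτ]
    linear_combination -hp'
  have h3 : Real.sqrt (1 - p 0 ^ 2 / a ^ 2 - p 1 ^ 2 / b ^ 2) = τ * p 2 / c := by
    rw [h2, Real.sqrt_sq (by positivity)]
  refine ⟨?_, ?_⟩
  · change 0 < 1 - p 0 ^ 2 / a ^ 2 - p 1 ^ 2 / b ^ 2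
    rw [h2]; positivity
  · ext i
    fin_cases i
    · simp [graphChart]
    · simp [graphChart]
    · simp only [graphChart, Fin.reduceFinMk, Matrix.cons_val]
      rw [h3]
      field_simp
      linear_combination p 2 * hτ

theorem isChart_graphChart {a b c τ : ℝ} (hc : 0 < c) (hτ : τ = 1 ∨ τ = -1) :
    IsChart (ellipsoid a b c) (graphDomain a b) (graphChart a b c τ) := by
  have hτ2 : τ ^ 2 = 1 := by rcases hτ with rfl | rfl <;> norm_num
  refine ⟨isOpen_graphDomain a b, contDiffOn_graphChart a b c τ, ?_, ?_, ?_, ?_⟩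
  · intro q hq
    have hq' : 0 < 1 - q.1 ^ 2 / a ^ 2 - q.2 ^ 2 / b ^ 2 := hq
    simp only [ellipsoid, graphChart, Set.mem_ofPred_eq]
    simp [mul_pow, hτ2, Real.sq_sqrt hq'.le]
    field_simp
    ring
  · intro q _ q' _ h
    have e0 := congrFun h 0
    have e1 := congrFun h 1
    simp [graphChart] at e0 e1
    exact Prod.ext e0 e1
  · intro q hq
    have hu := fderiv_graphChart a b c τ hq (1, 0)
    have hv := fderiv_graphChart a b c τ hq (0, 1)
    exact linearIndependent_graph hu.1 hu.2 hv.1 hv.2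
  · intro V hV hVo
    -- The projection to the xy-plane inverts the chart, and the half-space τz > 0 selects its
    -- sheet.
    refine ⟨(fun p : E3 => ((p 0, p 1) : ℝ × ℝ)) ⁻¹' V ∩ {p | 0 < τ * p 2}, ?_, ?_⟩
    · exact (hVo.preimage (by fun_prop)).inter (isOpen_lt continuous_const (by fun_prop))
    · ext p
      constructor
      · rintro ⟨q, hq, rfl⟩
        have hq' : 0 < 1 - q.1 ^ 2 / a ^ 2 - q.2 ^ 2 / b ^ 2 := hV hq
        refine ⟨⟨by simpa [graphChart] using hq, ?_⟩, ?_⟩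
        · simp only [graphChart, Set.mem_ofPred_eq]
          have : 0 < τ ^ 2 * (c * Real.sqrt (1 - q.1 ^ 2 / a ^ 2 - q.2 ^ 2 / b ^ 2)) := by
            rw [hτ2]; have := Real.sqrt_pos.2 hq'; positivity
          simpa [sq, mul_assoc] using this
        · simp only [ellipsoid, graphChart, Set.mem_ofPred_eq]
          simp [mul_pow, hτ2, Real.sq_sqrt hq'.le]
          field_simp
          ring
      · rintro ⟨⟨hp, hz⟩, hM⟩
        exact ⟨(p 0, p 1), hp, (graphChart_apply hc hτ2 hM hz).2⟩

theorem isChartAt_graphChart {a b c τ : ℝ} {p : E3} (hc : 0 < c) (hτ : τ = 1 ∨ τ = -1)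
    (hp : p ∈ ellipsoid a b c) (hz : 0 < τ * p 2) :
    IsChartAt (ellipsoid a b c) p (graphDomain a b) (graphChart a b c τ) (p 0, p 1) := by
  have hτ2 : τ ^ 2 = 1 := by rcases hτ with rfl | rfl <;> norm_num
  exact ⟨isChart_graphChart hc hτ, graphChart_apply hc hτ2 hp hz⟩

theorem exists_sign {z : ℝ} (hz : z ≠ 0) : ∃ τ : ℝ, (τ = 1 ∨ τ = -1) ∧ 0 < τ * z := by
  rcases lt_or_gt_of_ne hz with h | h
  · exact ⟨-1, Or.inr rfl, by linarith⟩
  · exact ⟨1, Or.inl rfl, by linarith⟩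

theorem exists_isChartAt_of_ne {a b c : ℝ} {p : E3} (hc : 0 < c) (hp : p ∈ ellipsoid a b c)
    (hz : p 2 ≠ 0) : ∃ U X q, IsChartAt (ellipsoid a b c) p U X q := by
  obtain ⟨τ, h1, h2⟩ := exists_sign hz
  exact ⟨_, _, _, isChartAt_graphChart hc h1 hp h2⟩

/-! ### Charts around every point, by permuting the coordinates -/

theorem IsChart.image {M : Set E3} {U : Set (ℝ × ℝ)} {X : ℝ × ℝ → E3} (h : IsChart M U X)
    (e : E3 ≃L[ℝ] E3) : IsChart (e '' M) U (e ∘ X) := by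
  refine ⟨h.isOpen, e.contDiff.comp_contDiffOn h.smooth, fun q hq => ⟨X q, h.mapsTo hq, rfl⟩,
    e.injective.comp_injOn h.injOn, fun q hq => ?_, fun V hV hVo => ?_⟩
  · have hf : ∀ v, fderiv ℝ (e ∘ X) q v = e (fderiv ℝ X q v) := by
      intro v
      rw [e.comp_fderiv]; rfl
    have := (h.immersion q hq).map' (e.toLinearEquiv : E3 →ₗ[ℝ] E3) (LinearEquiv.ker _)
    have he : (e.toLinearEquiv : E3 →ₗ[ℝ] E3) ∘ ![dU X q, dV X q] =
        ![dU (e ∘ X) q, dV (e ∘ X) q] := by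
      ext i j
      fin_cases i <;> simp [dU, dV, hf]
    rwa [he] at this
  · obtain ⟨W, hW, hWe⟩ := h.openMap V hV hVo
    refine ⟨e '' W, e.toHomeomorph.isOpenMap W hW, ?_⟩
    rw [Set.image_comp, hWe, Set.image_inter e.injective]

/-- Permutation of the coordinates. -/
def permEquiv (σ : Equiv.Perm (Fin 3)) : E3 ≃L[ℝ] E3 :=
  (LinearEquiv.funCongrLeft ℝ ℝ σ).toContinuousLinearEquiv

theorem permEquiv_apply (σ : Equiv.Perm (Fin 3)) (p : E3) (i : Fin 3) :
    permEquiv σ p i = p (σ i) := rfl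

theorem permEquiv_swap_swap (i j : Fin 3) (p : E3) :
    permEquiv (Equiv.swap i j) (permEquiv (Equiv.swap i j) p) = p := by
  ext k; simp [permEquiv_apply]

/-- `IsChart` does not involve the metric, so a linear isomorphism transports charts. Some
coordinate of p is nonzero; swapping it with z reduces to a graph chart of an ellipsoid with
permuted semi-axes. -/
theorem exists_isChartAt {a b c : ℝ} (ha : 0 < a) (hb : 0 < b) (hc : 0 < c) {p : E3}
    (hp : p ∈ ellipsoid a b c) : ∃ U X q, IsChartAt (ellipsoid a b c) p U X q := by
  have aux : ∀ (i j : Fin 3) (a' b' c' : ℝ), 0 < c' →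
      (∀ x : E3, permEquiv (Equiv.swap i j) x ∈ ellipsoid a' b' c' ↔ x ∈ ellipsoid a b c) →
      p (Equiv.swap i j 2) ≠ 0 → ∃ U X q, IsChartAt (ellipsoid a b c) p U X q := by
    intro i j a' b' c' hc' hM hz
    obtain ⟨U, X, q, h1, h2, h3⟩ :=
      exists_isChartAt_of_ne (p := permEquiv (Equiv.swap i j) p) hc' ((hM p).2 hp) hz
    have hi : permEquiv (Equiv.swap i j) '' ellipsoid a' b' c' = ellipsoid a b c := by
      ext x
      constructor
      · rintro ⟨y, hy, rfl⟩
        rw [← hM, permEquiv_swap_swap]; exact hy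
      · intro hx
        exact ⟨_, (hM x).2 hx, permEquiv_swap_swap i j x⟩
    refine ⟨U, _, q, hi ▸ h1.image (permEquiv (Equiv.swap i j)), h2, ?_⟩
    rw [Function.comp_apply, h3, permEquiv_swap_swap]
  by_cases h2 : p 2 = 0
  · by_cases h1 : p 1 = 0
    · have h0 : p 0 ≠ 0 := by
        intro h0; simp [ellipsoid, h0, h1, h2] at hp
      refine aux 0 2 c b a ha (fun x => ?_) (by simpa using h0)
      simp only [ellipsoid, Set.mem_ofPred_eq, permEquiv_apply,
        show Equiv.swap (0 : Fin 3) 2 0 = 2 by decide,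
        show Equiv.swap (0 : Fin 3) 2 1 = 1 by decide,
        show Equiv.swap (0 : Fin 3) 2 2 = 0 by decide]
      rw [show x 2 ^ 2 / c ^ 2 + x 1 ^ 2 / b ^ 2 + x 0 ^ 2 / a ^ 2 =
        x 0 ^ 2 / a ^ 2 + x 1 ^ 2 / b ^ 2 + x 2 ^ 2 / c ^ 2 by ring]
    · refine aux 1 2 a c b hb (fun x => ?_) (by simpa using h1)
      simp only [ellipsoid, Set.mem_ofPred_eq, permEquiv_apply,
        show Equiv.swap (1 : Fin 3) 2 0 = 0 by decide,
        show Equiv.swap (1 : Fin 3) 2 1 = 2 by decide,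
        show Equiv.swap (1 : Fin 3) 2 2 = 1 by decide]
      rw [show x 0 ^ 2 / a ^ 2 + x 2 ^ 2 / c ^ 2 + x 1 ^ 2 / b ^ 2 =
        x 0 ^ 2 / a ^ 2 + x 1 ^ 2 / b ^ 2 + x 2 ^ 2 / c ^ 2 by ring]
  · exact exists_isChartAt_of_ne hc hp h2

/-! ### Intrinsic description of principal vectors -/

theorem exists_tangent_coords {P R n w : E3} {l : ℝ} (hl : l ≠ 0)
    (hn : 0 < n 0 ^ 2 + n 1 ^ 2 + n 2 ^ 2)
    (hc : cross P R = ![l * n 0, l * n 1, -(l * n 2)])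
    (hw : n 0 * w 0 + n 1 * w 1 + n 2 * w 2 = 0) : ∃ ξ η : ℝ, w = ξ • P + η • R := by
  have e0 := congrFun hc 0
  have e1 := congrFun hc 1
  have e2 := congrFun hc 2
  simp [cross] at e0 e1 e2
  rw [← neg_inj, neg_neg] at e2
  set s := l * (n 0 ^ 2 + n 1 ^ 2 + n 2 ^ 2) with hs
  have hs0 : s ≠ 0 := mul_ne_zero hl hn.ne'
  -- Cramer's rule: ξ = det(n, w, R)/det(n, P, R) and η = det(n, P, w)/det(n, P, R), with
  -- denominator l|n|².
  refine ⟨(n 0 * (w 1 * R 2 - w 2 * R 1) + n 1 * (w 2 * R 0 - w 0 * R 2)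
    + n 2 * (w 0 * R 1 - w 1 * R 0)) / s,
    (n 0 * (P 1 * w 2 - P 2 * w 1) + n 1 * (P 2 * w 0 - P 0 * w 2)
    + n 2 * (P 0 * w 1 - P 1 * w 0)) / s, ?_⟩
  have hs' : s = n 0 * (P 1 * R 2 - P 2 * R 1) + n 1 * (P 2 * R 0 - P 0 * R 2)
      + n 2 * (P 0 * R 1 - P 1 * R 0) := by
    rw [hs]; linear_combination (-n 0) * e0 - n 1 * e1 - n 2 * e2
  ext i
  fin_cases i
  · simp; field_simp; rw [hs']
    linear_combination n 0 * (w 0 * e0 + w 1 * e1 + w 2 * e2 + l * hw)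
  · simp; field_simp; rw [hs']
    linear_combination n 1 * (w 0 * e0 + w 1 * e1 + w 2 * e2 + l * hw)
  · simp; field_simp; rw [hs']
    linear_combination n 2 * (w 0 * e0 + w 1 * e1 + w 2 * e2 + l * hw)

theorem IsChart.exists_coords {a b c : ℝ} {U : Set (ℝ × ℝ)} {X : ℝ × ℝ → E3} {q : ℝ × ℝ}
    (h : IsChart (ellipsoid a b c) U X) (hq : q ∈ U) {w : E3}
    (hw : shapeForm a b c (X q) w = 0) : ∃ ξ η : ℝ, w = ξ • dU X q + η • dV X q := by
  refine exists_tangent_coords (n := ![X q 0 / a ^ 2, X q 1 / b ^ 2, X q 2 / c ^ 2])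
    (h.conormalFactor_ne hq) (conormal_sq_pos (h.shapeForm_eq_one hq)) (h.nrm_eq hq) ?_
  rw [← hw]
  simp [shapeForm]
  ring

theorem shapeForm_comb (a b c : ℝ) (p P R : E3) (ξ η : ℝ) :
    shapeForm a b c p (ξ • P + η • R) = ξ * shapeForm a b c p P + η * shapeForm a b c p R := by
  simp [shapeForm]; ring

/-- In any chart the form is -λ² `prinForm` with λ ≠ 0, so the condition does not depend on the
chart. This is the form in which principal vectors are used for curves below. -/
theorem isPrincipalVector_iff {a b c : ℝ} (ha : 0 < a) (hb : 0 < b) (hc : 0 < c) {p w : E3} :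
    IsPrincipalVector (ellipsoid a b c) p w ↔
      p ∈ ellipsoid a b c ∧ shapeForm a b c p w = 0 ∧ prinForm a b c p w = 0 := by
  constructor
  · rintro ⟨U, X, q, ⟨h, hq, rfl⟩, ξ, η, rfl, he⟩
    refine ⟨h.mapsTo hq, ?_, ?_⟩
    · rw [shapeForm_comb, h.shapeForm_dU hq, h.shapeForm_dV hq]; ring
    · rw [h.coef_eq hq] at he
      have := h.conormalFactor_ne hq
      simpa [this] using he
  · rintro ⟨hp, hw, hQ⟩
    obtain ⟨U, X, q, h, hq, rfl⟩ := exists_isChartAt ha hb hc hp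
    obtain ⟨ξ, η, rfl⟩ := h.exists_coords hq hw
    exact ⟨U, X, q, ⟨h, hq, rfl⟩, ξ, η, rfl, by rw [h.coef_eq hq, hQ, mul_zero]⟩

/-! ### Umbilic points, the tropic and the principal directions -/

section
variable {a b c : ℝ}

theorem inv_sq_sub_pos (hb : 0 < b) (hab : b < a) : 0 < 1 / b ^ 2 - 1 / a ^ 2 := by
  have : b ^ 2 < a ^ 2 := by nlinarith
  have := one_div_lt_one_div_of_lt (by positivity) this
  linarith

/-- The conormal coordinates satisfy the equations of an umbilic point. -/
def UmbilicEq (a b c : ℝ) (p : E3) : Prop :=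
  p 1 = 0 ∧ (p 0 / a ^ 2) ^ 2 * (1 / b ^ 2 + 1 / c ^ 2) =
    (p 2 / c ^ 2) ^ 2 * (1 / b ^ 2 - 1 / a ^ 2)

/-- The discriminant is (A - C)² + B² + 2B(A + C) with A, B, C ≥ 0, where a > b makes the
coefficient of C positive. All three summands must vanish. -/
theorem prinDisc_eq_zero_iff (hb : 0 < b) (hab : b < a) (hc : 0 < c) (p : E3) :
    prinDisc a b c p = 0 ↔ UmbilicEq a b c p := by
  have ha : 0 < a := hb.trans hab
  have hk2 := inv_sq_sub_pos hb hab
  have hk0 : 0 < 1 / b ^ 2 + 1 / c ^ 2 := by positivity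
  have hk1 : 0 < 1 / a ^ 2 + 1 / c ^ 2 := by positivity
  unfold prinDisc UmbilicEq
  constructor
  · intro h
    have h0 : 0 ≤ (p 0 / a ^ 2) ^ 2 * (1 / b ^ 2 + 1 / c ^ 2) := by positivity
    have h1 : 0 ≤ (p 1 / b ^ 2) ^ 2 * (1 / a ^ 2 + 1 / c ^ 2) := by positivity
    have h2 : 0 ≤ (p 2 / c ^ 2) ^ 2 * (1 / b ^ 2 - 1 / a ^ 2) := by positivity
    set A := (p 0 / a ^ 2) ^ 2 * (1 / b ^ 2 + 1 / c ^ 2)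
    set B := (p 1 / b ^ 2) ^ 2 * (1 / a ^ 2 + 1 / c ^ 2) with hB
    set C := (p 2 / c ^ 2) ^ 2 * (1 / b ^ 2 - 1 / a ^ 2)
    have hm : 0 ≤ B * (A + C) := mul_nonneg h1 (add_nonneg h0 h2)
    have e1 : (A - C) ^ 2 = 0 := by nlinarith [sq_nonneg (A - C), sq_nonneg B]
    have e2 : B ^ 2 = 0 := by nlinarith [sq_nonneg (A - C), sq_nonneg B]
    have e3 : A - C = 0 := by simpa using e1
    have e4 : B = 0 := by simpa using e2
    refine ⟨?_, by linarith⟩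
    rw [hB, mul_eq_zero, or_iff_left hk1.ne'] at e4
    simpa [hb.ne'] using e4
  · rintro ⟨h1, h2⟩
    rw [h1, h2]; simp

theorem prinDisc_nonneg (hb : 0 < b) (hab : b < a) (p : E3) :
    0 ≤ prinDisc a b c p := by
  have hk2 := inv_sq_sub_pos hb hab
  unfold prinDisc
  positivity

theorem UmbilicEq.conormal_ne {p : E3} (hb : 0 < b) (hab : b < a) (hc : 0 < c)
    (h : UmbilicEq a b c p) (hp : p ∈ ellipsoid a b c) : p 0 ≠ 0 ∧ p 2 ≠ 0 := by
  have ha : 0 < a := hb.trans hab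
  have hk2 := inv_sq_sub_pos hb hab
  have hk0 : 0 < 1 / b ^ 2 + 1 / c ^ 2 := by positivity
  obtain ⟨h1, h2⟩ := h
  have key : p 0 = 0 ↔ p 2 = 0 := by
    constructor
    · intro h0
      rw [h0] at h2
      have : p 2 = 0 ∨ 1 / b ^ 2 - 1 / a ^ 2 = 0 := by simpa [hc.ne'] using h2.symm
      exact this.resolve_right hk2.ne'
    · intro h0
      rw [h0] at h2
      have : p 0 = 0 ∨ 1 / b ^ 2 + 1 / c ^ 2 = 0 := by simpa [ha.ne'] using h2
      exact this.resolve_right hk0.ne'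
  constructor
  · intro h0
    simp [ellipsoid, h0, h1, key.1 h0] at hp
  · intro h0
    simp [ellipsoid, h0, h1, key.2 h0] at hp

/-- For y = 0 the form is w₁ times this linear form. The umbilic equation makes the linear form
proportional to the conormal, so it vanishes on the tangent plane. -/
theorem UmbilicEq.prinForm_factor {p w : E3} (hb : 0 < b) (hab : b < a) (hc : 0 < c)
    (h : UmbilicEq a b c p) (hp : p ∈ ellipsoid a b c) (hw : shapeForm a b c p w = 0) :
    p 0 / a ^ 2 * (1 / b ^ 2 + 1 / c ^ 2) * w 2 +
      p 2 / c ^ 2 * (1 / b ^ 2 - 1 / a ^ 2) * w 0 = 0 := by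
  have h2 := (h.conormal_ne hb hab hc hp).2
  obtain ⟨h1, h3⟩ := h
  have hz : p 2 / c ^ 2 ≠ 0 := by positivity
  apply (mul_eq_zero.1 _).resolve_left hz
  have hw' : p 0 / a ^ 2 * w 0 + p 2 / c ^ 2 * w 2 = 0 := by
    rw [← hw]; simp [shapeForm, h1]; ring
  linear_combination (p 0 / a ^ 2 * (1 / b ^ 2 + 1 / c ^ 2)) * hw' - w 0 * h3

theorem UmbilicEq.prinForm_eq_zero {p w : E3} (hb : 0 < b) (hab : b < a) (hc : 0 < c)
    (h : UmbilicEq a b c p) (hp : p ∈ ellipsoid a b c) (hw : shapeForm a b c p w = 0) :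
    prinForm a b c p w = 0 := by
  have := h.prinForm_factor hb hab hc hp hw
  simp only [prinForm, h.1]
  linear_combination w 1 * this

theorem IsChart.coef_eq_zero {U : Set (ℝ × ℝ)} {X : ℝ × ℝ → E3} {q : ℝ × ℝ} (hb : 0 < b)
    (hab : b < a) (hc : 0 < c) (h : IsChart (ellipsoid a b c) U X) (hq : q ∈ U)
    (hu : UmbilicEq a b c (X q)) : coefL X q = 0 ∧ coefM X q = 0 ∧ coefN X q = 0 := by
  have h0 : ∀ ξ η : ℝ, prinForm a b c (X q) (ξ • dU X q + η • dV X q) = 0 := fun ξ η =>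
    hu.prinForm_eq_zero hb hab hc (h.mapsTo hq) (by
      rw [shapeForm_comb, h.shapeForm_dU hq, h.shapeForm_dV hq]; ring)
  have e0 := h.coef_eq hq 0 1
  have e1 := h.coef_eq hq 1 0
  have e2 := h.coef_eq hq 1 1
  rw [h0] at e0 e1 e2
  simp only [mul_zero] at e0 e1 e2
  refine ⟨by linarith, by linarith, by linarith⟩

theorem mem_umbilics_iff (hb : 0 < b) (hab : b < a) (hc : 0 < c) {p : E3} :
    p ∈ umbilics (ellipsoid a b c) ↔ p ∈ ellipsoid a b c ∧ UmbilicEq a b c p := by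
  constructor
  · rintro ⟨U, X, q, ⟨h, hq, rfl⟩, hL, hM, hN⟩
    refine ⟨h.mapsTo hq, (prinDisc_eq_zero_iff hb hab hc _).1 ?_⟩
    have h1 := h.coef_disc hq
    rw [hL, hM, hN] at h1
    have := h.conormalFactor_ne hq
    simpa [this] using h1.symm
  · rintro ⟨hp, hu⟩
    obtain ⟨U, X, q, h, hq, rfl⟩ := exists_isChartAt (hb.trans hab) hb hc hp
    exact ⟨U, X, q, ⟨h, hq, rfl⟩, h.coef_eq_zero hb hab hc hq hu⟩

theorem umbilicEq_iff (hb : 0 < b) (hab : b < a) (hc : 0 < c) {p : E3}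
    (hp : p ∈ ellipsoid a b c) : UmbilicEq a b c p ↔
      p 1 = 0 ∧ (p 0 / a) ^ 2 = (a ^ 2 - b ^ 2) / (a ^ 2 + c ^ 2) := by
  have ha : 0 < a := hb.trans hab
  unfold UmbilicEq
  refine and_congr_right fun h1 => ?_
  have hp' : p 0 ^ 2 / a ^ 2 + p 1 ^ 2 / b ^ 2 + p 2 ^ 2 / c ^ 2 = 1 := hp
  have h2 : (p 2 / c) ^ 2 = 1 - (p 0 / a) ^ 2 := by
    rw [h1] at hp'; simp only [div_pow]; linear_combination hp'
  have e0 : (p 0 / a ^ 2) ^ 2 * (1 / b ^ 2 + 1 / c ^ 2) =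
      (p 0 / a) ^ 2 * (b ^ 2 + c ^ 2) / (a ^ 2 * b ^ 2 * c ^ 2) := by field_simp; ring
  have e1 : (p 2 / c ^ 2) ^ 2 * (1 / b ^ 2 - 1 / a ^ 2) =
      (1 - (p 0 / a) ^ 2) * (a ^ 2 - b ^ 2) / (a ^ 2 * b ^ 2 * c ^ 2) := by
    rw [← h2]; field_simp
  rw [e0, e1, div_left_inj' (by positivity), eq_div_iff (by positivity)]
  constructor <;> intro h <;> linarith

theorem umbilics_eq (hb : 0 < b) (hab : b < a) (hc : 0 < c) :
    umbilics (ellipsoid a b c) = fourPoints a b c := by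
  have ha : 0 < a := hb.trans hab
  have hba : 0 < a ^ 2 - b ^ 2 := by nlinarith
  have hk : (0:ℝ) ≤ (a ^ 2 - b ^ 2) / (a ^ 2 + c ^ 2) := by positivity
  have hk' : (0:ℝ) ≤ (b ^ 2 + c ^ 2) / (a ^ 2 + c ^ 2) := by positivity
  have hs : ∀ {x y : ℝ}, x ^ 2 = y ^ 2 → ∃ s : ℝ, (s = 1 ∨ s = -1) ∧ x = s * y := by
    intro x y h
    rcases sq_eq_sq_iff_eq_or_eq_neg.1 h with h | h
    · exact ⟨1, Or.inl rfl, by linarith⟩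
    · exact ⟨-1, Or.inr rfl, by linarith⟩
  ext p
  rw [mem_umbilics_iff hb hab hc]
  constructor
  · rintro ⟨hp, hu⟩
    obtain ⟨h1, h2⟩ := (umbilicEq_iff hb hab hc hp).1 hu
    have hp' : p 0 ^ 2 / a ^ 2 + p 1 ^ 2 / b ^ 2 + p 2 ^ 2 / c ^ 2 = 1 := hp
    have h3 : (p 2 / c) ^ 2 = (b ^ 2 + c ^ 2) / (a ^ 2 + c ^ 2) := by
      have : (p 2 / c) ^ 2 = 1 - (p 0 / a) ^ 2 := by
        rw [h1] at hp'; simp only [div_pow]; linear_combination hp'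
      rw [this, h2]; field_simp; ring
    obtain ⟨s, hs1, hs2⟩ := hs (h2.trans (Real.sq_sqrt hk).symm)
    obtain ⟨t, ht1, ht2⟩ := hs (h3.trans (Real.sq_sqrt hk').symm)
    rw [div_eq_iff ha.ne'] at hs2
    rw [div_eq_iff hc.ne'] at ht2
    refine ⟨s, t, hs1, ht1, ?_⟩
    ext i
    fin_cases i
    · simp [hs2]; ring
    · simp [h1]
    · simp [ht2]; ring
  · rintro ⟨s, t, hs, ht, rfl⟩
    have hs2 : s ^ 2 = 1 := by rcases hs with rfl | rfl <;> norm_num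
    have ht2 : t ^ 2 = 1 := by rcases ht with rfl | rfl <;> norm_num
    rw [and_iff_left_of_imp (fun h => ?_)]
    · simp only [ellipsoid, Set.mem_ofPred_eq, Matrix.cons_val, mul_pow, Real.sq_sqrt hk,
        Real.sq_sqrt hk', hs2, ht2]
      field_simp
      ring
    · rw [umbilicEq_iff hb hab hc h]
      simp only [Matrix.cons_val, div_pow, mul_pow, Real.sq_sqrt hk, hs2]
      simp
      field_simp

theorem ncard_fourPoints (hb : 0 < b) (hab : b < a) (hc : 0 < c) :
    (fourPoints a b c).ncard = 4 := by
  have ha : 0 < a := hb.trans hab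
  have hba : 0 < a ^ 2 - b ^ 2 := by nlinarith
  unfold fourPoints
  have hx : 0 < a * Real.sqrt ((a ^ 2 - b ^ 2) / (a ^ 2 + c ^ 2)) := by positivity
  have hz : 0 < c * Real.sqrt ((b ^ 2 + c ^ 2) / (a ^ 2 + c ^ 2)) := by positivity
  generalize a * Real.sqrt ((a ^ 2 - b ^ 2) / (a ^ 2 + c ^ 2)) = x at *
  generalize c * Real.sqrt ((b ^ 2 + c ^ 2) / (a ^ 2 + c ^ 2)) = z at *
  have : {p : E3 | ∃ s t : ℝ, (s = 1 ∨ s = -1) ∧ (t = 1 ∨ t = -1) ∧ p = ![s * x, 0, t * z]} =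
      {![x, 0, z], ![x, 0, -z], ![-x, 0, z], ![-x, 0, -z]} := by
    ext p
    simp only [Set.mem_ofPred_eq, Set.mem_insert_iff, Set.mem_singleton_iff]
    constructor
    · rintro ⟨s, t, rfl | rfl, rfl | rfl, rfl⟩ <;> simp
    · rintro (rfl | rfl | rfl | rfl)
      · exact ⟨1, 1, by simp⟩
      · exact ⟨1, -1, by simp⟩
      · exact ⟨-1, 1, by simp⟩
      · exact ⟨-1, -1, by simp⟩
  have h1 : x ≠ -x := by linarith
  have h2 : z ≠ -z := by linarith
  have hne : ∀ {u v u' v' : ℝ}, (![u, 0, v] : E3) = ![u', 0, v'] ↔ u = u' ∧ v = v' := by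
    intro u v u' v'
    constructor
    · intro h
      exact ⟨by simpa using congrFun h 0, by simpa using congrFun h 2⟩
    · rintro ⟨rfl, rfl⟩; rfl
  rw [this, Set.ncard_insert_of_notMem, Set.ncard_insert_of_notMem, Set.ncard_insert_of_notMem,
    Set.ncard_singleton]
  · simp only [Set.mem_singleton_iff, hne]; tauto
  · simp only [Set.mem_insert_iff, Set.mem_singleton_iff, hne]; tauto
  · simp only [Set.mem_insert_iff, Set.mem_singleton_iff, hne]; tauto

/-- Lagrange's identity `ip_nrm` applied to X_u × X_v = λJn. -/
theorem IsChart.detI_eq {U : Set (ℝ × ℝ)} {X : ℝ × ℝ → E3} {q : ℝ × ℝ}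
    (h : IsChart (ellipsoid a b c) U X) (hq : q ∈ U) :
    detI X q = conormalFactor a b c X q ^ 2 *
      ((X q 2 / c ^ 2) ^ 2 - (X q 0 / a ^ 2) ^ 2 - (X q 1 / b ^ 2) ^ 2) := by
  have h1 := ip_nrm X q
  rw [h.nrm_eq hq] at h1
  simp [ip] at h1
  linear_combination h1

theorem mem_tropic_iff (ha : 0 < a) (hb : 0 < b) (hc : 0 < c) {p : E3} :
    p ∈ tropic (ellipsoid a b c) ↔ p ∈ ellipsoid a b c ∧
      (p 0 / a ^ 2) ^ 2 + (p 1 / b ^ 2) ^ 2 = (p 2 / c ^ 2) ^ 2 := by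
  constructor
  · rintro ⟨U, X, q, ⟨h, hq, rfl⟩, h0⟩
    refine ⟨h.mapsTo hq, ?_⟩
    rw [h.detI_eq hq] at h0
    have := (mul_eq_zero.1 h0).resolve_left (pow_ne_zero 2 (h.conormalFactor_ne hq))
    linarith
  · rintro ⟨hp, h0⟩
    obtain ⟨U, X, q, h, hq, rfl⟩ := exists_isChartAt ha hb hc hp
    refine ⟨U, X, q, ⟨h, hq, rfl⟩, ?_⟩
    rw [h.detI_eq hq, ← h0]; ring

/-- At an umbilic point n₀²(1/b² + 1/c²) = n₂²(1/b² - 1/a²), and the second coefficient is the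
smaller one. By `IsChart.detI_eq` the tangent plane is therefore spacelike; in particular umbilic
points avoid the tropic. -/
theorem UmbilicEq.conormal_timelike {p : E3} (hb : 0 < b) (hab : b < a) (hc : 0 < c)
    (h : UmbilicEq a b c p) (hp : p ∈ ellipsoid a b c) :
    (p 0 / a ^ 2) ^ 2 + (p 1 / b ^ 2) ^ 2 < (p 2 / c ^ 2) ^ 2 := by
  have ha : 0 < a := hb.trans hab
  have h2 := (h.conormal_ne hb hab hc hp).2
  have hk2 := inv_sq_sub_pos hb hab
  have hk1 : 0 < 1 / a ^ 2 + 1 / c ^ 2 := by positivity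
  have hk0 : 0 < 1 / b ^ 2 + 1 / c ^ 2 := by positivity
  obtain ⟨h1, h3⟩ := h
  rw [h1]
  have hz : 0 < (p 2 / c ^ 2) ^ 2 := by positivity
  simp only [zero_div, ne_eq, OfNat.ofNat_ne_zero, not_false_eq_true, zero_pow, add_zero]
  refine lt_of_mul_lt_mul_right (a := 1 / b ^ 2 + 1 / c ^ 2) ?_ hk0.le
  rw [h3]
  exact mul_lt_mul_of_pos_left (by linarith) hz

theorem eps_ne_zero (X : ℝ × ℝ → E3) (q : ℝ × ℝ) : eps X q ≠ 0 := by
  unfold eps; split_ifs <;> norm_num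

theorem spacelikeUmbilics_eq (hb : 0 < b) (hab : b < a) (hc : 0 < c) :
    spacelikeUmbilics (ellipsoid a b c) = umbilics (ellipsoid a b c) := by
  ext p
  constructor
  · rintro ⟨U, X, q, hX, hd, k, he, hf, hg⟩
    have hL := Mink.coefL_eq X q hd.ne'
    have hM := Mink.coefM_eq X q hd.ne'
    have hN := Mink.coefN_eq X q hd.ne'
    rw [hf, hg] at hL
    rw [he, hg] at hM
    rw [he, hf] at hN
    have h0 := eps_ne_zero X q
    refine ⟨U, X, q, hX, mul_left_cancel₀ h0 ?_, mul_left_cancel₀ h0 ?_, mul_left_cancel₀ h0 ?_⟩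
    · rw [← hL]; ring
    · rw [← hM]; ring
    · rw [← hN]; ring
  · intro hp
    obtain ⟨hp, hu⟩ := (mem_umbilics_iff hb hab hc).1 hp
    obtain ⟨U, X, q, h, hq, rfl⟩ := exists_isChartAt (hb.trans hab) hb hc hp
    have hd : 0 < detI X q := by
      rw [h.detI_eq hq]
      have := h.conormalFactor_ne hq
      have := hu.conormal_timelike hb hab hc hp
      exact mul_pos (by positivity) (by linarith)
    refine ⟨U, X, q, ⟨h, hq, rfl⟩, hd, ?_⟩
    obtain ⟨h1, h2, h3⟩ := h.coef_eq_zero hb hab hc hq hu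
    have hM := Mink.coefM_eq X q hd.ne'
    have hN := Mink.coefN_eq X q hd.ne'
    have hm := mnorm_nrm_ne X q hd.ne'
    simp only [h2, h3, mul_zero, mul_eq_zero, hm, false_or] at hM hN
    -- EG - F² > 0 excludes E = 0, so k = e/E is available; N₁ = 0 gives f = kF and M₁ = 0 gives g =
    -- kG.
    have hE : cE X q ≠ 0 := by
      intro hE
      simp only [detI, hE] at hd
      nlinarith [sq_nonneg (cF X q)]
    refine ⟨ce X q / cE X q, ?_, ?_, ?_⟩
    · field_simp
    · field_simp; linarith
    · field_simp; linarith

theorem LPL_eq_empty (hb : 0 < b) (hab : b < a) (hc : 0 < c) :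
    LPL (ellipsoid a b c) = ∅ := by
  rw [Set.eq_empty_iff_forall_notMem]
  rintro p ⟨hu, U, X, q, ⟨h, hq, rfl⟩, h0⟩
  rw [mem_umbilics_iff hb hab hc] at hu
  refine hu ⟨h.mapsTo hq, (prinDisc_eq_zero_iff hb hab hc _).1 ?_⟩
  rw [h.coef_disc hq] at h0
  simpa [h.conormalFactor_ne hq] using h0

/-! ### The two principal directions at a non-umbilic point -/

theorem exists_roots_of_disc_pos {L M N : ℝ} (h : 0 < M ^ 2 - 4 * L * N) :
    ∃ x₁ y₁ x₂ y₂ : ℝ, x₁ * y₂ - x₂ * y₁ ≠ 0 ∧ ∀ x y : ℝ,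
      L * y ^ 2 + M * (x * y) + N * x ^ 2 = 0 ↔
        ∃ r : ℝ, (x = r * x₁ ∧ y = r * y₁) ∨ (x = r * x₂ ∧ y = r * y₂) := by
  by_cases hL : L = 0
  · subst hL
    have hM : M ≠ 0 := by rintro rfl; simp at h
    refine ⟨0, 1, M, -N, by simpa using hM, fun x y => ⟨fun he => ?_, ?_⟩⟩
    · have : x * (M * y + N * x) = 0 := by linarith
      rcases mul_eq_zero.1 this with h1 | h1
      · exact ⟨y, Or.inl (by simp [h1])⟩
      · refine ⟨x / M, Or.inr ⟨by field_simp, ?_⟩⟩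
        field_simp; linarith
    · rintro ⟨r, ⟨rfl, rfl⟩ | ⟨rfl, rfl⟩⟩ <;> ring
  · set s := Real.sqrt (M ^ 2 - 4 * L * N) with hs
    have hs0 : 0 < s := Real.sqrt_pos.2 h
    have hs2 : s ^ 2 = M ^ 2 - 4 * L * N := Real.sq_sqrt h.le
    refine ⟨2 * L, -M + s, 2 * L, -M - s, ?_, fun x y => ⟨fun he => ?_, ?_⟩⟩
    · have : 2 * L * (-M - s) - 2 * L * (-M + s) = -4 * (L * s) := by ring
      rw [this]
      exact mul_ne_zero (by norm_num) (mul_ne_zero hL hs0.ne')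
    -- Completing the square: 4L times the form is (2Ly + Mx)² - s²x².
    · have : (2 * L * y + M * x - s * x) * (2 * L * y + M * x + s * x) = 0 := by
        linear_combination 4 * L * he - x ^ 2 * hs2
      rcases mul_eq_zero.1 this with h1 | h1
      · exact ⟨x / (2 * L), Or.inl ⟨by field_simp, by field_simp; linarith⟩⟩
      · exact ⟨x / (2 * L), Or.inr ⟨by field_simp, by field_simp; linarith⟩⟩
    · rintro ⟨r, ⟨rfl, rfl⟩ | ⟨rfl, rfl⟩⟩
      · linear_combination L * r ^ 2 * hs2
      · linear_combination L * r ^ 2 * hs2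

theorem exists_principal_directions (hb : 0 < b) (hab : b < a) (hc : 0 < c) {p : E3}
    (hp : p ∈ ellipsoid a b c) (hu : p ∉ umbilics (ellipsoid a b c)) :
    ∃ w₁ w₂ : E3, LinearIndependent ℝ ![w₁, w₂] ∧
      ∀ w : E3, IsPrincipalVector (ellipsoid a b c) p w ↔ ∃ r : ℝ, w = r • w₁ ∨ w = r • w₂ := by
  obtain ⟨U, X, q, h, hq, rfl⟩ := exists_isChartAt (hb.trans hab) hb hc hp
  have hD : 0 < coefM X q ^ 2 - 4 * coefL X q * coefN X q := by
    rw [h.coef_disc hq]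
    refine mul_pos ?_ (lt_of_le_of_ne (prinDisc_nonneg hb hab _) fun h0 => hu ?_)
    · have := h.conormalFactor_ne hq
      positivity
    · exact (mem_umbilics_iff hb hab hc).2 ⟨hp, (prinDisc_eq_zero_iff hb hab hc _).1 h0.symm⟩
  obtain ⟨x₁, y₁, x₂, y₂, hne, hroots⟩ := exists_roots_of_disc_pos hD
  have hind := LinearIndependent.pair_iff.1 (h.immersion q hq)
  refine ⟨x₁ • dU X q + y₁ • dV X q, x₂ • dU X q + y₂ • dV X q, ?_, fun w => ?_⟩
  · rw [LinearIndependent.pair_iff]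
    intro s t hst
    obtain ⟨e1, e2⟩ := hind (s * x₁ + t * x₂) (s * y₁ + t * y₂) (by rw [← hst]; module)
    constructor
    · apply (mul_eq_zero.1 _).resolve_right hne
      linear_combination y₂ * e1 - x₂ * e2
    · apply (mul_eq_zero.1 _).resolve_right hne
      linear_combination x₁ * e2 - y₁ * e1
  · rw [isPrincipalVector_iff (hb.trans hab) hb hc]
    constructor
    · rintro ⟨-, hw, hQ⟩
      obtain ⟨ξ, η, rfl⟩ := h.exists_coords hq hw
      have he := h.coef_eq hq ξ η
      rw [hQ, mul_zero] at he
      obtain ⟨r, ⟨rfl, rfl⟩ | ⟨rfl, rfl⟩⟩ := (hroots ξ η).1 he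
      · exact ⟨r, Or.inl (by module)⟩
      · exact ⟨r, Or.inr (by module)⟩
    · have key : ∀ ξ η : ℝ, coefL X q * η ^ 2 + coefM X q * (ξ * η) + coefN X q * ξ ^ 2 = 0 →
          X q ∈ ellipsoid a b c ∧ shapeForm a b c (X q) (ξ • dU X q + η • dV X q) = 0 ∧
            prinForm a b c (X q) (ξ • dU X q + η • dV X q) = 0 := by
        intro ξ η he
        refine (isPrincipalVector_iff (hb.trans hab) hb hc).1
          ⟨U, X, q, ⟨h, hq, rfl⟩, ξ, η, rfl, he⟩
      rintro ⟨r, rfl | rfl⟩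
      · rw [show r • (x₁ • dU X q + y₁ • dV X q) = (r * x₁) • dU X q + (r * y₁) • dV X q by module]
        exact key _ _ ((hroots _ _).2 ⟨r, Or.inl ⟨rfl, rfl⟩⟩)
      · rw [show r • (x₂ • dU X q + y₂ • dV X q) = (r * x₂) • dU X q + (r * y₂) • dV X q by module]
        exact key _ _ ((hroots _ _).2 ⟨r, Or.inr ⟨rfl, rfl⟩⟩)

end

/-! ### The Lie-Cartan field over an umbilic point -/

section
variable {M : Set E3} {U : Set (ℝ × ℝ)} {X : ℝ × ℝ → E3} {q : ℝ × ℝ}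

theorem IsChart.hasFDerivAt_coefs (h : IsChart M U X) (hq : q ∈ U) :
    HasFDerivAt (coefL X) (fderiv ℝ (coefL X) q) q ∧
    HasFDerivAt (coefM X) (fderiv ℝ (coefM X) q) q ∧
    HasFDerivAt (coefN X) (fderiv ℝ (coefN X) q) q :=
  ⟨((contDiffAt_coefL (h.contDiffAt hq)).differentiableAt (by simp)).hasFDerivAt,
    ((contDiffAt_coefM (h.contDiffAt hq)).differentiableAt (by simp)).hasFDerivAt,
    ((contDiffAt_coefN (h.contDiffAt hq)).differentiableAt (by simp)).hasFDerivAt⟩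

theorem IsChart.fderiv_implF (h : IsChart M U X) (hq : q ∈ U) (m : ℝ) (w : (ℝ × ℝ) × ℝ) :
    fderiv ℝ (implF X) (q, m) w = fderiv ℝ (coefL X) q w.1 * m ^ 2 +
      fderiv ℝ (coefM X) q w.1 * m + fderiv ℝ (coefN X) q w.1 +
      (2 * coefL X q * m + coefM X q) * w.2 := by
  obtain ⟨hL, hM, hN⟩ := h.hasFDerivAt_coefs hq
  have hf : HasFDerivAt (fun z : (ℝ × ℝ) × ℝ => z.1) _ (q, m) := hasFDerivAt_fst (𝕜 := ℝ)
  have hs : HasFDerivAt (fun z : (ℝ × ℝ) × ℝ => z.2) _ (q, m) := hasFDerivAt_snd (𝕜 := ℝ)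
  have := (((HasFDerivAt.comp (q, m) (f := fun z : (ℝ × ℝ) × ℝ => z.1) hL hf).mul (hs.pow 2)).add
    ((HasFDerivAt.comp (q, m) (f := fun z : (ℝ × ℝ) × ℝ => z.1) hM hf).mul hs)).add
    (HasFDerivAt.comp (q, m) (f := fun z : (ℝ × ℝ) × ℝ => z.1) hN hf)
  have h2 : HasFDerivAt (implF X) _ (q, m) := this
  rw [h2.fderiv]
  simp
  ring

theorem IsChart.fderiv_implG (h : IsChart M U X) (hq : q ∈ U) (m : ℝ) (w : (ℝ × ℝ) × ℝ) :
    fderiv ℝ (implG X) (q, m) w = fderiv ℝ (coefL X) q w.1 +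
      fderiv ℝ (coefM X) q w.1 * m + fderiv ℝ (coefN X) q w.1 * m ^ 2 +
      (coefM X q + 2 * coefN X q * m) * w.2 := by
  obtain ⟨hL, hM, hN⟩ := h.hasFDerivAt_coefs hq
  have hf : HasFDerivAt (fun z : (ℝ × ℝ) × ℝ => z.1) _ (q, m) := hasFDerivAt_fst (𝕜 := ℝ)
  have hs : HasFDerivAt (fun z : (ℝ × ℝ) × ℝ => z.2) _ (q, m) := hasFDerivAt_snd (𝕜 := ℝ)
  have := ((HasFDerivAt.comp (q, m) (f := fun z : (ℝ × ℝ) × ℝ => z.1) hL hf).add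
    ((HasFDerivAt.comp (q, m) (f := fun z : (ℝ × ℝ) × ℝ => z.1) hM hf).mul hs)).add
    ((HasFDerivAt.comp (q, m) (f := fun z : (ℝ × ℝ) × ℝ => z.1) hN hf).mul (hs.pow 2))
  have h2 : HasFDerivAt (implG X) _ (q, m) := this
  rw [h2.fderiv]
  simp
  ring

theorem contDiffAt_implF (h : ContDiffAt ℝ ∞ X q) (m : ℝ) : ContDiffAt ℝ ∞ (implF X) (q, m) := by
  have hf : ContDiffAt ℝ ∞ (fun z : (ℝ × ℝ) × ℝ => z.1) (q, m) := contDiffAt_fst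
  have hs : ContDiffAt ℝ ∞ (fun z : (ℝ × ℝ) × ℝ => z.2) (q, m) := contDiffAt_snd
  exact (((ContDiffAt.comp (q, m) (contDiffAt_coefL h) hf).mul (hs.pow 2)).add
    ((ContDiffAt.comp (q, m) (contDiffAt_coefM h) hf).mul hs)).add
    (ContDiffAt.comp (q, m) (contDiffAt_coefN h) hf)

theorem differentiableAt_lieCartan (h : ContDiffAt ℝ ∞ X q) (m : ℝ) :
    DifferentiableAt ℝ (lieCartan X) (q, m) := by
  have h1 : ContDiffAt ℝ ∞ (fderiv ℝ (implF X)) (q, m) :=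
    (contDiffAt_implF h m).fderiv_right (by simp)
  have hp : ∀ v : (ℝ × ℝ) × ℝ, DifferentiableAt ℝ (fun z => fderiv ℝ (implF X) z v) (q, m) :=
    fun v => (h1.clm_apply contDiffAt_const).differentiableAt (by simp)
  have hs : DifferentiableAt ℝ (fun z : (ℝ × ℝ) × ℝ => z.2) (q, m) := differentiableAt_snd
  exact ((hp _).prodMk (hs.mul (hp _))).prodMk ((hp _).add (hs.mul (hp _))).neg

theorem IsChart.lieCartan_eq (h : IsChart M U X) (hq : q ∈ U) (m : ℝ) :
    lieCartan X (q, m) = ((2 * coefL X q * m + coefM X q, m * (2 * coefL X q * m + coefM X q)),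
      -(fderiv ℝ (coefL X) q (1, 0) * m ^ 2 + fderiv ℝ (coefM X) q (1, 0) * m
        + fderiv ℝ (coefN X) q (1, 0) + m * (fderiv ℝ (coefL X) q (0, 1) * m ^ 2
        + fderiv ℝ (coefM X) q (0, 1) * m + fderiv ℝ (coefN X) q (0, 1)))) := by
  simp only [lieCartan, pm, pu, pv, h.fderiv_implF hq]
  simp [Prod.mk_zero_zero]

/-- A sufficient condition for the direction `dv = 0` over an umbilic point to be a hyperbolic
saddle of the Lie-Cartan field. -/
theorem IsChart.isLieCartanSaddle_zero (h : IsChart M U X) (hq : q ∈ U) {k : ℝ} (hk : k ≠ 0)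
    (hL : coefL X q = 0) (hM : coefM X q = 0) (hN : coefN X q = 0)
    (hNu : fderiv ℝ (coefN X) q (1, 0) = 0) (hMu : fderiv ℝ (coefM X) q (1, 0) = -2 * k)
    (hNv : fderiv ℝ (coefN X) q (0, 1) = k) : IsLieCartanSaddle X (q, 0) := by
  have hT := (differentiableAt_lieCartan (h.contDiffAt hq) 0).hasFDerivAt
  set T := fderiv ℝ (lieCartan X) (q, 0)
  have hnear : ∀ᶠ z : (ℝ × ℝ) × ℝ in 𝓝 (q, 0), z.1 ∈ U :=
    continuous_fst.continuousAt.eventually (h.isOpen.mem_nhds hq)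
  have hf : HasFDerivAt (fun z : (ℝ × ℝ) × ℝ => z.1) _ (q, (0 : ℝ)) := hasFDerivAt_fst (𝕜 := ℝ)
  have hs : HasFDerivAt (fun z : (ℝ × ℝ) × ℝ => z.2) _ (q, (0 : ℝ)) := hasFDerivAt_snd (𝕜 := ℝ)
  obtain ⟨dL, dM, dN⟩ := h.hasFDerivAt_coefs hq
  have hpm := ((((HasFDerivAt.comp (q, (0 : ℝ)) (f := fun z : (ℝ × ℝ) × ℝ => z.1) dL hf).const_mul
    2).mul hs).add (HasFDerivAt.comp (q, (0 : ℝ)) (f := fun z : (ℝ × ℝ) × ℝ => z.1) dM hf))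
  have h11 : HasFDerivAt (fun z => (lieCartan X z).1.1) _ (q, (0 : ℝ)) :=
    hpm.congr_of_eventuallyEq (hnear.mono fun z hz => by
      change (lieCartan X (z.1, z.2)).1.1 = _
      rw [h.lieCartan_eq hz]; rfl)
  have h12 : HasFDerivAt (fun z => (lieCartan X z).1.2) _ (q, (0 : ℝ)) :=
    (hs.mul hpm).congr_of_eventuallyEq (hnear.mono fun z hz => by
      change (lieCartan X (z.1, z.2)).1.2 = _
      rw [h.lieCartan_eq hz]; rfl)
  -- Since L₁ = M₁ = 0 at q and m = 0, only dM₁ survives in the first row of the linear part, and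
  -- the second row vanishes.
  have e11 : ∀ w, (T w).1.1 = fderiv ℝ (coefM X) q w.1 := by
    intro w
    have := DFunLike.congr_fun (hT.fst.fst.unique h11) w
    simpa [hL] using this
  have e12 : ∀ w, (T w).1.2 = 0 := by
    intro w
    have := DFunLike.congr_fun (hT.fst.snd.unique h12) w
    simpa [hL, hM] using this
  have e2 : (T ((0, 0), 1)).2 = k := by
    have hline : HasDerivAt (fun t : ℝ => ((q, t) : (ℝ × ℝ) × ℝ)) ((0, 0), 1) 0 :=
      (hasDerivAt_const _ _).prodMk (hasDerivAt_id _)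
    have h1 : HasDerivAt (fun t : ℝ => (lieCartan X (q, t)).2) (T ((0, 0), 1)).2 0 :=
      hT.snd.comp_hasDerivAt (f := fun t : ℝ => ((q, t) : (ℝ × ℝ) × ℝ)) 0 hline
    have h2 : HasDerivAt (fun t : ℝ => (lieCartan X (q, t)).2) k 0 := by
      simp only [h.lieCartan_eq hq]
      have hid := hasDerivAt_id (0 : ℝ)
      have := ((((hid.pow 2).const_mul (fderiv ℝ (coefL X) q (1, 0))).add
        (hid.const_mul (fderiv ℝ (coefM X) q (1, 0)))).add_const
        (fderiv ℝ (coefN X) q (1, 0))).add (hid.mul ((((hid.pow 2).const_mul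
        (fderiv ℝ (coefL X) q (0, 1))).add (hid.const_mul
        (fderiv ℝ (coefM X) q (0, 1)))).add_const (fderiv ℝ (coefN X) q (0, 1))))
      exact this.neg.congr_deriv (by simp [hMu, hNv]; ring)
    exact h1.unique h2
  have hv1 : T ((0, 0), 1) = k • (((0, 0), 1) : (ℝ × ℝ) × ℝ) := by
    refine Prod.ext (Prod.ext ?_ ?_) ?_
    · simpa [Prod.mk_zero_zero] using e11 ((0, 0), 1)
    · simpa using e12 ((0, 0), 1)
    · simpa using e2
  -- Since dN₁ = k dv, the tangent plane of the surface is dv = 0. There the linear part is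
  -- triangular with eigenvalues k on ∂m and -2k on some (1, 0, s); the third component determines
  -- s, solvably because 3k ≠ 0.
  obtain ⟨s, hs'⟩ : ∃ s : ℝ, (T ((1, 0), 0)).2 + s * k = -2 * k * s :=
    ⟨-(T ((1, 0), 0)).2 / (3 * k), by field_simp; ring⟩
  have hv2 : T ((1, 0), s) = (-2 * k) • (((1, 0), s) : (ℝ × ℝ) × ℝ) := by
    refine Prod.ext (Prod.ext ?_ ?_) ?_
    · simpa [hMu] using e11 ((1, 0), s)
    · simpa using e12 ((1, 0), s)
    · have : (((1, 0), s) : (ℝ × ℝ) × ℝ) = ((1, 0), 0) + s • ((0, 0), 1) := by simp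
      rw [this, map_add, map_smul, hv1]
      simpa using hs'
  have hk1 : fderiv ℝ (implF X) (q, 0) ((0, 0), 1) = 0 := by
    rw [h.fderiv_implF hq]; simp [hM, Prod.mk_zero_zero]
  have hk2 : fderiv ℝ (implF X) (q, 0) ((1, 0), s) = 0 := by
    rw [h.fderiv_implF hq]; simp [hM, hNu]
  refine ⟨by simp [implF, hN], fun h0 => hk ?_, ?_, ?_⟩
  · have := h.fderiv_implF hq 0 ((0, 1), 0)
    rw [h0] at this
    simpa [hNv] using this.symm
  · rw [h.lieCartan_eq hq]; simp [hM, hNu]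
  · have hn1 : (((0, 0), 1) : (ℝ × ℝ) × ℝ) ≠ 0 := by simp
    have hn2 : (((1, 0), s) : (ℝ × ℝ) × ℝ) ≠ 0 := by simp
    rcases lt_or_gt_of_ne hk with hk' | hk'
    · exact ⟨k, -2 * k, _, _, hk', by linarith, hn1, hn2, hk1, hk2, hv1, hv2⟩
    · exact ⟨-2 * k, k, _, _, by linarith, hk', hn2, hn1, hk2, hk1, hv2, hv1⟩

end

/-! ### Saddle directions and type D₁ at the umbilic points of the ellipsoid -/

section
variable {a b c : ℝ}

theorem fderiv_prinForm (a b c : ℝ) {F G : ℝ × ℝ → E3} {q : ℝ × ℝ}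
    (hF : DifferentiableAt ℝ F q) (hG : DifferentiableAt ℝ G q) :
    DifferentiableAt ℝ (fun x => prinForm a b c (F x) (G x)) q ∧ ∀ v : ℝ × ℝ,
    fderiv ℝ (fun x => prinForm a b c (F x) (G x)) q v =
      prinForm a b c (fderiv ℝ F q v) (G q) +
      (F q 0 / a ^ 2 * (1 / b ^ 2 + 1 / c ^ 2) *
        (fderiv ℝ G q v 1 * G q 2 + G q 1 * fderiv ℝ G q v 2)
      - F q 1 / b ^ 2 * (1 / a ^ 2 + 1 / c ^ 2) *
        (fderiv ℝ G q v 0 * G q 2 + G q 0 * fderiv ℝ G q v 2)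
      + F q 2 / c ^ 2 * (1 / b ^ 2 - 1 / a ^ 2) *
        (fderiv ℝ G q v 0 * G q 1 + G q 0 * fderiv ℝ G q v 1)) := by
  have hF' := hasFDerivAt_pi'.1 hF.hasFDerivAt
  have hG' := hasFDerivAt_pi'.1 hG.hasFDerivAt
  have h := (((((hF' 0).mul_const (a ^ 2)⁻¹).mul_const (1 / b ^ 2 + 1 / c ^ 2)).mul
    ((hG' 1).mul (hG' 2))).sub ((((hF' 1).mul_const (b ^ 2)⁻¹).mul_const
    (1 / a ^ 2 + 1 / c ^ 2)).mul ((hG' 0).mul (hG' 2)))).add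
    ((((hF' 2).mul_const (c ^ 2)⁻¹).mul_const (1 / b ^ 2 - 1 / a ^ 2)).mul
    ((hG' 0).mul (hG' 1)))
  have h2 : HasFDerivAt (fun x => prinForm a b c (F x) (G x)) _ q := h
  refine ⟨h2.differentiableAt, fun v => ?_⟩
  rw [h2.fderiv]
  simp [prinForm]
  ring

theorem IsChart.differentiableAt_conormalFactor {U : Set (ℝ × ℝ)} {X : ℝ × ℝ → E3} {q : ℝ × ℝ}
    (h : IsChart (ellipsoid a b c) U X) (hq : q ∈ U) :
    DifferentiableAt ℝ (conormalFactor a b c X) q := by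
  have hX : ∀ (i : Fin 3) (k : ℝ), DifferentiableAt ℝ (fun x => X x i / k) q := fun i k => by
    simp only [div_eq_mul_inv]
    exact (differentiableAt_pi.1 ((h.contDiffAt hq).differentiableAt (by simp)) i).mul_const _
  have hn := differentiableAt_pi.1 ((contDiffAt_nrm (h.contDiffAt hq)).differentiableAt (by simp))
  have hpos := (conormal_sq_pos (h.shapeForm_eq_one hq)).ne'
  have hdiv : ∀ f g : ℝ × ℝ → ℝ, DifferentiableAt ℝ f q → DifferentiableAt ℝ g q → g q ≠ 0 →
      DifferentiableAt ℝ (fun x => f x / g x) q := fun f g hf hg h0 => by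
    simp only [div_eq_mul_inv]; exact hf.mul (hg.inv h0)
  refine hdiv (fun x => nrm X x 0 * (X x 0 / a ^ 2) + nrm X x 1 * (X x 1 / b ^ 2) -
    nrm X x 2 * (X x 2 / c ^ 2)) (fun x => (X x 0 / a ^ 2) ^ 2 + (X x 1 / b ^ 2) ^ 2 +
    (X x 2 / c ^ 2) ^ 2) ?_ ?_ hpos
  · exact (((hn 0).mul (hX 0 _)).add ((hn 1).mul (hX 1 _))).sub
      ((hn 2).mul (hX 2 _))
  · exact (((hX 0 _).pow 2).add ((hX 1 _).pow 2)).add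
      ((hX 2 _).pow 2)

theorem fderiv_mul_of_eq_zero {f g : ℝ × ℝ → ℝ} {q : ℝ × ℝ} (hf : DifferentiableAt ℝ f q)
    (hg : DifferentiableAt ℝ g q) (h0 : g q = 0) (v : ℝ × ℝ) :
    fderiv ℝ (fun x => f x * g x) q v = f q * fderiv ℝ g q v := by
  rw [fderiv_fun_mul hf hg]; simp [h0]

/-- At a zero of g the derivative of f drops out. The powers of `conormalFactor` thus only have to
be differentiable; their derivatives are never computed. -/
theorem fderiv_eq_of_factor {U : Set (ℝ × ℝ)} {C f g : ℝ × ℝ → ℝ} {g' : ℝ × ℝ →L[ℝ] ℝ}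
    {q : ℝ × ℝ} (hC : ∀ x ∈ U, C x = f x * g x) (hU : U ∈ 𝓝 q) (hf : DifferentiableAt ℝ f q)
    (hg : HasFDerivAt g g' q) (h0 : g q = 0) (v : ℝ × ℝ) : fderiv ℝ C q v = f q * g' v := by
  rw [Filter.EventuallyEq.fderiv_eq (Filter.eventually_of_mem hU hC),
    fderiv_mul_of_eq_zero hf hg.differentiableAt h0, hg.fderiv]

theorem shapeForm_self_pos (ha : 0 < a) (hb : 0 < b) (hc : 0 < c) {w : E3} {i : Fin 3}
    (hw : w i ≠ 0) : 0 < shapeForm a b c w w := by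
  have hpos := mul_self_pos.2 hw
  have h0 : 0 ≤ w 0 * w 0 / a ^ 2 := div_nonneg (mul_self_nonneg _) (by positivity)
  have h1 : 0 ≤ w 1 * w 1 / b ^ 2 := div_nonneg (mul_self_nonneg _) (by positivity)
  have h2 : 0 ≤ w 2 * w 2 / c ^ 2 := div_nonneg (mul_self_nonneg _) (by positivity)
  unfold shapeForm
  fin_cases i
  · have : 0 < w 0 * w 0 / a ^ 2 := div_pos hpos (by positivity)
    linarith
  · have : 0 < w 1 * w 1 / b ^ 2 := div_pos hpos (by positivity)
    linarith
  · have : 0 < w 2 * w 2 / c ^ 2 := div_pos hpos (by positivity)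
    linarith

/-- At an umbilic point the saddle directions of the Lie-Cartan field lie in the plane `y = 0`. -/
theorem IsSaddleVector.tangent {p w : E3} (hb : 0 < b) (hab : b < a) (hc : 0 < c)
    (hu : UmbilicEq a b c p) (hs : IsSaddleVector (ellipsoid a b c) p w) :
    w 1 = 0 ∧ shapeForm a b c p w = 0 ∧ w ≠ 0 := by
  have ha : 0 < a := hb.trans hab
  obtain ⟨U, X, q, ⟨h, hq, rfl⟩, m, s, hs0, ⟨-, -, hlc, -⟩, rfl⟩ := hs
  have hp := h.mapsTo hq
  set w : E3 := dU X q + m • dV X q with hw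
  have hwt : shapeForm a b c (X q) w = 0 := by
    have := shapeForm_comb a b c (X q) (dU X q) (dV X q) 1 m
    rw [one_smul, h.shapeForm_dU hq, h.shapeForm_dV hq] at this
    rw [hw, this]; ring
  have hwne : w ≠ 0 := by
    intro h0
    have := (LinearIndependent.pair_iff.1 (h.immersion q hq) 1 m (by rw [one_smul]; exact h0)).1
    exact one_ne_zero this
  refine ⟨?_, ?_, smul_ne_zero hs0 hwne⟩
  · suffices hw1 : w 1 = 0 by simp [hw1]
    have hW : ContDiffAt ℝ ∞ (fun x => dU X x + m • dV X x) q :=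
      (contDiffAt_dU (h.contDiffAt hq)).add ((contDiffAt_dV (h.contDiffAt hq)).const_smul m)
    have hWd := hW.differentiableAt (by simp)
    have hXd := (h.contDiffAt hq).differentiableAt (by simp)
    obtain ⟨hPd, hPf⟩ := fderiv_prinForm a b c hXd hWd
    -- The last component of the Lie-Cartan field at (q, m) is minus the derivative of 𝓕(·, m) in
    -- the direction (1, m).
    have hlast : fderiv ℝ (fun x => implF X (x, m)) q (1, m) = 0 := by
      obtain ⟨dL, dM, dN⟩ := h.hasFDerivAt_coefs hq
      have h1 : HasFDerivAt (fun x => implF X (x, m)) _ q :=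
        ((dL.mul_const (m ^ 2)).add (dM.mul_const m)).add dN
      have h2 := congrArg Prod.snd hlc
      rw [h.lieCartan_eq hq] at h2
      simp only [Prod.snd_zero, neg_eq_zero] at h2
      rw [h1.fderiv, show ((1, m) : ℝ × ℝ) = (1, 0) + m • (0, 1) by simp, map_add, map_smul]
      simp
      linarith
    have hfac : (fun x => implF X (x, m)) =ᶠ[𝓝 q] fun x => (-conormalFactor a b c X x ^ 2) *
        prinForm a b c (X x) (dU X x + m • dV X x) := by
      filter_upwards [h.isOpen.mem_nhds hq] with x hx
      have := h.coef_eq hx 1 m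
      rw [one_smul] at this
      rw [← this]
      simp only [implF]; ring
    have hcd := h.differentiableAt_conormalFactor hq
    rw [hfac.fderiv_eq, fderiv_mul_of_eq_zero
      (f := fun x => -conormalFactor a b c X x ^ 2) (hcd.pow 2).neg hPd
      (hu.prinForm_eq_zero hb hab hc hp hwt)] at hlast
    have hne : -conormalFactor a b c X q ^ 2 ≠ 0 :=
      neg_ne_zero.2 (pow_ne_zero 2 (h.conormalFactor_ne hq))
    have hder := (mul_eq_zero.1 hlast).resolve_left hne
    have hdX : fderiv ℝ X q (1, m) = w := by
      rw [show ((1, m) : ℝ × ℝ) = (1, 0) + m • (0, 1) by simp, map_add, map_smul]; rfl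
    -- Let D be the derivative of X_u + mX_v along (1, m), a direction that `X` maps to w. Then S(X,
    -- D) = -S(w, w).
    have hsec := h.shapeForm_second hq hWd (fun x hx => by
      have := shapeForm_comb a b c (X x) (dU X x) (dV X x) 1 m
      rw [one_smul, h.shapeForm_dU hx, h.shapeForm_dV hx] at this
      rw [this]; ring) (1, m)
    rw [hPf, hdX] at hder
    rw [hdX] at hsec
    change shapeForm a b c (X q) _ = -shapeForm a b c w w at hsec
    change prinForm a b c w w + _ = 0 at hder
    rw [← hw] at hder
    generalize fderiv ℝ (fun x => dU X x + m • dV X x) q (1, m) = D at *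
    have hself : prinForm a b c w w = 0 := by simp only [prinForm]; ring
    have hfac2 := hu.prinForm_factor hb hab hc hp hwt
    have hz := (hu.conormal_ne hb hab hc hp).2
    -- Because Q(w) vanishes with w itself as base point, the derivative of Q reduces to w₁ times a
    -- linear form in D₀, D₂. If w₁ ≠ 0, that form vanishes, and the umbilic equation turns this
    -- into S(X, D) = 0, contrary to S(w, w) > 0.
    by_contra hw1
    have hpos := shapeForm_self_pos ha hb hc hw1
    obtain ⟨hu1, hu2⟩ := hu
    rw [hself, hu1] at hder
    have h3 : X q 0 / a ^ 2 * (1 / b ^ 2 + 1 / c ^ 2) * D 2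
        + X q 2 / c ^ 2 * (1 / b ^ 2 - 1 / a ^ 2) * D 0 = 0 := by
      apply (mul_eq_zero.1 _).resolve_left hw1
      linear_combination hder - D 1 * hfac2
    have h4 : shapeForm a b c (X q) D = X q 0 / a ^ 2 * D 0 + X q 2 / c ^ 2 * D 2 := by
      simp [shapeForm, hu1]; ring
    have h5 : X q 0 / a ^ 2 * (1 / b ^ 2 + 1 / c ^ 2) *
        (X q 0 / a ^ 2 * D 0 + X q 2 / c ^ 2 * D 2) = 0 := by
      linear_combination (X q 2 / c ^ 2) * h3 + D 0 * hu2
    rw [← h4, hsec] at h5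
    have hx : X q 0 ≠ 0 := by
      intro h0
      rw [h0] at hu2
      have hk2 := inv_sq_sub_pos hb hab
      have : X q 2 = 0 ∨ 1 / b ^ 2 - 1 / a ^ 2 = 0 := by simpa [hc.ne'] using hu2.symm
      exact hz (this.resolve_right hk2.ne')
    have hk0 : 1 / b ^ 2 + 1 / c ^ 2 ≠ 0 := by positivity
    have : X q 0 / a ^ 2 ≠ 0 := by positivity
    have h6 : X q 0 / a ^ 2 * (1 / b ^ 2 + 1 / c ^ 2) ≠ 0 := mul_ne_zero this hk0
    have := (mul_eq_zero.1 h5).resolve_left h6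
    linarith
  · have := shapeForm_comb a b c (X q) w 0 s 0
    rw [hwt] at this
    simpa using this

/-- The derivatives at an umbilic point of the coefficients of the equation of principal lines in a
graph chart. -/
theorem graphChart_coefs {τ : ℝ} {p : E3} (hb : 0 < b) (hab : b < a) (hc : 0 < c)
    (hτ : τ = 1 ∨ τ = -1) (hp : p ∈ ellipsoid a b c) (hu : UmbilicEq a b c p)
    (hz : 0 < τ * p 2) :
    ∃ k : ℝ, k ≠ 0 ∧ (∀ v : ℝ × ℝ,
      fderiv ℝ (coefL (graphChart a b c τ)) (p 0, p 1) v =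
        -k * ((1 / b ^ 2 + 1 / c ^ 2) / (1 / a ^ 2 + 1 / c ^ 2)) * v.2 ∧
      fderiv ℝ (coefM (graphChart a b c τ)) (p 0, p 1) v = -2 * k * v.1 ∧
      fderiv ℝ (coefN (graphChart a b c τ)) (p 0, p 1) v = k * v.2) := by
  have ha : 0 < a := hb.trans hab
  have hp1 := hu.1
  have hp0 := (hu.conormal_ne hb hab hc hp).1
  obtain ⟨h, hq, hX⟩ := isChartAt_graphChart hc hτ hp hz
  set X := graphChart a b c τ with hXdef
  set U := graphDomain a b with hU
  have h0 : ∀ x, X x 0 = x.1 := fun x => rfl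
  have h1 : ∀ x, X x 1 = x.2 := fun x => rfl
  -- In a graph chart the last entry of X_u × X_v is -1, which forces λ = c²/z; tangency then gives
  -- the slopes of the graph.
  have hfac : ∀ x ∈ U, X x 2 ≠ 0 ∧ conormalFactor a b c X x = c ^ 2 / X x 2 ∧
      dU X x 2 = -(x.1 / a ^ 2 * conormalFactor a b c X x) ∧
      dV X x 2 = -(x.2 / b ^ 2 * conormalFactor a b c X x) := by
    intro x hx
    have hdu : dU X x 0 = 1 ∧ dU X x 1 = 0 := fderiv_graphChart a b c τ hx (1, 0)
    have hdv : dV X x 0 = 0 ∧ dV X x 1 = 1 := fderiv_graphChart a b c τ hx (0, 1)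
    have e2 := congrFun (h.nrm_eq hx) 2
    simp [nrm, cross, hdu, hdv] at e2
    have hz : X x 2 ≠ 0 := by rintro h0; simp [h0] at e2
    have hl : conormalFactor a b c X x = c ^ 2 / X x 2 := by field_simp at e2 ⊢; linarith
    refine ⟨hz, hl, ?_, ?_⟩
    · have := h.shapeForm_dU hx
      simp only [shapeForm, hdu, h0, h1, mul_zero, mul_one, zero_div, add_zero] at this
      rw [hl]; field_simp at this ⊢; linarith
    · have := h.shapeForm_dV hx
      simp only [shapeForm, hdv, h0, h1, mul_zero, mul_one, zero_div, zero_add] at this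
      rw [hl]; field_simp at this ⊢; linarith
  have hz2 : ∀ x ∈ U, (X x 2) ^ 2 / c ^ 2 = 1 - x.1 ^ 2 / a ^ 2 - x.2 ^ 2 / b ^ 2 := by
    intro x hx
    have : X x 0 ^ 2 / a ^ 2 + X x 1 ^ 2 / b ^ 2 + X x 2 ^ 2 / c ^ 2 = 1 := h.mapsTo hx
    rw [h0, h1] at this
    linarith
  have hL : ∀ x ∈ U, coefL X x = conormalFactor a b c X x ^ 3 *
      (1 / (a ^ 2 * b ^ 2) * (1 / b ^ 2 + 1 / c ^ 2) * (x.1 * x.2)) := by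
    intro x hx
    have hdv : dV X x 0 = 0 ∧ dV X x 1 = 1 := fderiv_graphChart a b c τ hx (0, 1)
    obtain ⟨-, -, hu2, hv2⟩ := hfac x hx
    rw [h.coefL_eq hx]
    simp only [prinForm, hdv, hv2, h0, h1]
    field_simp
    ring
  have hN : ∀ x ∈ U, coefN X x = conormalFactor a b c X x ^ 3 *
      (-(1 / (a ^ 2 * b ^ 2) * (1 / a ^ 2 + 1 / c ^ 2) * (x.1 * x.2))) := by
    intro x hx
    have hdu : dU X x 0 = 1 ∧ dU X x 1 = 0 := fderiv_graphChart a b c τ hx (1, 0)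
    obtain ⟨-, -, hu2, hv2⟩ := hfac x hx
    rw [h.coefN_eq hx]
    simp only [prinForm, hdu, hu2, h0, h1]
    field_simp
    ring
  have hM : ∀ x ∈ U, coefM X x = conormalFactor a b c X x ^ 3 *
      (1 / a ^ 4 * (1 / b ^ 2 + 1 / c ^ 2) * x.1 ^ 2 - 1 / b ^ 4 * (1 / a ^ 2 + 1 / c ^ 2) * x.2 ^ 2
        - 1 / c ^ 2 * (1 / b ^ 2 - 1 / a ^ 2) * (1 - x.1 ^ 2 / a ^ 2 - x.2 ^ 2 / b ^ 2)) := by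
    intro x hx
    have hdu : dU X x 0 = 1 ∧ dU X x 1 = 0 := fderiv_graphChart a b c τ hx (1, 0)
    have hdv : dV X x 0 = 0 ∧ dV X x 1 = 1 := fderiv_graphChart a b c τ hx (0, 1)
    obtain ⟨hz, hl, hu2, hv2⟩ := hfac x hx
    have e := h.coef_eq hx 1 1
    have e1 := hL x hx
    have e2 := hN x hx
    have : coefM X x = -conormalFactor a b c X x ^ 2 *
        prinForm a b c (X x) ((1:ℝ) • dU X x + (1:ℝ) • dV X x) - coefL X x - coefN X x := by
      linarith
    rw [this, e1, e2, ← hz2 x hx]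
    simp only [prinForm, Pi.add_apply, Pi.smul_apply, smul_eq_mul, hdu, hdv, hu2, hv2, h0, h1]
    rw [hl]
    field_simp
    ring
  set q : ℝ × ℝ := (p 0, p 1) with hqdef
  have hq1 : q.1 = p 0 := rfl
  have hq2 : q.2 = 0 := hp1
  have hdl : DifferentiableAt ℝ (fun x => conormalFactor a b c X x ^ 3) q :=
    (h.differentiableAt_conormalFactor hq).pow 3
  have hf : HasFDerivAt (fun x : ℝ × ℝ => x.1) _ q := hasFDerivAt_fst (𝕜 := ℝ)
  have hs : HasFDerivAt (fun x : ℝ × ℝ => x.2) _ q := hasFDerivAt_snd (𝕜 := ℝ)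
  have hnh := h.isOpen.mem_nhds hq
  have hlq := h.conormalFactor_ne hq
  -- N₁ = -λ³κxy with κ = (1/a² + 1/c²)/(a²b²). At y = 0 its differential is -λ³κx dy, so this is
  -- the value of k.
  refine ⟨-(conormalFactor a b c X q ^ 3 *
    (1 / (a ^ 2 * b ^ 2) * (1 / a ^ 2 + 1 / c ^ 2) * p 0)), ?_, fun v => ⟨?_, ?_, ?_⟩⟩
  · have : 1 / (a ^ 2 * b ^ 2) * (1 / a ^ 2 + 1 / c ^ 2) ≠ 0 := by positivity
    exact neg_ne_zero.2 (mul_ne_zero (pow_ne_zero 3 hlq) (mul_ne_zero this hp0))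
  · have hd := (hf.mul hs).const_mul (1 / (a ^ 2 * b ^ 2) * (1 / b ^ 2 + 1 / c ^ 2))
    rw [fderiv_eq_of_factor hL hnh hdl hd (by simp [hq2])]
    simp [hq2, hq1]
    field_simp
  · have hd := (((hf.pow 2).const_mul (1 / a ^ 4 * (1 / b ^ 2 + 1 / c ^ 2))).sub
      ((hs.pow 2).const_mul (1 / b ^ 4 * (1 / a ^ 2 + 1 / c ^ 2)))).sub
      ((((hf.pow 2).mul_const (a ^ 2)⁻¹).const_sub 1 |>.sub
        ((hs.pow 2).mul_const (b ^ 2)⁻¹)).const_mul (1 / c ^ 2 * (1 / b ^ 2 - 1 / a ^ 2)))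
    have hMz := (h.coef_eq_zero hb hab hc hq (by rw [hX]; exact hu)).2.1
    rw [hM q hq] at hMz
    rw [fderiv_eq_of_factor hM hnh hdl hd
      ((mul_eq_zero.1 hMz).resolve_left (pow_ne_zero 3 hlq))]
    simp [hq2, hq1]
    field_simp
    ring
  · have hd := ((hf.mul hs).const_mul (1 / (a ^ 2 * b ^ 2) * (1 / a ^ 2 + 1 / c ^ 2))).neg
    rw [fderiv_eq_of_factor hN hnh hdl hd (by simp [hq2])]
    simp [hq2, hq1]
    ring

theorem isLieCartanSaddle_graphChart {τ : ℝ} {p : E3} (hb : 0 < b) (hab : b < a) (hc : 0 < c)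
    (hτ : τ = 1 ∨ τ = -1) (hp : p ∈ ellipsoid a b c) (hu : UmbilicEq a b c p)
    (hz : 0 < τ * p 2) : IsLieCartanSaddle (graphChart a b c τ) ((p 0, p 1), 0) := by
  obtain ⟨k, hk, hd⟩ := graphChart_coefs hb hab hc hτ hp hu hz
  obtain ⟨h, hq, hX⟩ := isChartAt_graphChart hc hτ hp hz
  obtain ⟨hL, hM, hN⟩ := h.coef_eq_zero hb hab hc hq (by rw [hX]; exact hu)
  exact h.isLieCartanSaddle_zero hq hk hL hM hN (by rw [(hd _).2.2]; simp)
    (by rw [(hd _).2.1]; simp) (by rw [(hd _).2.2]; simp)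

/-- Let r be the ratio in `graphChart_coefs`. Over p one has d𝓕 = -2km du + k(1 - rm²) dv, which is
never zero, and the last component of the Lie-Cartan field is km(1 + rm²) with r > 0. At the
direction du = 0 the last component in the other chart is kr ≠ 0. -/
theorem isDarbouxianD1_of_umbilic {p : E3} (hb : 0 < b) (hab : b < a) (hc : 0 < c)
    (hp : p ∈ ellipsoid a b c) (hu : UmbilicEq a b c p) :
    IsDarbouxianD1 (ellipsoid a b c) p := by
  obtain ⟨τ, hτ, hz⟩ := exists_sign (hu.conormal_ne hb hab hc hp).2
  obtain ⟨k, hk, hd⟩ := graphChart_coefs hb hab hc hτ hp hu hz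
  obtain ⟨h, hq, hX⟩ := isChartAt_graphChart hc hτ hp hz
  obtain ⟨hL, hM, hN⟩ := h.coef_eq_zero hb hab hc hq (by rw [hX]; exact hu)
  have hr : 0 < (1 / b ^ 2 + 1 / c ^ 2) / (1 / a ^ 2 + 1 / c ^ 2) := by positivity
  set r := (1 / b ^ 2 + 1 / c ^ 2) / (1 / a ^ 2 + 1 / c ^ 2)
  refine ⟨_, _, _, ⟨h, hq, hX⟩, hL, hM, hN, fun m h0 => ?_, fun m h0 => ?_,
    ⟨0, isLieCartanSaddle_graphChart hb hab hc hτ hp hu hz, fun m h0 => ?_⟩, fun h0 => ?_⟩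
  · have e1 := h.fderiv_implF hq m ((1, 0), 0)
    have e2 := h.fderiv_implF hq m ((0, 1), 0)
    rw [h0] at e1 e2
    simp [(hd _).1, (hd _).2.1, (hd _).2.2, hk] at e1 e2
    rw [e1] at e2
    simp at e2
    exact hk e2.symm
  · have e1 := h.fderiv_implG hq m ((1, 0), 0)
    have e2 := h.fderiv_implG hq m ((0, 1), 0)
    rw [h0] at e1 e2
    simp [(hd _).1, (hd _).2.1, (hd _).2.2, hk] at e1 e2
    rw [e1] at e2
    simp [hk, hr.ne'] at e2
  · have e := congrArg Prod.snd h0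
    rw [h.lieCartan_eq hq] at e
    simp only [(hd _).1, (hd _).2.1, (hd _).2.2, Prod.snd_zero] at e
    have : k * (1 + r * m ^ 2) * m = 0 := by linear_combination e
    have h1 : k * (1 + r * m ^ 2) ≠ 0 := mul_ne_zero hk (by positivity)
    exact (mul_eq_zero.1 this).resolve_left h1
  · have e := congrArg Prod.snd h0
    simp only [lieCartan', pm, pu, pv, h.fderiv_implG hq] at e
    simp [(hd _).1, hk, hr.ne'] at e

theorem isSaddleVector_of_tangent {p w : E3} (hb : 0 < b) (hab : b < a) (hc : 0 < c)
    (hp : p ∈ ellipsoid a b c) (hu : UmbilicEq a b c p) (hw1 : w 1 = 0)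
    (hw : shapeForm a b c p w = 0) (hw0 : w 0 ≠ 0) : IsSaddleVector (ellipsoid a b c) p w := by
  obtain ⟨τ, hτ, hz⟩ := exists_sign (hu.conormal_ne hb hab hc hp).2
  have hs := isLieCartanSaddle_graphChart hb hab hc hτ hp hu hz
  obtain ⟨h, hq, hX⟩ := isChartAt_graphChart hc hτ hp hz
  refine ⟨_, _, _, ⟨h, hq, hX⟩, 0, w 0, hw0, hs, ?_⟩
  have hdu : dU (graphChart a b c τ) (p 0, p 1) 0 = 1 ∧ dU (graphChart a b c τ) (p 0, p 1) 1 = 0 :=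
    fderiv_graphChart a b c τ hq (1, 0)
  have ht := h.shapeForm_dU hq
  rw [hX] at ht
  have hz2 := (hu.conormal_ne hb hab hc hp).2
  simp only [shapeForm, hdu, hw1] at ht hw
  ext i
  fin_cases i
  · simp [hdu]
  · simp [hdu, hw1]
  · simp
    apply mul_left_cancel₀ (div_ne_zero hz2 (pow_ne_zero 2 hc.ne'))
    linear_combination hw - w 0 * ht

end

/-! ### Two lemmas on ordinary differential equations -/

/-- Uniqueness against the zero solution; continuity of h at t₀ supplies the Lipschitz constant |h
t₀| + 1 nearby. -/
theorem eventually_eq_zero_of_linear_ode {y h : ℝ → ℝ} {t₀ : ℝ} (hh : ContinuousAt h t₀)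
    (hy : ∀ᶠ t in 𝓝 t₀, HasDerivAt y (h t * y t) t) (h0 : y t₀ = 0) : ∀ᶠ t in 𝓝 t₀, y t = 0 := by
  have hb : ∀ᶠ t in 𝓝 t₀, |h t| < |h t₀| + 1 :=
    hh.abs.eventually_lt continuousAt_const (by linarith)
  obtain ⟨ε, hε, hball⟩ := Metric.eventually_nhds_iff_ball.1 (hb.and hy)
  rw [Real.ball_eq_Ioo] at hball
  have hu := ODE_solution_unique_of_mem_Ioo (v := fun t z => h t * z) (s := fun _ => Set.univ)
    (K := ⟨|h t₀| + 1, by positivity⟩) (a := t₀ - ε) (b := t₀ + ε) (t₀ := t₀) (f := y)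
    (g := fun _ => (0 : ℝ)) ?_ ⟨by linarith, by linarith⟩ (fun t ht => ⟨(hball t ht).2, trivial⟩)
    (fun t _ => ⟨by simpa using hasDerivAt_const t (0 : ℝ), trivial⟩) h0
  · filter_upwards [Ioo_mem_nhds (show t₀ - ε < t₀ by linarith) (show t₀ < t₀ + ε by linarith)]
      with t ht using hu ht
  · intro t ht
    refine (LipschitzWith.of_dist_le_mul fun u v => ?_).lipschitzOnWith
    rw [Real.dist_eq, Real.dist_eq, ← mul_sub, abs_mul]
    exact mul_le_mul_of_nonneg_right (hball t ht).1.le (abs_nonneg _)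

/-- Carries the sign of a derivative back from infinity. All estimates in the saddle argument below
have this shape. -/
theorem nonneg_of_antitone_tendsto {F F' : ℝ → ℝ} {T : ℝ} (hF : ∀ t, T ≤ t → HasDerivAt F (F' t) t)
    (hF' : ∀ t, T ≤ t → F' t ≤ 0) (hlim : Filter.Tendsto F Filter.atTop (𝓝 0)) {t : ℝ}
    (ht : T ≤ t) : 0 ≤ F t := by
  have hanti : AntitoneOn F (Set.Ici T) := by
    refine antitoneOn_of_deriv_nonpos (convex_Ici T)
      (fun t ht => (hF t ht).continuousAt.continuousWithinAt) ?_ ?_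
    · intro t ht
      rw [interior_Ici] at ht
      exact (hF t (le_of_lt ht)).differentiableAt.differentiableWithinAt
    · intro t ht
      rw [interior_Ici] at ht
      rw [(hF t (le_of_lt ht)).deriv]
      exact hF' t (le_of_lt ht)
  refine le_of_tendsto hlim ?_
  filter_upwards [Filter.eventually_ge_atTop t] with s hs
  exact hanti ht (ht.trans hs) hs

/-- Put U = x - x₀ and m = y'/x' → 0. As x' < 0 eventually, U is positive, and comparing derivatives
gives |y| ≤ εU for every ε > 0, so y/U → 0. The equation reads mU = yR with R → 1/2 < 1. Hence
(y/U)² has derivative -2x'(1 - R)y²/U³ ≥ 0: it is nondecreasing and tends to 0, so it vanishes.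
Heuristically, a nonzero y would grow like √U, against m → 0. -/
theorem eventually_eq_zero_of_saddle_neg {A B x₀ s : ℝ} (hA : 0 < A) (hx₀ : x₀ ≠ 0) (hs : s < 0)
    {x y x' y' ρ : ℝ → ℝ} (hx : ∀ t, HasDerivAt x (x' t) t) (hy : ∀ t, HasDerivAt y (y' t) t)
    (hxl : Filter.Tendsto x Filter.atTop (𝓝 x₀)) (hyl : Filter.Tendsto y Filter.atTop (𝓝 0))
    (hρ : ∀ t, 0 < ρ t) (hxs : Filter.Tendsto (fun t => ρ t * x' t) Filter.atTop (𝓝 s))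
    (hys : Filter.Tendsto (fun t => ρ t * y' t) Filter.atTop (𝓝 0))
    (heq : ∀ t, -B * x t * y t * y' t ^ 2 + (A * (x₀ ^ 2 - x t ^ 2) + B * y t ^ 2) * x' t * y' t
      + A * x t * y t * x' t ^ 2 = 0) : ∀ᶠ t in Filter.atTop, y t = 0 := by
  have hm : Filter.Tendsto (fun t => y' t / x' t) Filter.atTop (𝓝 0) := by
    have := hys.div hxs hs.ne
    rw [zero_div] at this
    refine this.congr fun t => ?_
    simp only [Pi.div_apply]
    rw [mul_div_mul_left _ _ (hρ t).ne']
  have hx'neg : ∀ᶠ t in Filter.atTop, x' t < 0 := by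
    filter_upwards [hxs.eventually_lt_const hs] with t ht
    by_contra hn
    exact absurd ht (not_lt.2 (mul_nonneg (hρ t).le (not_lt.1 hn)))
  have hU0 : Filter.Tendsto (fun t => x t - x₀) Filter.atTop (𝓝 0) := by
    simpa using hxl.sub_const x₀
  have hbound : ∀ ε > 0, ∀ᶠ t in Filter.atTop, |y t| ≤ ε * (x t - x₀) := by
    intro ε hε
    have h1 : ∀ᶠ t in Filter.atTop, |y' t / x' t| < ε := by
      have := hm.abs
      rw [abs_zero] at this
      exact this.eventually_lt_const hε
    obtain ⟨T, hT⟩ := Filter.eventually_atTop.1 (h1.and hx'neg)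
    filter_upwards [Filter.eventually_ge_atTop T] with t ht
    have hy' : ∀ t, T ≤ t → |y' t| ≤ -(ε * x' t) := by
      intro t ht
      obtain ⟨h2, h3⟩ := hT t ht
      rw [abs_div, div_lt_iff₀ (abs_pos.2 h3.ne), abs_of_neg h3] at h2
      linarith
    have e1 := nonneg_of_antitone_tendsto (F := fun t => ε * (x t - x₀) - y t)
      (fun t _ => (((hx t).sub_const x₀).const_mul ε).sub (hy t))
      (fun t ht => by have := neg_abs_le (y' t); have := hy' t ht; linarith)
      (by simpa using (hU0.const_mul ε).sub hyl) ht
    have e2 := nonneg_of_antitone_tendsto (F := fun t => ε * (x t - x₀) + y t)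
      (fun t _ => (((hx t).sub_const x₀).const_mul ε).add (hy t))
      (fun t ht => by have := le_abs_self (y' t); have := hy' t ht; linarith)
      (by simpa using (hU0.const_mul ε).add hyl) ht
    rw [abs_le]
    exact ⟨by linarith, by linarith⟩
  have hUpos : ∀ᶠ t in Filter.atTop, 0 < x t - x₀ := by
    obtain ⟨T, hT⟩ := Filter.eventually_atTop.1 hx'neg
    have hnn : ∀ t, T ≤ t → 0 ≤ x t - x₀ := fun t ht =>
      nonneg_of_antitone_tendsto (fun t _ => (hx t).sub_const x₀) (fun t ht => (hT t ht).le) hU0 ht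
    have hanti : StrictAntiOn x (Set.Ici T) := by
      refine strictAntiOn_of_deriv_neg (convex_Ici T)
        (fun t _ => (hx t).continuousAt.continuousWithinAt) fun t ht => ?_
      rw [interior_Ici] at ht
      rw [(hx t).deriv]
      exact hT t (le_of_lt ht)
    filter_upwards [Filter.eventually_ge_atTop T] with t ht
    have h1 := hanti (show T ≤ t from ht) (show T ≤ t + 1 by linarith) (by linarith : t < t + 1)
    have h2 := hnn (t + 1) (by linarith)
    linarith
  have hyU : Filter.Tendsto (fun t => y t / (x t - x₀)) Filter.atTop (𝓝 0) := by
    rw [Metric.tendsto_atTop']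
    intro ε hε
    obtain ⟨T, hT⟩ := Filter.eventually_atTop.1 ((hbound (ε / 2) (by linarith)).and hUpos)
    refine ⟨T, fun t ht => ?_⟩
    obtain ⟨h1, h2⟩ := hT t ht.le
    rw [Real.dist_eq, sub_zero, abs_div, abs_of_pos h2, div_lt_iff₀ h2]
    nlinarith
  have hK : Filter.Tendsto (fun t => A * (x t + x₀) - B * (y t / (x t - x₀) * y t)) Filter.atTop
      (𝓝 (A * (x₀ + x₀) - B * (0 * 0))) :=
    ((hxl.add_const x₀).const_mul A).sub ((hyU.mul hyl).const_mul B)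
  have hKne : A * (x₀ + x₀) - B * (0 * 0) ≠ 0 := by
    have : A * (x₀ + x₀) - B * (0 * 0) = 2 * (A * x₀) := by ring
    rw [this]
    exact mul_ne_zero two_ne_zero (mul_ne_zero hA.ne' hx₀)
  have hR : Filter.Tendsto (fun t => x t * (A - B * (y' t / x' t) ^ 2) /
      (A * (x t + x₀) - B * (y t / (x t - x₀) * y t))) Filter.atTop
      (𝓝 (x₀ * (A - B * 0 ^ 2) / (A * (x₀ + x₀) - B * (0 * 0)))) :=
    (hxl.mul (((hm.pow 2).const_mul B).const_sub A)).div hK hKne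
  have hR1 : x₀ * (A - B * 0 ^ 2) / (A * (x₀ + x₀) - B * (0 * 0)) < 1 := by
    have : x₀ * (A - B * 0 ^ 2) / (A * (x₀ + x₀) - B * (0 * 0)) = 1 / 2 := by
      have h2 : A * (x₀ + x₀) - B * (0 * 0) = 2 * (A * x₀) := by ring
      rw [h2]; field_simp; ring
    rw [this]; norm_num
  obtain ⟨T, hT⟩ := Filter.eventually_atTop.1 ((hR.eventually_lt_const hR1).and
    ((hK.eventually_ne hKne).and (hUpos.and hx'neg)))
  have hg : Filter.Tendsto (fun t => -(y t / (x t - x₀)) ^ 2) Filter.atTop (𝓝 0) := by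
    simpa using (hyU.pow 2).neg
  filter_upwards [Filter.eventually_ge_atTop T] with t ht
  have key := nonneg_of_antitone_tendsto (F := fun t => -(y t / (x t - x₀)) ^ 2)
    (fun t ht => (((hy t).div ((hx t).sub_const x₀) (hT t ht).2.2.1.ne').pow 2).neg) ?_ hg ht
  · have h1 : y t / (x t - x₀) = 0 := by nlinarith [sq_nonneg (y t / (x t - x₀))]
    rcases div_eq_zero_iff.1 h1 with h2 | h2
    · exact h2
    · exact absurd h2 (hT t ht).2.2.1.ne'
  · intro t ht
    obtain ⟨h1, h2, h3, h4⟩ := hT t ht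
    have e := heq t
    set m := y' t / x' t with hmdef
    have hy' : y' t = m * x' t := by rw [hmdef, div_mul_cancel₀ _ h4.ne]
    set R := x t * (A - B * m ^ 2) / (A * (x t + x₀) - B * (y t / (x t - x₀) * y t)) with hRdef
    have e1 : m * (x t - x₀) = y t * R := by
      rw [hRdef, mul_div_assoc', eq_div_iff h2]
      rw [hy'] at e
      have e2 : -B * x t * y t * m ^ 2 + (A * (x₀ ^ 2 - x t ^ 2) + B * y t ^ 2) * m
          + A * x t * y t = 0 := by
        apply (mul_eq_zero.1 _).resolve_left (pow_ne_zero 2 h4.ne)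
        linear_combination e
      field_simp
      linear_combination -e2
    have e3 : (y' t * (x t - x₀) - y t * x' t) * y t = -(x' t) * (1 - R) * y t ^ 2 := by
      rw [hy']; linear_combination x' t * y t * e1
    have e4 : 0 ≤ (y' t * (x t - x₀) - y t * x' t) * y t := by
      rw [e3]
      exact mul_nonneg (mul_nonneg (by linarith) (by linarith)) (sq_nonneg _)
    have e5 : 0 ≤ (y' t * (x t - x₀) - y t * x' t) * y t / (x t - x₀) ^ 3 :=
      div_nonneg e4 (by positivity)
    have e6 : (2:ℝ) * (y t / (x t - x₀)) * ((y' t * (x t - x₀) - y t * x' t) / (x t - x₀) ^ 2) =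
        2 * ((y' t * (x t - x₀) - y t * x' t) * y t / (x t - x₀) ^ 3) := by
      field_simp
    simp only [Pi.div_apply, Nat.cast_ofNat, Nat.add_one_sub_one, pow_one]
    linarith

/-- A solution of the equation of principal lines in a graph chart that tends to an umbilic point
with tangent direction converging to the saddle direction lies on the invariant line `y = 0`. -/
theorem eventually_eq_zero_of_saddle {A B x₀ s : ℝ} (hA : 0 < A) (hx₀ : x₀ ≠ 0) (hs : s ≠ 0)
    {x y x' y' ρ : ℝ → ℝ} (hx : ∀ t, HasDerivAt x (x' t) t) (hy : ∀ t, HasDerivAt y (y' t) t)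
    (hxl : Filter.Tendsto x Filter.atTop (𝓝 x₀)) (hyl : Filter.Tendsto y Filter.atTop (𝓝 0))
    (hρ : ∀ t, 0 < ρ t) (hxs : Filter.Tendsto (fun t => ρ t * x' t) Filter.atTop (𝓝 s))
    (hys : Filter.Tendsto (fun t => ρ t * y' t) Filter.atTop (𝓝 0))
    (heq : ∀ t, -B * x t * y t * y' t ^ 2 + (A * (x₀ ^ 2 - x t ^ 2) + B * y t ^ 2) * x' t * y' t
      + A * x t * y t * x' t ^ 2 = 0) : ∀ᶠ t in Filter.atTop, y t = 0 := by
  rcases lt_or_gt_of_ne hs with hs | hs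
  · exact eventually_eq_zero_of_saddle_neg hA hx₀ hs hx hy hxl hyl hρ hxs hys heq
  -- The reflection x ↦ -x, x₀ ↦ -x₀ only changes the sign of the equation.
  · refine eventually_eq_zero_of_saddle_neg (A := A) (B := B) (x₀ := -x₀) (s := -s)
      (x := fun t => -x t) (x' := fun t => -x' t) hA (neg_ne_zero.2 hx₀) (by linarith)
      (fun t => (hx t).neg) hy hxl.neg hyl hρ ?_ hys fun t => ?_
    · simpa using hxs.neg
    · linear_combination -heq t

/-! ### Principal curves near the section `y = 0` -/

section
variable {a b c : ℝ} {γ : ℝ → E3}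

theorem IsPrincipalCurve.hasDerivAt {M : Set E3} (h : IsPrincipalCurve M γ) (t : ℝ) (i : Fin 3) :
    HasDerivAt (fun s => γ s i) (deriv γ t i) t :=
  hasDerivAt_pi.1 ((h.smooth.differentiable (by simp)) t).hasDerivAt i

theorem IsPrincipalCurve.continuous_deriv {M : Set E3} (h : IsPrincipalCurve M γ) (i : Fin 3) :
    Continuous fun t => deriv γ t i :=
  (continuous_apply i).comp (h.smooth.continuous_deriv (by simp))

/-- A principal curve that is tangent to the section `y = 0` at a point lies on it near this
point. -/
theorem IsPrincipalCurve.eventually_eq_zero (hb : 0 < b) (hab : b < a) (hc : 0 < c)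
    (h : IsPrincipalCurve (ellipsoid a b c) γ) {t₀ : ℝ} (h0 : γ t₀ 1 = 0)
    (h1 : deriv γ t₀ 1 = 0) : ∀ᶠ t in 𝓝 t₀, γ t 1 = 0 := by
  have ha : 0 < a := hb.trans hab
  have hpv := fun t => (isPrincipalVector_iff ha hb hc).1 (h.principal t)
  have hγ := fun i => (continuous_apply i).comp h.smooth.continuous
  have hγ' := fun i => h.continuous_deriv i
  -- The equation of principal lines reads Dy' = (1/b²)(1/a² + 1/c²)x'z' y: linear in y once D ≠ 0,
  -- with x', z' treated as given functions.
  set D : ℝ → ℝ := fun t => γ t 0 / a ^ 2 * (1 / b ^ 2 + 1 / c ^ 2) * deriv γ t 2 +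
    γ t 2 / c ^ 2 * (1 / b ^ 2 - 1 / a ^ 2) * deriv γ t 0 with hD
  have hDc : Continuous D :=
    ((((hγ 0).div_const _).mul_const _).mul (hγ' 2)).add
      ((((hγ 2).div_const _).mul_const _).mul (hγ' 0))
  have hD0 : D t₀ ≠ 0 := by
    intro hz
    have ht : γ t₀ 0 / a ^ 2 * deriv γ t₀ 0 + γ t₀ 2 / c ^ 2 * deriv γ t₀ 2 = 0 := by
      rw [← (hpv t₀).2.1]; simp [shapeForm, h0]; ring
    have hz' : γ t₀ 0 / a ^ 2 * (1 / b ^ 2 + 1 / c ^ 2) * deriv γ t₀ 2 +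
      γ t₀ 2 / c ^ 2 * (1 / b ^ 2 - 1 / a ^ 2) * deriv γ t₀ 0 = 0 := hz
    apply h.not_umbilic t₀
    refine (mem_umbilics_iff hb hab hc).2 ⟨h.mem t₀, h0, ?_⟩
    -- Tangency and D = 0 form a linear system for (x', z') whose determinant vanishes only if the
    -- umbilic equation holds. Otherwise the velocity would be zero.
    by_contra hne
    have hne' := sub_ne_zero.2 hne
    apply h.regular t₀
    ext i
    fin_cases i
    · change deriv γ t₀ 0 = 0
      apply (mul_eq_zero.1 _).resolve_left hne'
      linear_combination (γ t₀ 0 / a ^ 2 * (1 / b ^ 2 + 1 / c ^ 2)) * ht - γ t₀ 2 / c ^ 2 * hz'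
    · exact h1
    · change deriv γ t₀ 2 = 0
      apply (mul_eq_zero.1 _).resolve_left hne'
      linear_combination γ t₀ 0 / a ^ 2 * hz' - (γ t₀ 2 / c ^ 2 * (1 / b ^ 2 - 1 / a ^ 2)) * ht
  refine eventually_eq_zero_of_linear_ode
    (h := fun t => 1 / b ^ 2 * (1 / a ^ 2 + 1 / c ^ 2) * (deriv γ t 0 * deriv γ t 2) / D t)
    ?_ ?_ h0
  · exact (((hγ' 0).mul (hγ' 2)).const_mul _).continuousAt.div hDc.continuousAt hD0
  · filter_upwards [hDc.continuousAt.eventually_ne hD0] with t ht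
    convert h.hasDerivAt t 1 using 1
    have := (hpv t).2.2
    simp only [prinForm] at this
    rw [div_mul_eq_mul_div, div_eq_iff ht, hD]
    linear_combination -this

/-- The parameters with y = y' = 0 form a closed set, which is open by the local statement; ℝ is
connected. -/
theorem IsPrincipalCurve.forall_eq_zero (hb : 0 < b) (hab : b < a) (hc : 0 < c)
    (h : IsPrincipalCurve (ellipsoid a b c) γ) {t₀ : ℝ} (h0 : γ t₀ 1 = 0)
    (h1 : deriv γ t₀ 1 = 0) (t : ℝ) : γ t 1 = 0 := by
  set S : Set ℝ := {t | γ t 1 = 0} ∩ {t | deriv γ t 1 = 0} with hS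
  have hcl : IsClosed S :=
    (isClosed_eq ((continuous_apply 1).comp h.smooth.continuous) continuous_const).inter
      (isClosed_eq (h.continuous_deriv 1) continuous_const)
  have hop : IsOpen S := by
    rw [isOpen_iff_mem_nhds]
    rintro s ⟨hs0, hs1⟩
    filter_upwards [(h.eventually_eq_zero hb hab hc hs0 hs1).eventually_nhds] with u hu
    refine ⟨hu.self_of_nhds, ?_⟩
    have hu' : (fun s => γ s 1) =ᶠ[𝓝 u] fun _ => 0 := hu
    exact ((h.hasDerivAt u 1).congr_of_eventuallyEq hu'.symm).unique (hasDerivAt_const u 0)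
  have : S = Set.univ := IsClopen.eq_univ ⟨hcl, hop⟩ ⟨t₀, h0, h1⟩
  have ht : t ∈ S := this ▸ Set.mem_univ t
  exact ht.1

/-- If y' ≠ 0 at every zero of y, the zeros are isolated, and a discrete subset of ℝ is countable.
-/
theorem IsPrincipalCurve.exists_tangent_of_not_countable {M : Set E3} (h : IsPrincipalCurve M γ)
    (hT : ¬ {t | γ t 1 = 0}.Countable) : ∃ t, γ t 1 = 0 ∧ deriv γ t 1 = 0 := by
  by_contra! hne
  apply hT
  have : DiscreteTopology {t | γ t 1 = 0} := by
    rw [discreteTopology_subtype_iff]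
    intro t ht
    rw [Filter.inf_principal_eq_bot]
    exact (h.hasDerivAt t 1).eventually_ne (hne t ht)
  exact Set.countable_coe_iff.1 countable_of_Lindelof_of_discrete

/-- The equation of principal lines in the coordinates `x`, `y`, with the umbilic point `p` as
reference point. -/
theorem graph_equation {p q w : E3} (hb : 0 < b) (hab : b < a)
    (hp : p ∈ ellipsoid a b c) (hu : UmbilicEq a b c p) (hq : q ∈ ellipsoid a b c)
    (hw : shapeForm a b c q w = 0) (hQ : prinForm a b c q w = 0) :
    -(1 / b ^ 2 + 1 / c ^ 2) * q 0 * q 1 * w 1 ^ 2 +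
      ((1 / a ^ 2 + 1 / c ^ 2) * (p 0 ^ 2 - q 0 ^ 2) + (1 / b ^ 2 + 1 / c ^ 2) * q 1 ^ 2) *
        w 0 * w 1 + (1 / a ^ 2 + 1 / c ^ 2) * q 0 * q 1 * w 0 ^ 2 = 0 := by
  have ha : 0 < a := hb.trans hab
  have hp' : p 0 ^ 2 / a ^ 2 + p 1 ^ 2 / b ^ 2 + p 2 ^ 2 / c ^ 2 = 1 := hp
  have hq' : q 0 ^ 2 / a ^ 2 + q 1 ^ 2 / b ^ 2 + q 2 ^ 2 / c ^ 2 = 1 := hq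
  obtain ⟨hu1, hu2⟩ := hu
  rw [hu1] at hp'
  simp only [shapeForm, prinForm] at hw hQ
  have e1 : 0 < (a ^ 2)⁻¹ := by positivity
  have e2 : 0 < (b ^ 2)⁻¹ := by positivity
  simp only [div_eq_mul_inv, one_mul] at hp' hq' hw hQ hu2 ⊢
  generalize (a ^ 2)⁻¹ = A at *
  generalize (b ^ 2)⁻¹ = B at *
  generalize (c ^ 2)⁻¹ = C at *
  apply (mul_eq_zero.1 _).resolve_left (mul_pos e1 e2).ne'
  -- With p on the ellipsoid, the umbilic equation expresses C(B - A) through the x-coordinate of p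
  -- alone; the ellipsoid equation at q and tangency of w remove z and z'.
  have hK : C * (B - A) = A * B * (A + C) * p 0 ^ 2 := by
    linear_combination (-C * (B - A)) * hp' - hu2
  linear_combination (C * q 2) * hQ - (A * q 0 * (B + C) * w 1 - B * q 1 * (A + C) * w 0) * hw
    - C * (B - A) * w 0 * w 1 * hq' - w 0 * w 1 * hK

/-- A principal curve that tends to an umbilic point along a saddle direction lies on the section
`y = 0`. -/
theorem IsPrincipalCurve.eq_zero_of_tendsto {p w : E3} {ρ : ℝ → ℝ} (hb : 0 < b) (hab : b < a)
    (hc : 0 < c) (h : IsPrincipalCurve (ellipsoid a b c) γ) (hp : p ∈ ellipsoid a b c)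
    (hu : UmbilicEq a b c p) (hlim : Filter.Tendsto γ Filter.atTop (𝓝 p)) (hρ : ∀ t, 0 < ρ t)
    (hs : IsSaddleVector (ellipsoid a b c) p w)
    (hdir : Filter.Tendsto (fun t => ρ t • deriv γ t) Filter.atTop (𝓝 w)) (t : ℝ) :
    γ t 1 = 0 := by
  have ha : 0 < a := hb.trans hab
  obtain ⟨hw1, hwt, hw0⟩ := hs.tangent hb hab hc hu
  obtain ⟨hp0, hp2⟩ := hu.conormal_ne hb hab hc hp
  have hw0' : w 0 ≠ 0 := by
    intro h0
    apply hw0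
    simp only [shapeForm, hw1, h0, mul_zero, zero_div, zero_add, div_eq_zero_iff, mul_eq_zero, hp2,
      false_or, pow_eq_zero_iff, ne_eq, OfNat.ofNat_ne_zero, not_false_eq_true, hc.ne',
      or_false] at hwt
    ext i
    fin_cases i
    · exact h0
    · exact hw1
    · exact hwt
  have hA : (0:ℝ) < 1 / a ^ 2 + 1 / c ^ 2 := by positivity
  have hlim' := tendsto_pi_nhds.1 hlim
  have hdir' := tendsto_pi_nhds.1 hdir
  have hev := eventually_eq_zero_of_saddle (A := 1 / a ^ 2 + 1 / c ^ 2)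
    (B := 1 / b ^ 2 + 1 / c ^ 2) (s := w 0) hA hp0 hw0' (fun t => h.hasDerivAt t 0)
    (fun t => h.hasDerivAt t 1) (hlim' 0) (by simpa [hu.1] using hlim' 1) hρ
    (by simpa using hdir' 0) (by simpa [hw1] using hdir' 1) (fun t => by
      obtain ⟨h1, h2, h3⟩ := (isPrincipalVector_iff ha hb hc).1 (h.principal t)
      exact graph_equation hb hab hp hu h1 h2 h3)
  obtain ⟨T, hT⟩ := Filter.eventually_atTop.1 hev
  -- At T + 1 the function y vanishes on a whole neighbourhood, so y' vanishes there too.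
  refine h.forall_eq_zero hb hab hc (t₀ := T + 1) (hT _ (by linarith)) ?_ t
  have hn : (fun s => γ s 1) =ᶠ[𝓝 (T + 1)] fun _ => 0 := by
    filter_upwards [Ioi_mem_nhds (show T < T + 1 by linarith)] with s hs using hT s (le_of_lt hs)
  exact ((h.hasDerivAt (T + 1) 1).congr_of_eventuallyEq hn.symm).unique (hasDerivAt_const _ 0)

end

/-! ### The section `y = 0` -/

theorem exists_cos_sin {x y : ℝ} (h : x ^ 2 + y ^ 2 = 1) :
    ∃ θ : ℝ, Real.cos θ = x ∧ Real.sin θ = y := by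
  have hn : ‖(⟨x, y⟩ : ℂ)‖ = 1 := by
    rw [Complex.norm_def, Complex.normSq_mk, ← sq, ← sq, h, Real.sqrt_one]
  have h0 : (⟨x, y⟩ : ℂ) ≠ 0 := by
    intro h0; rw [h0] at hn; simp at hn
  exact ⟨Complex.arg ⟨x, y⟩, by rw [Complex.cos_arg h0, hn, div_one],
    by rw [Complex.sin_arg, hn, div_one]⟩

/-- The parametrization of the ellipse in the plane `y = 0`. -/
def ellipseY (a c θ : ℝ) : E3 := ![a * Real.cos θ, 0, c * Real.sin θ]

/-- The derivative of `ellipseY`. -/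
def ellipseY' (a c θ : ℝ) : E3 := ![-(a * Real.sin θ), 0, c * Real.cos θ]

theorem contDiff_ellipseY (a c : ℝ) : ContDiff ℝ ∞ (ellipseY a c) := by
  refine contDiff_pi.2 fun i => ?_
  fin_cases i
  · exact contDiff_const.mul Real.contDiff_cos
  · exact contDiff_const
  · exact contDiff_const.mul Real.contDiff_sin

theorem hasDerivAt_ellipseY (a c θ : ℝ) : HasDerivAt (ellipseY a c) (ellipseY' a c θ) θ := by
  refine hasDerivAt_pi.2 fun i => ?_
  fin_cases i
  · simpa [ellipseY, ellipseY'] using (Real.hasDerivAt_cos θ).const_mul a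
  · simpa [ellipseY, ellipseY'] using hasDerivAt_const θ (0 : ℝ)
  · simpa [ellipseY, ellipseY'] using (Real.hasDerivAt_sin θ).const_mul c

section
variable {a b c : ℝ}

theorem ellipseY_mem (ha : 0 < a) (hc : 0 < c) (θ : ℝ) :
    ellipseY a c θ ∈ planeSection a b c 1 := by
  refine ⟨?_, rfl⟩
  simp only [ellipsoid, ellipseY, Set.mem_ofPred_eq, Matrix.cons_val]
  field_simp
  linear_combination Real.cos_sq_add_sin_sq θ

theorem exists_eq_ellipseY (ha : 0 < a) (hc : 0 < c) {p : E3}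
    (hp : p ∈ planeSection a b c 1) : ∃ θ, ellipseY a c θ = p := by
  obtain ⟨h1, h2⟩ := hp
  have h1' : p 0 ^ 2 / a ^ 2 + p 1 ^ 2 / b ^ 2 + p 2 ^ 2 / c ^ 2 = 1 := h1
  have h2' : p 1 = 0 := h2
  obtain ⟨θ, hcos, hsin⟩ := exists_cos_sin (x := p 0 / a) (y := p 2 / c) (by
    rw [h2'] at h1'; simp only [div_pow]; linear_combination h1')
  refine ⟨θ, ?_⟩
  ext i
  fin_cases i
  · simp [ellipseY, hcos]; field_simp
  · simp [ellipseY, h2']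
  · simp [ellipseY, hsin]; field_simp

theorem ellipseY_mem_umbilics_iff (hb : 0 < b) (hab : b < a) (hc : 0 < c) (θ : ℝ) :
    ellipseY a c θ ∈ umbilics (ellipsoid a b c) ↔
      Real.cos θ ^ 2 = (a ^ 2 - b ^ 2) / (a ^ 2 + c ^ 2) := by
  have ha : 0 < a := hb.trans hab
  have hp := (ellipseY_mem (b := b) ha hc θ).1
  rw [mem_umbilics_iff hb hab hc, umbilicEq_iff hb hab hc hp]
  have h0 : ellipseY a c θ 0 / a = Real.cos θ := by simp [ellipseY]; field_simp
  have h1 : ellipseY a c θ 1 = 0 := rfl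
  rw [h0]
  tauto

theorem shapeForm_ellipseY (ha : 0 < a) (hc : 0 < c) (θ r : ℝ) :
    shapeForm a b c (ellipseY a c θ) (r • ellipseY' a c θ) = 0 := by
  simp [shapeForm, ellipseY, ellipseY']
  field_simp
  ring

theorem isPrincipalVector_ellipseY (hb : 0 < b) (hab : b < a) (hc : 0 < c) (θ r : ℝ) :
    IsPrincipalVector (ellipsoid a b c) (ellipseY a c θ) (r • ellipseY' a c θ) := by
  have ha : 0 < a := hb.trans hab
  refine (isPrincipalVector_iff ha hb hc).2 ⟨(ellipseY_mem ha hc θ).1,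
    shapeForm_ellipseY ha hc θ r, ?_⟩
  simp [prinForm, ellipseY, ellipseY']

theorem ellipseY'_ne (ha : 0 < a) (hc : 0 < c) (θ : ℝ) : ellipseY' a c θ ≠ 0 := by
  intro h
  have h0 := congrFun h 0
  have h2 := congrFun h 2
  simp [ellipseY', ha.ne', hc.ne'] at h0 h2
  have := Real.cos_sq_add_sin_sq θ
  rw [h0, h2] at this
  norm_num at this

/-- An increasing parametrization of the interval `(θ - h, θ + h)` by `ℝ`. -/
def arcParam (θ h t : ℝ) : ℝ := θ + 2 * h / Real.pi * Real.arctan t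

theorem contDiff_arcParam (θ h : ℝ) : ContDiff ℝ ∞ (arcParam θ h) :=
  contDiff_const.add (contDiff_const.mul Real.contDiff_arctan)

theorem hasDerivAt_arcParam (θ h t : ℝ) :
    HasDerivAt (arcParam θ h) (2 * h / Real.pi * (1 / (1 + t ^ 2))) t :=
  ((Real.hasDerivAt_arctan t).const_mul _).const_add θ

theorem range_arcParam {θ h : ℝ} (hh : 0 < h) :
    Set.range (arcParam θ h) = Set.Ioo (θ - h) (θ + h) := by
  have hpi := Real.pi_pos
  ext x
  constructor
  · rintro ⟨t, rfl⟩
    have h1 := Real.neg_pi_div_two_lt_arctan t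
    have h2 := Real.arctan_lt_pi_div_two t
    have e1 : 2 * h / Real.pi * (-(Real.pi / 2)) = -h := by field_simp
    have e2 : 2 * h / Real.pi * (Real.pi / 2) = h := by field_simp
    have hk : 0 < 2 * h / Real.pi := by positivity
    have i1 := mul_lt_mul_of_pos_left h1 hk
    have i2 := mul_lt_mul_of_pos_left h2 hk
    exact ⟨by unfold arcParam; linarith, by unfold arcParam; linarith⟩
  · rintro ⟨h1, h2⟩
    have hm : (x - θ) * (Real.pi / (2 * h)) ∈ Set.range Real.arctan := by
      rw [Real.range_arctan]
      have hk : 0 < Real.pi / (2 * h) := by positivity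
      have i1 := mul_lt_mul_of_pos_right (show -h < x - θ by linarith) hk
      have i2 := mul_lt_mul_of_pos_right (show x - θ < h by linarith) hk
      have e1 : -h * (Real.pi / (2 * h)) = -(Real.pi / 2) := by field_simp
      have e2 : h * (Real.pi / (2 * h)) = Real.pi / 2 := by field_simp
      exact ⟨by linarith, by linarith⟩
    obtain ⟨t, ht⟩ := hm
    refine ⟨t, ?_⟩
    rw [arcParam, ht]
    field_simp
    ring

theorem tendsto_arcParam (θ h : ℝ) :
    Filter.Tendsto (arcParam θ h) Filter.atTop (𝓝 (θ + h)) := by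
  have h1 : Filter.Tendsto Real.arctan Filter.atTop (𝓝 (Real.pi / 2)) :=
    Real.tendsto_arctan_atTop.mono_right nhdsWithin_le_nhds
  have h2 := (h1.const_mul (2 * h / Real.pi)).const_add θ
  have e : 2 * h / Real.pi * (Real.pi / 2) = h := by field_simp
  rwa [e] at h2

/-! ### Arcs of the section between umbilic points -/

/-- The open arc of the ellipse in the plane `y = 0` with centre `θ` and half-width `h`. -/
def arcY (a c θ h : ℝ) : Set E3 := ellipseY a c '' Set.Ioo (θ - h) (θ + h)

/-- The arc with centre `θ` and half-width `h` is bounded by umbilic points and contains none. -/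
structure IsUmbilicArc (a b c θ h : ℝ) : Prop where
  pos : 0 < h
  lt_pi : h < Real.pi
  umbilic_of_eq : ∀ t, Real.cos (t - θ) = Real.cos h →
    Real.cos t ^ 2 = (a ^ 2 - b ^ 2) / (a ^ 2 + c ^ 2)
  not_umbilic_of_lt : ∀ t, Real.cos h < Real.cos (t - θ) →
    Real.cos t ^ 2 ≠ (a ^ 2 - b ^ 2) / (a ^ 2 + c ^ 2)

theorem cos_lt_cos_of_abs_lt {s h : ℝ} (hs : |s| < h) (hh : h < Real.pi) :
    Real.cos h < Real.cos s := by
  rw [← Real.cos_abs s]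
  exact Real.cos_lt_cos_of_nonneg_of_le_pi (abs_nonneg s) hh.le hs

theorem ellipseY_congr {t t' : ℝ} (h : Real.cos t = Real.cos t') (h' : Real.sin t = Real.sin t') :
    ellipseY a c t = ellipseY a c t' := by
  simp only [ellipseY, h, h']

theorem ellipseY_inj (ha : 0 < a) (hc : 0 < c) {t t' : ℝ}
    (h : ellipseY a c t = ellipseY a c t') :
    Real.cos t = Real.cos t' ∧ Real.sin t = Real.sin t' := by
  have h0 := congrFun h 0
  have h2 := congrFun h 2
  simp [ellipseY, ha.ne', hc.ne'] at h0 h2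
  exact ⟨h0, h2⟩

/-- An inequality between cosines does not see the choice of the angle modulo 2π, so arcs can be
handled without choosing representatives. -/
theorem ellipseY_mem_arcY_iff (ha : 0 < a) (hc : 0 < c) {θ h : ℝ} (h0 : 0 < h)
    (hh : h < Real.pi) {t : ℝ} :
    ellipseY a c t ∈ arcY a c θ h ↔ Real.cos h < Real.cos (t - θ) := by
  constructor
  · rintro ⟨t', ⟨h1, h2⟩, he⟩
    obtain ⟨e1, e2⟩ := ellipseY_inj ha hc he
    rw [Real.cos_sub, ← e1, ← e2, ← Real.cos_sub]
    exact cos_lt_cos_of_abs_lt (abs_lt.2 ⟨by linarith, by linarith⟩) hh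
  · intro hlt
    set s := Real.arccos (Real.cos (t - θ)) with hs
    have hcs : Real.cos s = Real.cos (t - θ) :=
      Real.cos_arccos (Real.neg_one_le_cos _) (Real.cos_le_one _)
    have hs0 : 0 ≤ s := Real.arccos_nonneg _
    have hsh : s < h := by
      by_contra hn
      have := Real.cos_le_cos_of_nonneg_of_le_pi h0.le (Real.arccos_le_pi _) (not_lt.1 hn)
      rw [← hs, hcs] at this
      linarith
    obtain ⟨k, hk | hk⟩ := Real.cos_eq_cos_iff.1 hcs
    · refine ⟨θ + s, ⟨by linarith, by linarith⟩, ?_⟩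
      have : t = (θ + s) + k * (2 * Real.pi) := by linarith
      rw [this]
      exact ellipseY_congr (Real.cos_add_int_mul_two_pi _ k).symm
        (Real.sin_add_int_mul_two_pi _ k).symm
    · refine ⟨θ - s, ⟨by linarith, by linarith⟩, ?_⟩
      have : t = (θ - s) + k * (2 * Real.pi) := by linarith
      rw [this]
      exact ellipseY_congr (Real.cos_add_int_mul_two_pi _ k).symm
        (Real.sin_add_int_mul_two_pi _ k).symm

/-- The section `y = 0` without the umbilic points. -/
abbrev puncturedSection (a b c : ℝ) : Set E3 :=
  planeSection a b c 1 \ umbilics (ellipsoid a b c)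

theorem IsUmbilicArc.subset {θ h : ℝ} (hA : IsUmbilicArc a b c θ h) (hb : 0 < b) (hab : b < a)
    (hc : 0 < c) : arcY a c θ h ⊆ puncturedSection a b c := by
  have ha : 0 < a := hb.trans hab
  rintro p ⟨t, ⟨h1, h2⟩, rfl⟩
  refine ⟨ellipseY_mem ha hc t, ?_⟩
  rw [ellipseY_mem_umbilics_iff hb hab hc]
  exact hA.not_umbilic_of_lt t
    (cos_lt_cos_of_abs_lt (abs_lt.2 ⟨by linarith, by linarith⟩) hA.lt_pi)

theorem isPreconnected_arcY (a c θ h : ℝ) : IsPreconnected (arcY a c θ h) :=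
  isPreconnected_Ioo.image _ (contDiff_ellipseY a c).continuous.continuousOn

/-- The function cos(t - θ) on the ellipse is the restriction of a linear function f on ℝ³. A
connected set that leaves the arc attains f = cos h, which happens only at umbilic points. -/
theorem IsUmbilicArc.subset_of_isPreconnected {θ h : ℝ} (hA : IsUmbilicArc a b c θ h)
    (hb : 0 < b) (hab : b < a) (hc : 0 < c) {T : Set E3} (hT : IsPreconnected T)
    (hTS : T ⊆ puncturedSection a b c) {p : E3} (hpT : p ∈ T) (hp : p ∈ arcY a c θ h) :
    T ⊆ arcY a c θ h := by
  have ha : 0 < a := hb.trans hab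
  set f : E3 → ℝ := fun q => q 0 / a * Real.cos θ + q 2 / c * Real.sin θ with hf
  have hfc : Continuous f := by fun_prop
  have hfe : ∀ t, f (ellipseY a c t) = Real.cos (t - θ) := by
    intro t
    rw [Real.cos_sub, hf]
    simp [ellipseY]
    field_simp
  have hpf : Real.cos h < f p := by
    obtain ⟨t, -, rfl⟩ := id hp
    rw [hfe]
    exact (ellipseY_mem_arcY_iff ha hc hA.pos hA.lt_pi).1 hp
  intro q hq
  obtain ⟨t, rfl⟩ := exists_eq_ellipseY ha hc (hTS hq).1
  rw [ellipseY_mem_arcY_iff ha hc hA.pos hA.lt_pi]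
  by_contra hn
  obtain ⟨x, hxT, hx⟩ := hT.intermediate_value hq hpT hfc.continuousOn
    ⟨by rw [hfe]; exact not_lt.1 hn, hpf.le⟩
  obtain ⟨t', rfl⟩ := exists_eq_ellipseY ha hc (hTS hxT).1
  rw [hfe] at hx
  exact (hTS hxT).2 ((ellipseY_mem_umbilics_iff hb hab hc t').2 (hA.umbilic_of_eq t' hx))

theorem IsUmbilicArc.connectedComponentIn_eq {θ h : ℝ} (hA : IsUmbilicArc a b c θ h)
    (hb : 0 < b) (hab : b < a) (hc : 0 < c) {p : E3} (hp : p ∈ arcY a c θ h) :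
    connectedComponentIn (puncturedSection a b c) p = arcY a c θ h :=
  Set.Subset.antisymm
    (hA.subset_of_isPreconnected hb hab hc isPreconnected_connectedComponentIn
      (connectedComponentIn_subset _ _) (mem_connectedComponentIn (hA.subset hb hab hc hp)) hp)
    ((isPreconnected_arcY a c θ h).subset_connectedComponentIn hp (hA.subset hb hab hc))

theorem hasDerivAt_arc (a c θ h t : ℝ) : HasDerivAt (fun t => ellipseY a c (arcParam θ h t))
    ((2 * h / Real.pi * (1 / (1 + t ^ 2))) • ellipseY' a c (arcParam θ h t)) t :=
  (hasDerivAt_ellipseY a c _).scomp t (hasDerivAt_arcParam θ h t)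

theorem range_arc {θ h : ℝ} (hh : 0 < h) :
    Set.range (fun t => ellipseY a c (arcParam θ h t)) = arcY a c θ h := by
  rw [arcY, ← range_arcParam hh, ← Set.range_comp]; rfl

theorem IsUmbilicArc.isPrincipalCurve {θ h : ℝ} (hA : IsUmbilicArc a b c θ h)
    (hb : 0 < b) (hab : b < a) (hc : 0 < c) :
    IsPrincipalCurve (ellipsoid a b c) (fun t => ellipseY a c (arcParam θ h t)) := by
  have ha : 0 < a := hb.trans hab
  have hmem : ∀ t, ellipseY a c (arcParam θ h t) ∈ puncturedSection a b c := fun t =>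
    hA.subset hb hab hc (range_arc hA.pos ▸ Set.mem_range_self t)
  refine ⟨(contDiff_ellipseY a c).comp (contDiff_arcParam θ h), fun t => ?_, fun t => (hmem t).1.1,
    fun t => (hmem t).2, fun t => ?_⟩
  · rw [(hasDerivAt_arc a c θ h t).deriv]
    have := hA.pos
    have := Real.pi_pos
    exact smul_ne_zero (by positivity) (ellipseY'_ne ha hc _)
  · rw [(hasDerivAt_arc a c θ h t).deriv]
    exact isPrincipalVector_ellipseY hb hab hc _ _

theorem not_countable_arcY (ha : 0 < a) (hc : 0 < c) {θ h : ℝ} (h0 : 0 < h) (hh : h < Real.pi) :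
    ¬ (arcY a c θ h).Countable := by
  intro hcount
  have hss := hcount.isTotallyDisconnected _ subset_rfl (isPreconnected_arcY a c θ h)
  have he := hss (Set.mem_image_of_mem _ (show θ ∈ Set.Ioo (θ - h) (θ + h) from
    ⟨by linarith, by linarith⟩)) (Set.mem_image_of_mem _
    (show θ + h / 2 ∈ Set.Ioo (θ - h) (θ + h) from ⟨by linarith, by linarith⟩))
  obtain ⟨e1, e2⟩ := ellipseY_inj ha hc he
  have e3 : Real.cos (θ - θ) = Real.cos (θ + h / 2 - θ) := by
    rw [Real.cos_sub, Real.cos_sub, e1, e2]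
  have e4 := Real.cos_lt_cos_of_nonneg_of_le_pi le_rfl (by linarith : h / 2 ≤ Real.pi)
    (by linarith : (0:ℝ) < h / 2)
  rw [sub_self, add_sub_cancel_left] at e3
  linarith

theorem IsPrincipalCurve.range_subset_connectedComponentIn (hγ : IsPrincipalCurve
    (ellipsoid a b c) γ) (h0 : ∀ t, γ t 1 = 0) (t : ℝ) :
    Set.range γ ⊆ connectedComponentIn (puncturedSection a b c) (γ t) := by
  refine (isPreconnected_range hγ.smooth.continuous).subset_connectedComponentIn
    (Set.mem_range_self t) ?_
  rintro _ ⟨s, rfl⟩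
  exact ⟨⟨hγ.mem s, h0 s⟩, hγ.not_umbilic s⟩

/-- A principal curve whose image contains the arc has uncountably many parameters with y = 0, so it
is tangent to the section somewhere and stays in it. Its image is connected and free of umbilic
points, hence inside the component, which is the arc. -/
theorem IsUmbilicArc.isLeaf {θ h : ℝ} (hA : IsUmbilicArc a b c θ h)
    (hb : 0 < b) (hab : b < a) (hc : 0 < c) : IsLeaf (ellipsoid a b c) (arcY a c θ h) := by
  have ha : 0 < a := hb.trans hab
  refine ⟨⟨_, hA.isPrincipalCurve hb hab hc, range_arc hA.pos⟩, ?_⟩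
  rintro _ ⟨γ, hγ, rfl⟩ hsub
  have hT : ¬ {t | γ t 1 = 0}.Countable := by
    intro hcount
    apply not_countable_arcY ha hc hA.pos hA.lt_pi
    refine (hcount.image γ).mono fun p hp => ?_
    obtain ⟨t, rfl⟩ := hsub hp
    exact ⟨t, (hA.subset hb hab hc hp).1.2, rfl⟩
  obtain ⟨t₀, h0, h1⟩ := hγ.exists_tangent_of_not_countable hT
  have hy := hγ.forall_eq_zero hb hab hc h0 h1
  refine Set.Subset.antisymm ?_ hsub
  have hpos := hA.pos
  have hcen : ellipseY a c θ ∈ arcY a c θ h :=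
    Set.mem_image_of_mem _ ⟨by linarith, by linarith⟩
  obtain ⟨s, hs⟩ := hsub hcen
  have := hγ.range_subset_connectedComponentIn hy s
  rwa [hs, hA.connectedComponentIn_eq hb hab hc hcen] at this

theorem IsUmbilicArc.isSeparatrix {θ h : ℝ} (hA : IsUmbilicArc a b c θ h)
    (hb : 0 < b) (hab : b < a) (hc : 0 < c) :
    IsSeparatrix (ellipsoid a b c) (ellipseY a c (θ + h)) (arcY a c θ h) := by
  have ha : 0 < a := hb.trans hab
  have hpos := hA.pos
  have hpi := Real.pi_pos
  have hu : ellipseY a c (θ + h) ∈ umbilics (ellipsoid a b c) :=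
    (ellipseY_mem_umbilics_iff hb hab hc _).2 (hA.umbilic_of_eq _ (by rw [add_sub_cancel_left]))
  obtain ⟨hp, hue⟩ := (mem_umbilics_iff hb hab hc).1 hu
  have hE' : Continuous (ellipseY' a c) := by
    refine continuous_pi fun i => ?_
    fin_cases i
    · exact (continuous_const.mul Real.continuous_sin).neg
    · exact continuous_const
    · exact continuous_const.mul Real.continuous_cos
  refine ⟨hu, hA.isLeaf hb hab hc, _, hA.isPrincipalCurve hb hab hc, range_arc hpos,
    ((contDiff_ellipseY a c).continuous.tendsto _).comp (tendsto_arcParam θ h),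
    -- ρ is the inverse speed of `arcParam`; the speed tends to 0, while the rescaled tangent is
    -- exactly `ellipseY'` and converges.
    fun t => (2 * h / Real.pi * (1 / (1 + t ^ 2)))⁻¹, ellipseY' a c (θ + h),
    fun t => by positivity, ?_, ?_⟩
  · refine isSaddleVector_of_tangent hb hab hc hp hue rfl ?_ ?_
    · simpa using shapeForm_ellipseY (b := b) ha hc (θ + h) 1
    · have h2 := (hue.conormal_ne hb hab hc hp).2
      simp [ellipseY] at h2
      simp [ellipseY', ha.ne', h2.2]
  · refine ((hE'.tendsto _).comp (tendsto_arcParam θ h)).congr fun t => ?_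
    rw [(hasDerivAt_arc a c θ h t).deriv, smul_smul, inv_mul_cancel₀ (by positivity), one_smul]
    rfl

/-- The umbilic points are at cos² t = K, 0 < K < 1, and θ₀ = arccos √K. Arcs around 0 and π are
where cos² t > K, those around ±π/2 where cos² t < K; the last clause says that the four arcs cover
all other points. -/
theorem exists_four_arcs (hb : 0 < b) (hab : b < a) (hc : 0 < c) :
    ∃ θ₀ : ℝ, 0 < θ₀ ∧ θ₀ < Real.pi / 2 ∧ IsUmbilicArc a b c 0 θ₀ ∧ IsUmbilicArc a b c Real.pi θ₀ ∧
      IsUmbilicArc a b c (Real.pi / 2) (Real.pi / 2 - θ₀) ∧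
      IsUmbilicArc a b c (-(Real.pi / 2)) (Real.pi / 2 - θ₀) ∧
      ∀ t, Real.cos t ^ 2 ≠ (a ^ 2 - b ^ 2) / (a ^ 2 + c ^ 2) →
        Real.cos θ₀ < Real.cos (t - 0) ∨ Real.cos θ₀ < Real.cos (t - Real.pi) ∨
        Real.cos (Real.pi / 2 - θ₀) < Real.cos (t - Real.pi / 2) ∨
        Real.cos (Real.pi / 2 - θ₀) < Real.cos (t - -(Real.pi / 2)) := by
  have ha : 0 < a := hb.trans hab
  have hba : 0 < a ^ 2 - b ^ 2 := by nlinarith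
  have hpi := Real.pi_pos
  set K := (a ^ 2 - b ^ 2) / (a ^ 2 + c ^ 2) with hK
  have hK0 : 0 < K := by positivity
  have hK1 : K < 1 := by rw [hK, div_lt_one (by positivity)]; nlinarith
  set k := Real.sqrt K with hk
  have hk0 : 0 < k := Real.sqrt_pos.2 hK0
  have hk2 : k ^ 2 = K := Real.sq_sqrt hK0.le
  have hk1 : k < 1 := by nlinarith
  have hcos : Real.cos (Real.arccos k) = k := Real.cos_arccos (by linarith) hk1.le
  set θ₀ := Real.arccos k with hθ
  have hθ0 : 0 < θ₀ := Real.arccos_pos.2 hk1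
  have hθ1 : θ₀ < Real.pi / 2 := Real.arccos_lt_pi_div_two.2 hk0
  have hsin : 0 < Real.sin θ₀ := Real.sin_pos_of_pos_of_lt_pi hθ0 (by linarith)
  have hs2 : Real.sin θ₀ ^ 2 = 1 - K := by
    have := Real.sin_sq_add_cos_sq θ₀
    rw [hcos, hk2] at this; linarith
  have e1 : ∀ t, Real.cos (t - Real.pi) = -Real.cos t := Real.cos_sub_pi
  have e2 : ∀ t, Real.cos (t - Real.pi / 2) = Real.sin t := Real.cos_sub_pi_div_two
  have e3 : ∀ t, Real.cos (t - -(Real.pi / 2)) = -Real.sin t := fun t => by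
    rw [sub_neg_eq_add, Real.cos_add_pi_div_two]
  have e4 : Real.cos (Real.pi / 2 - θ₀) = Real.sin θ₀ := Real.cos_pi_div_two_sub _
  have hsc : ∀ t, Real.cos t ^ 2 = 1 - Real.sin t ^ 2 := Real.cos_sq'
  refine ⟨θ₀, hθ0, hθ1, ⟨hθ0, by linarith, fun t ht => ?_, fun t ht => ?_⟩,
    ⟨hθ0, by linarith, fun t ht => ?_, fun t ht => ?_⟩,
    ⟨by linarith, by linarith, fun t ht => ?_, fun t ht => ?_⟩,
    ⟨by linarith, by linarith, fun t ht => ?_, fun t ht => ?_⟩, fun t ht => ?_⟩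
  · rw [sub_zero, hcos] at ht
    rw [ht, hk2]
  · rw [sub_zero, hcos] at ht
    rw [← hK, ← hk2]
    exact (pow_lt_pow_left₀ ht hk0.le two_ne_zero).ne'
  · rw [e1, hcos] at ht
    rw [← hK, ← hk2, ← ht, neg_sq]
  · rw [e1, hcos] at ht
    rw [← hK, ← hk2, ← neg_sq (Real.cos t)]
    exact (pow_lt_pow_left₀ ht hk0.le two_ne_zero).ne'
  · rw [e2, e4] at ht
    rw [hsc, ht, hs2]; ring
  · rw [e2, e4] at ht
    have := pow_lt_pow_left₀ ht hsin.le two_ne_zero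
    rw [hsc]
    intro h; linarith
  · rw [e3, e4] at ht
    rw [hsc, ← neg_sq (Real.sin t), ht, hs2]; ring
  · rw [e3, e4] at ht
    have := pow_lt_pow_left₀ ht hsin.le two_ne_zero
    rw [neg_sq] at this
    rw [hsc]
    intro h; linarith
  · rw [sub_zero, e1, e2, e3, e4, hcos]
    rcases lt_or_gt_of_ne ht with h | h
    · right; right
      have : Real.sin θ₀ ^ 2 < Real.sin t ^ 2 := by rw [hs2]; linarith [hsc t]
      have := sq_lt_sq.1 this
      rw [abs_of_pos hsin] at this
      exact lt_abs.1 this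
    · have : k ^ 2 < Real.cos t ^ 2 := by rw [hk2]; exact h
      have := sq_lt_sq.1 this
      rw [abs_of_pos hk0] at this
      rcases lt_abs.1 this with h | h
      · exact Or.inl h
      · exact Or.inr (Or.inl h)

theorem exists_arc_of_mem (hb : 0 < b) (hab : b < a) (hc : 0 < c) {p : E3}
    (hp : p ∈ puncturedSection a b c) :
    ∃ θ h, IsUmbilicArc a b c θ h ∧ p ∈ arcY a c θ h := by
  have ha : 0 < a := hb.trans hab
  obtain ⟨θ₀, -, -, h1, h2, h3, h4, hcov⟩ := exists_four_arcs hb hab hc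
  obtain ⟨t, rfl⟩ := exists_eq_ellipseY ha hc hp.1
  rcases hcov t (fun h => hp.2 ((ellipseY_mem_umbilics_iff hb hab hc t).2 h)) with h | h | h | h
  · exact ⟨_, _, h1, (ellipseY_mem_arcY_iff ha hc h1.pos h1.lt_pi).2 h⟩
  · exact ⟨_, _, h2, (ellipseY_mem_arcY_iff ha hc h2.pos h2.lt_pi).2 h⟩
  · exact ⟨_, _, h3, (ellipseY_mem_arcY_iff ha hc h3.pos h3.lt_pi).2 h⟩
  · exact ⟨_, _, h4, (ellipseY_mem_arcY_iff ha hc h4.pos h4.lt_pi).2 h⟩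

/-- A separatrix lies in y = 0 and so in one component, which is an arc and thus a principal line;
maximality of the leaf gives equality. -/
theorem separatrices_eq (hb : 0 < b) (hab : b < a) (hc : 0 < c) :
    separatrices (ellipsoid a b c) = {C | ∃ p ∈ puncturedSection a b c,
      C = connectedComponentIn (puncturedSection a b c) p} := by
  ext C
  constructor
  · rintro ⟨p, hp, ⟨hpl, hleaf⟩, γ, hγ, rfl, hlim, ρ, w, hρ, hs, hdir⟩
    obtain ⟨hpE, hu⟩ := (mem_umbilics_iff hb hab hc).1 hp
    have hy := hγ.eq_zero_of_tendsto hb hab hc hpE hu hlim hρ hs hdir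
    have h0 : γ 0 ∈ puncturedSection a b c := ⟨⟨hγ.mem 0, hy 0⟩, hγ.not_umbilic 0⟩
    refine ⟨γ 0, h0, ?_⟩
    obtain ⟨θ, h, hA, hmem⟩ := exists_arc_of_mem hb hab hc h0
    have hsub := hγ.range_subset_connectedComponentIn hy 0
    rw [hA.connectedComponentIn_eq hb hab hc hmem] at hsub ⊢
    exact (hleaf _ (hA.isLeaf hb hab hc).1 hsub).symm
  · rintro ⟨p, hp, rfl⟩
    obtain ⟨θ, h, hA, hmem⟩ := exists_arc_of_mem hb hab hc hp
    rw [hA.connectedComponentIn_eq hb hab hc hmem]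
    exact ⟨_, hA.isSeparatrix hb hab hc⟩

theorem planeSection_one_eq (hb : 0 < b) (hab : b < a) (hc : 0 < c) :
    planeSection a b c 1 = umbilics (ellipsoid a b c) ∪ ⋃₀ separatrices (ellipsoid a b c) := by
  rw [separatrices_eq hb hab hc]
  ext p
  constructor
  · intro hp
    by_cases hu : p ∈ umbilics (ellipsoid a b c)
    · exact Or.inl hu
    · exact Or.inr ⟨_, ⟨p, ⟨hp, hu⟩, rfl⟩, mem_connectedComponentIn ⟨hp, hu⟩⟩
  · rintro (hu | ⟨_, ⟨q, -, rfl⟩, hp⟩)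
    · obtain ⟨h1, h2⟩ := (mem_umbilics_iff hb hab hc).1 hu
      exact ⟨h1, h2.1⟩
    · exact (connectedComponentIn_subset _ _ hp).1

theorem ncard_separatrices (hb : 0 < b) (hab : b < a) (hc : 0 < c) :
    (separatrices (ellipsoid a b c)).ncard = 4 := by
  have ha : 0 < a := hb.trans hab
  obtain ⟨θ₀, hθ0, hθ1, h1, h2, h3, h4, hcov⟩ := exists_four_arcs hb hab hc
  have hcen : ∀ {θ h : ℝ}, IsUmbilicArc a b c θ h → ellipseY a c θ ∈ arcY a c θ h := by
    intro θ h hA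
    have := hA.pos
    exact Set.mem_image_of_mem _ ⟨by linarith, by linarith⟩
  have hset : separatrices (ellipsoid a b c) = {arcY a c 0 θ₀, arcY a c Real.pi θ₀,
      arcY a c (Real.pi / 2) (Real.pi / 2 - θ₀), arcY a c (-(Real.pi / 2)) (Real.pi / 2 - θ₀)} := by
    rw [separatrices_eq hb hab hc]
    ext C
    simp only [Set.mem_ofPred_eq, Set.mem_insert_iff, Set.mem_singleton_iff]
    constructor
    · rintro ⟨p, hp, rfl⟩
      obtain ⟨t, rfl⟩ := exists_eq_ellipseY ha hc hp.1
      rcases hcov t (fun h => hp.2 ((ellipseY_mem_umbilics_iff hb hab hc t).2 h)) with h | h | h | h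
      · exact Or.inl (h1.connectedComponentIn_eq hb hab hc
          ((ellipseY_mem_arcY_iff ha hc h1.pos h1.lt_pi).2 h))
      · exact Or.inr (Or.inl (h2.connectedComponentIn_eq hb hab hc
          ((ellipseY_mem_arcY_iff ha hc h2.pos h2.lt_pi).2 h)))
      · exact Or.inr (Or.inr (Or.inl (h3.connectedComponentIn_eq hb hab hc
          ((ellipseY_mem_arcY_iff ha hc h3.pos h3.lt_pi).2 h))))
      · exact Or.inr (Or.inr (Or.inr (h4.connectedComponentIn_eq hb hab hc
          ((ellipseY_mem_arcY_iff ha hc h4.pos h4.lt_pi).2 h))))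
    · rintro (rfl | rfl | rfl | rfl)
      · exact ⟨_, h1.subset hb hab hc (hcen h1),
          (h1.connectedComponentIn_eq hb hab hc (hcen h1)).symm⟩
      · exact ⟨_, h2.subset hb hab hc (hcen h2),
          (h2.connectedComponentIn_eq hb hab hc (hcen h2)).symm⟩
      · exact ⟨_, h3.subset hb hab hc (hcen h3),
          (h3.connectedComponentIn_eq hb hab hc (hcen h3)).symm⟩
      · exact ⟨_, h4.subset hb hab hc (hcen h4),
          (h4.connectedComponentIn_eq hb hab hc (hcen h4)).symm⟩
  -- An arc of half-width at most π/2 contains no point at angular distance π/2 or more from its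
  -- centre, and the four centres are that far apart.
  have hne : ∀ {θ h θ' h' : ℝ}, IsUmbilicArc a b c θ h → IsUmbilicArc a b c θ' h' →
      h' ≤ Real.pi / 2 → Real.cos (θ - θ') ≤ 0 → arcY a c θ h ≠ arcY a c θ' h' := by
    intro θ h θ' h' hA hA' hh hcos he
    have := (ellipseY_mem_arcY_iff ha hc hA'.pos hA'.lt_pi).1 (he ▸ hcen hA)
    have hn := Real.cos_nonneg_of_neg_pi_div_two_le_of_le
      (by have := hA'.pos; have := Real.pi_pos; linarith) hh
    linarith
  rw [hset, Set.ncard_insert_of_notMem, Set.ncard_insert_of_notMem, Set.ncard_insert_of_notMem,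
    Set.ncard_singleton]
  · simp only [Set.mem_singleton_iff]
    refine hne h3 h4 (by linarith) ?_
    rw [show Real.pi / 2 - -(Real.pi / 2) = Real.pi by ring, Real.cos_pi]; norm_num
  · simp only [Set.mem_insert_iff, Set.mem_singleton_iff, not_or]
    refine ⟨hne h2 h3 (by linarith) ?_, hne h2 h4 (by linarith) ?_⟩
    · rw [Real.cos_sub_pi_div_two, Real.sin_pi]
    · rw [sub_neg_eq_add, Real.cos_add_pi_div_two, Real.sin_pi, neg_zero]
  · simp only [Set.mem_insert_iff, Set.mem_singleton_iff, not_or]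
    refine ⟨hne h1 h2 (by linarith) ?_, hne h1 h3 (by linarith) ?_, hne h1 h4 (by linarith) ?_⟩
    · rw [Real.cos_sub_pi, Real.cos_zero]; norm_num
    · rw [Real.cos_sub_pi_div_two, Real.sin_zero]
    · rw [sub_neg_eq_add, Real.cos_add_pi_div_two, Real.sin_zero, neg_zero]

end

/-! ### The sections `x = 0` and `z = 0` -/

section
variable {a b c : ℝ}

/-- Along x = 0 both x and x' vanish, and every monomial of `prinForm` contains one of them. Umbilic
points have x ≠ 0. The section z = 0 is treated in the same way with the last coordinate. -/
theorem isPrincipalLine_section_zero (hb : 0 < b) (hab : b < a) (hc : 0 < c) :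
    IsPrincipalLine (ellipsoid a b c) (planeSection a b c 0) := by
  have ha : 0 < a := hb.trans hab
  set γ : ℝ → E3 := fun t => ![0, b * Real.cos t, c * Real.sin t] with hγ
  have hd : ∀ t, HasDerivAt γ ![0, -(b * Real.sin t), c * Real.cos t] t := by
    intro t
    refine hasDerivAt_pi.2 fun i => ?_
    fin_cases i
    · simpa [hγ] using hasDerivAt_const t (0 : ℝ)
    · simpa [hγ] using (Real.hasDerivAt_cos t).const_mul b
    · simpa [hγ] using (Real.hasDerivAt_sin t).const_mul c
  have hmem : ∀ t, γ t ∈ ellipsoid a b c := by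
    intro t
    simp only [ellipsoid, hγ, Set.mem_ofPred_eq, Matrix.cons_val]
    field_simp
    linear_combination a ^ 2 * Real.cos_sq_add_sin_sq t
  refine ⟨γ, ⟨?_, fun t => ?_, hmem, fun t hu => ?_, fun t => ?_⟩, ?_⟩
  · refine contDiff_pi.2 fun i => ?_
    fin_cases i
    · exact contDiff_const
    · exact contDiff_const.mul Real.contDiff_cos
    · exact contDiff_const.mul Real.contDiff_sin
  · rw [(hd t).deriv]
    intro h
    have h1 := congrFun h 1
    have h2 := congrFun h 2
    simp [hb.ne', hc.ne'] at h1 h2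
    have := Real.cos_sq_add_sin_sq t
    rw [h1, h2] at this
    norm_num at this
  · obtain ⟨hp, hu⟩ := (mem_umbilics_iff hb hab hc).1 hu
    exact (hu.conormal_ne hb hab hc hp).1 rfl
  · rw [(hd t).deriv]
    refine (isPrincipalVector_iff ha hb hc).2 ⟨hmem t, ?_, ?_⟩
    · simp [shapeForm, hγ]; field_simp; ring
    · simp [prinForm, hγ]
  · ext p
    constructor
    · rintro ⟨t, rfl⟩
      exact ⟨hmem t, rfl⟩
    · rintro ⟨h1, h2⟩
      have h1' : p 0 ^ 2 / a ^ 2 + p 1 ^ 2 / b ^ 2 + p 2 ^ 2 / c ^ 2 = 1 := h1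
      have h2' : p 0 = 0 := h2
      obtain ⟨θ, hcos, hsin⟩ := exists_cos_sin (x := p 1 / b) (y := p 2 / c) (by
        rw [h2'] at h1'; simp only [div_pow]; linear_combination h1')
      refine ⟨θ, ?_⟩
      ext i
      fin_cases i
      · simp [hγ, h2']
      · simp [hγ, hcos]; field_simp
      · simp [hγ, hsin]; field_simp

theorem isPrincipalLine_section_two (hb : 0 < b) (hab : b < a) (hc : 0 < c) :
    IsPrincipalLine (ellipsoid a b c) (planeSection a b c 2) := by
  have ha : 0 < a := hb.trans hab
  set γ : ℝ → E3 := fun t => ![a * Real.cos t, b * Real.sin t, 0] with hγ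
  have hd : ∀ t, HasDerivAt γ ![-(a * Real.sin t), b * Real.cos t, 0] t := by
    intro t
    refine hasDerivAt_pi.2 fun i => ?_
    fin_cases i
    · simpa [hγ] using (Real.hasDerivAt_cos t).const_mul a
    · simpa [hγ] using (Real.hasDerivAt_sin t).const_mul b
    · simpa [hγ] using hasDerivAt_const t (0 : ℝ)
  have hmem : ∀ t, γ t ∈ ellipsoid a b c := by
    intro t
    simp only [ellipsoid, hγ, Set.mem_ofPred_eq, Matrix.cons_val]
    field_simp
    linear_combination c ^ 2 * Real.cos_sq_add_sin_sq t
  refine ⟨γ, ⟨?_, fun t => ?_, hmem, fun t hu => ?_, fun t => ?_⟩, ?_⟩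
  · refine contDiff_pi.2 fun i => ?_
    fin_cases i
    · exact contDiff_const.mul Real.contDiff_cos
    · exact contDiff_const.mul Real.contDiff_sin
    · exact contDiff_const
  · rw [(hd t).deriv]
    intro h
    have h1 := congrFun h 0
    have h2 := congrFun h 1
    simp [ha.ne', hb.ne'] at h1 h2
    have := Real.cos_sq_add_sin_sq t
    rw [h1, h2] at this
    norm_num at this
  · obtain ⟨hp, hu⟩ := (mem_umbilics_iff hb hab hc).1 hu
    exact (hu.conormal_ne hb hab hc hp).2 rfl
  · rw [(hd t).deriv]
    refine (isPrincipalVector_iff ha hb hc).2 ⟨hmem t, ?_, ?_⟩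
    · simp [shapeForm, hγ]; field_simp; ring
    · simp [prinForm, hγ]
  · ext p
    constructor
    · rintro ⟨t, rfl⟩
      exact ⟨hmem t, rfl⟩
    · rintro ⟨h1, h2⟩
      have h1' : p 0 ^ 2 / a ^ 2 + p 1 ^ 2 / b ^ 2 + p 2 ^ 2 / c ^ 2 = 1 := h1
      have h2' : p 2 = 0 := h2
      obtain ⟨θ, hcos, hsin⟩ := exists_cos_sin (x := p 0 / a) (y := p 1 / b) (by
        rw [h2'] at h1'; simp only [div_pow]; linear_combination h1')
      refine ⟨θ, ?_⟩
      ext i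
      fin_cases i
      · simp [hγ, hcos]; field_simp
      · simp [hγ, hsin]; field_simp
      · simp [hγ, h2']

/-! ### The tropic -/

/-- The function under the root in `tropicCurve`. -/
def tropicRadicand (a b c t : ℝ) : ℝ :=
  Real.cos t ^ 2 / (a ^ 2 + c ^ 2) + Real.sin t ^ 2 / (b ^ 2 + c ^ 2)

/-- The component of the tropic with `s z > 0`, for `s = ± 1`. -/
def tropicCurve (a b c s t : ℝ) : E3 :=
  ![a ^ 2 / Real.sqrt (a ^ 2 + c ^ 2) * Real.cos t, b ^ 2 / Real.sqrt (b ^ 2 + c ^ 2) * Real.sin t,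
    s * (c ^ 2 * Real.sqrt (tropicRadicand a b c t))]

theorem tropicRadicand_pos (hc : 0 < c) (t : ℝ) : 0 < tropicRadicand a b c t := by
  unfold tropicRadicand
  have h := Real.cos_sq_add_sin_sq t
  by_cases h0 : Real.cos t = 0
  · rw [h0] at h ⊢
    have : Real.sin t ^ 2 = 1 := by linarith
    rw [this]; positivity
  · positivity

theorem contDiff_tropicCurve (hc : 0 < c) (s : ℝ) : ContDiff ℝ ∞ (tropicCurve a b c s) := by
  refine contDiff_pi.2 fun i => ?_
  fin_cases i
  · exact contDiff_const.mul Real.contDiff_cos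
  · exact contDiff_const.mul Real.contDiff_sin
  · exact contDiff_const.mul (contDiff_const.mul (ContDiff.sqrt
      (((Real.contDiff_cos.pow 2).div_const _).add ((Real.contDiff_sin.pow 2).div_const _))
      fun t => (tropicRadicand_pos hc t).ne'))

theorem hasDerivAt_tropicCurve (hc : 0 < c) (s t : ℝ) :
    HasDerivAt (tropicCurve a b c s)
      ![-(a ^ 2 / Real.sqrt (a ^ 2 + c ^ 2) * Real.sin t),
        b ^ 2 / Real.sqrt (b ^ 2 + c ^ 2) * Real.cos t,
        s * (c ^ 2 * (Real.cos t * Real.sin t * (1 / (b ^ 2 + c ^ 2) - 1 / (a ^ 2 + c ^ 2)) /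
          Real.sqrt (tropicRadicand a b c t)))] t := by
  refine hasDerivAt_pi.2 fun i => ?_
  fin_cases i
  · simpa [tropicCurve] using
      (Real.hasDerivAt_cos t).const_mul (a ^ 2 / Real.sqrt (a ^ 2 + c ^ 2))
  · simpa [tropicCurve] using
      (Real.hasDerivAt_sin t).const_mul (b ^ 2 / Real.sqrt (b ^ 2 + c ^ 2))
  · have h1 := (((Real.hasDerivAt_cos t).pow 2).div_const (a ^ 2 + c ^ 2)).add
      (((Real.hasDerivAt_sin t).pow 2).div_const (b ^ 2 + c ^ 2))
    have h2 := ((h1.sqrt (tropicRadicand_pos hc t).ne').const_mul (c ^ 2)).const_mul s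
    refine h2.congr_deriv ?_
    change _ = s * (c ^ 2 * (Real.cos t * Real.sin t *
      (1 / (b ^ 2 + c ^ 2) - 1 / (a ^ 2 + c ^ 2)) / Real.sqrt (tropicRadicand a b c t)))
    have hr := (Real.sqrt_pos.2 (tropicRadicand_pos (a := a) (b := b) hc t)).ne'
    change s * (c ^ 2 * (_ / (2 * Real.sqrt (tropicRadicand a b c t)))) = _
    have h3 : b ^ 2 + c ^ 2 ≠ 0 := by positivity
    have h4 : a ^ 2 + c ^ 2 ≠ 0 := by positivity
    push_cast
    field_simp
    ring

theorem tropicCurve_sq (hc : 0 < c) {s : ℝ} (hs : s ^ 2 = 1) (t : ℝ) :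
    tropicCurve a b c s t 0 ^ 2 = a ^ 4 / (a ^ 2 + c ^ 2) * Real.cos t ^ 2 ∧
    tropicCurve a b c s t 1 ^ 2 = b ^ 4 / (b ^ 2 + c ^ 2) * Real.sin t ^ 2 ∧
    tropicCurve a b c s t 2 ^ 2 = c ^ 4 * tropicRadicand a b c t := by
  have h1 : Real.sqrt (a ^ 2 + c ^ 2) ^ 2 = a ^ 2 + c ^ 2 := Real.sq_sqrt (by positivity)
  have h2 : Real.sqrt (b ^ 2 + c ^ 2) ^ 2 = b ^ 2 + c ^ 2 := Real.sq_sqrt (by positivity)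
  have h3 := Real.sq_sqrt (tropicRadicand_pos (a := a) (b := b) hc t).le
  refine ⟨?_, ?_, ?_⟩
  · simp only [tropicCurve, Matrix.cons_val, mul_pow, div_pow, h1]; ring
  · simp only [tropicCurve, Matrix.cons_val, mul_pow, div_pow, h2]; ring
  · simp only [tropicCurve, Matrix.cons_val, mul_pow, h3, hs]; ring

theorem tropicCurve_mem (ha : 0 < a) (hb : 0 < b) (hc : 0 < c) {s : ℝ} (hs : s ^ 2 = 1) (t : ℝ) :
    tropicCurve a b c s t ∈ tropic (ellipsoid a b c) := by
  obtain ⟨h0, h1, h2⟩ := tropicCurve_sq (a := a) (b := b) hc hs t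
  refine (mem_tropic_iff ha hb hc).2 ⟨?_, ?_⟩
  · change _ / _ + _ / _ + _ / _ = (1 : ℝ)
    rw [h0, h1, h2, tropicRadicand]
    field_simp
    linear_combination (a ^ 2 + c ^ 2) * (b ^ 2 + c ^ 2) * Real.cos_sq_add_sin_sq t
  · rw [div_pow, div_pow, div_pow, h0, h1, h2, tropicRadicand]
    field_simp

theorem tropicCurve_sign (hc : 0 < c) {s : ℝ} (hs : s ^ 2 = 1) (t : ℝ) :
    0 < s * tropicCurve a b c s t 2 := by
  have := Real.sqrt_pos.2 (tropicRadicand_pos (a := a) (b := b) hc t)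
  have h : s * tropicCurve a b c s t 2 =
      s ^ 2 * (c ^ 2 * Real.sqrt (tropicRadicand a b c t)) := by
    simp only [tropicCurve, Matrix.cons_val]; ring
  rw [h, hs]; positivity

/-- Eliminating z from the two equations of the tropic leaves the ellipse x²(a² + c²)/a⁴ + y²(b² +
c²)/b⁴ = 1, whose angle is the parameter; then z is determined up to sign. -/
theorem exists_eq_tropicCurve (ha : 0 < a) (hb : 0 < b) (hc : 0 < c) {p : E3}
    (hp : p ∈ tropic (ellipsoid a b c)) :
    ∃ s t : ℝ, (s = 1 ∨ s = -1) ∧ tropicCurve a b c s t = p := by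
  obtain ⟨h1, h2⟩ := (mem_tropic_iff ha hb hc).1 hp
  have h1' : p 0 ^ 2 / a ^ 2 + p 1 ^ 2 / b ^ 2 + p 2 ^ 2 / c ^ 2 = 1 := h1
  have hpa : 0 < Real.sqrt (a ^ 2 + c ^ 2) := Real.sqrt_pos.2 (by positivity)
  have hpb : 0 < Real.sqrt (b ^ 2 + c ^ 2) := Real.sqrt_pos.2 (by positivity)
  have ha2 : Real.sqrt (a ^ 2 + c ^ 2) ^ 2 = a ^ 2 + c ^ 2 := Real.sq_sqrt (by positivity)
  have hb2 : Real.sqrt (b ^ 2 + c ^ 2) ^ 2 = b ^ 2 + c ^ 2 := Real.sq_sqrt (by positivity)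
  have hz : p 2 ^ 2 / c ^ 2 = c ^ 2 * ((p 0 / a ^ 2) ^ 2 + (p 1 / b ^ 2) ^ 2) := by
    rw [h2]; field_simp
  obtain ⟨θ, hcos, hsin⟩ := exists_cos_sin (x := p 0 * Real.sqrt (a ^ 2 + c ^ 2) / a ^ 2)
    (y := p 1 * Real.sqrt (b ^ 2 + c ^ 2) / b ^ 2) (by
      rw [div_pow, div_pow, mul_pow, mul_pow, ha2, hb2]
      rw [← h1', hz]
      field_simp
      ring)
  have hz2 : p 2 ^ 2 = (c ^ 2 * Real.sqrt (tropicRadicand a b c θ)) ^ 2 := by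
    rw [mul_pow, Real.sq_sqrt (tropicRadicand_pos hc θ).le, tropicRadicand, hcos, hsin, div_pow,
      div_pow, mul_pow, mul_pow, ha2, hb2]
    have : p 2 ^ 2 = c ^ 2 * (p 2 ^ 2 / c ^ 2) := by field_simp
    rw [this, hz]
    field_simp
  have hx : a ^ 2 / Real.sqrt (a ^ 2 + c ^ 2) * Real.cos θ = p 0 := by rw [hcos]; field_simp
  have hy : b ^ 2 / Real.sqrt (b ^ 2 + c ^ 2) * Real.sin θ = p 1 := by rw [hsin]; field_simp
  have key : ∀ s : ℝ, s * (c ^ 2 * Real.sqrt (tropicRadicand a b c θ)) = p 2 →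
      tropicCurve a b c s θ = p := by
    intro s hs
    ext i
    fin_cases i
    · simpa [tropicCurve] using hx
    · simpa [tropicCurve] using hy
    · simpa [tropicCurve] using hs
  rcases sq_eq_sq_iff_eq_or_eq_neg.1 hz2 with h | h
  · exact ⟨1, θ, Or.inl rfl, key 1 (by rw [h, one_mul])⟩
  · exact ⟨-1, θ, Or.inr rfl, key (-1) (by rw [h, neg_one_mul])⟩

theorem deriv_tropicCurve_ne (ha : 0 < a) (hb : 0 < b) (hc : 0 < c) (s t : ℝ) :
    deriv (tropicCurve a b c s) t ≠ 0 := by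
  have hpa : 0 < Real.sqrt (a ^ 2 + c ^ 2) := Real.sqrt_pos.2 (by positivity)
  have hpb : 0 < Real.sqrt (b ^ 2 + c ^ 2) := Real.sqrt_pos.2 (by positivity)
  rw [(hasDerivAt_tropicCurve hc s t).deriv]
  intro h
  have h1 := congrFun h 0
  have h2 := congrFun h 1
  simp [ha.ne', hb.ne', hpa.ne', hpb.ne'] at h1 h2
  have := Real.cos_sq_add_sin_sq t
  rw [h1, h2] at this
  norm_num at this

/-- Geometrically, differentiating n₀² + n₁² = n₂² along the tropic gives Jn·Sw = 0; moreover Jn·Jw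
= n·w = 0 and Jn·n = 0. So n, Jw, Sw are linearly dependent and their determinant Q(w) is zero.
Below this is checked on the parametrization. -/
theorem isPrincipalLine_tropicCurve (hb : 0 < b) (hab : b < a) (hc : 0 < c) {s : ℝ}
    (hs : s ^ 2 = 1) : IsPrincipalLine (ellipsoid a b c) (Set.range (tropicCurve a b c s)) := by
  have ha : 0 < a := hb.trans hab
  have hmem := fun t => (mem_tropic_iff ha hb hc).1 (tropicCurve_mem ha hb hc hs t)
  refine ⟨_, ⟨contDiff_tropicCurve hc s, deriv_tropicCurve_ne ha hb hc s, fun t => (hmem t).1,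
    fun t hu => ?_, fun t => ?_⟩, rfl⟩
  · obtain ⟨hp, hu⟩ := (mem_umbilics_iff hb hab hc).1 hu
    exact (hu.conormal_timelike hb hab hc hp).ne (hmem t).2
  · refine (isPrincipalVector_iff ha hb hc).2 ⟨(hmem t).1, ?_⟩
    have hr := Real.sqrt_pos.2 (tropicRadicand_pos (a := a) (b := b) hc t)
    have hr2 := Real.sq_sqrt (tropicRadicand_pos (a := a) (b := b) hc t).le
    have hpa : 0 < Real.sqrt (a ^ 2 + c ^ 2) := Real.sqrt_pos.2 (by positivity)
    have hpb : 0 < Real.sqrt (b ^ 2 + c ^ 2) := Real.sqrt_pos.2 (by positivity)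
    have ha2 : Real.sqrt (a ^ 2 + c ^ 2) ^ 2 = a ^ 2 + c ^ 2 := Real.sq_sqrt (by positivity)
    have hb2 : Real.sqrt (b ^ 2 + c ^ 2) ^ 2 = b ^ 2 + c ^ 2 := Real.sq_sqrt (by positivity)
    rw [(hasDerivAt_tropicCurve hc s t).deriv]
    simp only [shapeForm, prinForm, tropicCurve, Matrix.cons_val]
    set r := Real.sqrt (tropicRadicand a b c t)
    set P := Real.sqrt (a ^ 2 + c ^ 2)
    set R := Real.sqrt (b ^ 2 + c ^ 2)
    rw [tropicRadicand, ← ha2, ← hb2] at hr2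
    rw [← ha2, ← hb2]
    constructor
    · field_simp
      rw [hs]
      linear_combination (Real.cos t * Real.sin t) * (R ^ 2 * ha2 - P ^ 2 * hb2)
    · field_simp at hr2 ⊢
      have hba : a ^ 2 - b ^ 2 = P ^ 2 - R ^ 2 := by rw [ha2, hb2]; ring
      rw [hba, hr2, show c ^ 2 + b ^ 2 = R ^ 2 by rw [hb2]; ring,
        show c ^ 2 + a ^ 2 = P ^ 2 by rw [ha2]; ring]
      ring

theorem isRegularClosedCurve_tropicCurve (ha : 0 < a) (hb : 0 < b) (hc : 0 < c) (s : ℝ) :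
    IsRegularClosedCurve (Set.range (tropicCurve a b c s)) := by
  have hpa : 0 < Real.sqrt (a ^ 2 + c ^ 2) := Real.sqrt_pos.2 (by positivity)
  have hpb : 0 < Real.sqrt (b ^ 2 + c ^ 2) := Real.sqrt_pos.2 (by positivity)
  refine ⟨_, 2 * Real.pi, Real.two_pi_pos, contDiff_tropicCurve hc s, fun t => ?_,
    deriv_tropicCurve_ne ha hb hc s, fun t ht t' ht' h => ?_, rfl⟩
  · simp only [tropicCurve, tropicRadicand, Real.cos_add_two_pi, Real.sin_add_two_pi]
  · have h0 := congrFun h 0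
    have h1 := congrFun h 1
    simp [tropicCurve, ha.ne', hb.ne', hpa.ne', hpb.ne'] at h0 h1
    -- The first two coordinates already determine cos t and sin t, and |t - t'| < 2π.
    have hcos : Real.cos (t - t') = 1 := by
      rw [Real.cos_sub, h0, h1]
      linear_combination Real.cos_sq_add_sin_sq t'
    have := (Real.cos_eq_one_iff_of_lt_of_lt (by linarith [ht.1, ht'.2])
      (by linarith [ht.2, ht'.1])).1 hcos
    linarith

theorem exists_tropic_curves (hb : 0 < b) (hab : b < a) (hc : 0 < c) :
    ∃ C₁ C₂ : Set E3, tropic (ellipsoid a b c) = C₁ ∪ C₂ ∧ Disjoint C₁ C₂ ∧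
      IsRegularClosedCurve C₁ ∧ IsRegularClosedCurve C₂ ∧
      IsPrincipalLine (ellipsoid a b c) C₁ ∧ IsPrincipalLine (ellipsoid a b c) C₂ := by
  have ha : 0 < a := hb.trans hab
  have h1 : (1:ℝ) ^ 2 = 1 := one_pow 2
  have h2 : (-1:ℝ) ^ 2 = 1 := by norm_num
  refine ⟨Set.range (tropicCurve a b c 1), Set.range (tropicCurve a b c (-1)), ?_, ?_,
    isRegularClosedCurve_tropicCurve ha hb hc _, isRegularClosedCurve_tropicCurve ha hb hc _,
    isPrincipalLine_tropicCurve hb hab hc h1, isPrincipalLine_tropicCurve hb hab hc h2⟩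
  · ext p
    constructor
    · intro hp
      obtain ⟨s, t, rfl | rfl, ht⟩ := exists_eq_tropicCurve ha hb hc hp
      · exact Or.inl ⟨t, ht⟩
      · exact Or.inr ⟨t, ht⟩
    · rintro (⟨t, rfl⟩ | ⟨t, rfl⟩)
      · exact tropicCurve_mem ha hb hc h1 t
      · exact tropicCurve_mem ha hb hc h2 t
  · rw [Set.disjoint_left]
    rintro p ⟨t, rfl⟩ ⟨t', ht'⟩
    have e1 := tropicCurve_sign (a := a) (b := b) hc h1 t
    have e2 := tropicCurve_sign (a := a) (b := b) hc h2 t'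
    rw [ht'] at e2
    linarith

end

end Mink

end

theorem mainTheorem1 (a b c : ℝ) (hb : 0 < b) (hab : b < a) (hc : 0 < c) :
    -- (a) the sections `x = 0` and `z = 0` are principal lines
    (Mink.IsPrincipalLine (Mink.ellipsoid a b c) (Mink.planeSection a b c 0) ∧
      Mink.IsPrincipalLine (Mink.ellipsoid a b c) (Mink.planeSection a b c 2)) ∧
    -- (b) there are exactly four spacelike umbilic points, and no other umbilic points
    (Mink.spacelikeUmbilics (Mink.ellipsoid a b c) = Mink.fourPoints a b c ∧
      (Mink.fourPoints a b c).ncard = 4 ∧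
      Mink.umbilics (Mink.ellipsoid a b c) = Mink.fourPoints a b c) ∧
    -- (c) they are Darbouxian of type `D₁`
    (∀ p ∈ Mink.umbilics (Mink.ellipsoid a b c),
      Mink.IsDarbouxianD1 (Mink.ellipsoid a b c) p) ∧
    -- (d) the section `y = 0` is the union of the umbilic points and of four principal lines, the
    -- connected components of the rest, and these are exactly the separatrices
    (Mink.planeSection a b c 1 = Mink.umbilics (Mink.ellipsoid a b c) ∪
        ⋃₀ Mink.separatrices (Mink.ellipsoid a b c) ∧
      Mink.separatrices (Mink.ellipsoid a b c) =
        {C | ∃ p ∈ Mink.planeSection a b c 1 \ Mink.umbilics (Mink.ellipsoid a b c),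
          C = connectedComponentIn
            (Mink.planeSection a b c 1 \ Mink.umbilics (Mink.ellipsoid a b c)) p} ∧
      (Mink.separatrices (Mink.ellipsoid a b c)).ncard = 4) ∧
    -- (e) the tropic consists of two disjoint regular closed curves that are principal lines
    (∃ C₁ C₂ : Set Mink.E3, Mink.tropic (Mink.ellipsoid a b c) = C₁ ∪ C₂ ∧ Disjoint C₁ C₂ ∧
      Mink.IsRegularClosedCurve C₁ ∧ Mink.IsRegularClosedCurve C₂ ∧
      Mink.IsPrincipalLine (Mink.ellipsoid a b c) C₁ ∧
      Mink.IsPrincipalLine (Mink.ellipsoid a b c) C₂) ∧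
    -- (f) `LPL` is empty, and there are exactly two principal directions at every point that is
    -- not umbilic
    (Mink.LPL (Mink.ellipsoid a b c) = ∅ ∧
      ∀ p ∈ Mink.ellipsoid a b c, p ∉ Mink.umbilics (Mink.ellipsoid a b c) →
        ∃ w₁ w₂ : Mink.E3, LinearIndependent ℝ ![w₁, w₂] ∧
          ∀ w : Mink.E3, Mink.IsPrincipalVector (Mink.ellipsoid a b c) p w ↔
            ∃ r : ℝ, w = r • w₁ ∨ w = r • w₂) := by
  exact ⟨⟨Mink.isPrincipalLine_section_zero hb hab hc, Mink.isPrincipalLine_section_two hb hab hc⟩,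
    ⟨(Mink.spacelikeUmbilics_eq hb hab hc).trans (Mink.umbilics_eq hb hab hc),
      Mink.ncard_fourPoints hb hab hc, Mink.umbilics_eq hb hab hc⟩,
    fun p hp => Mink.isDarbouxianD1_of_umbilic hb hab hc
      ((Mink.mem_umbilics_iff hb hab hc).1 hp).1 ((Mink.mem_umbilics_iff hb hab hc).1 hp).2,
    ⟨Mink.planeSection_one_eq hb hab hc, Mink.separatrices_eq hb hab hc,
      Mink.ncard_separatrices hb hab hc⟩,
    Mink.exists_tropic_curves hb hab hc,
    ⟨Mink.LPL_eq_empty hb hab hc,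
      fun _ hp hu => Mink.exists_principal_directions hb hab hc hp hu⟩⟩
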